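/- Let $(M,g)$ be a smooth Riemannian $n$-manifold, let $\alpha$ be a smooth $q$-form on $M$ which is a semi-calibration, i.e. $\alpha|_\pi\le \mathrm{vol}_\pi$ for every oriented tangent $q$-plane $\pi$, and let $H$ be a smooth $q$-dimensional distribution on $M$ that is calibrated, and thereby oriented, by $\alpha$, i.e. $\alpha|_{H_x}=\mathrm{vol}_{H_x}$ for all $x\in M$. Let $V=H^\perp$, let $p_H,p_V$ be the orthogonal projections onto $H,V$, and write $\alpha=\sum_{i=0}^q\alpha_i$ with $\alpha_i\in\Gamma(\Lambda^{q-i}H^*\otimes\Lambda^iV^*)$. An oriented $q$-plane $\pi\subset T_xM$ is called positive horizontally projectable if $p_H|_\pi:\pi\to H_x$ is an orientation-preserving isomorphism. For such $\pi$ put $g^H_\pi=(p_H|_\pi)^*g$, let $\mathrm{vol}^H_\pi$ be the volume form of $g^H_\pi$ on the oriented plane $\pi$, and let $$ve(\pi)=\tfrac12\bigl|p_V|_\pi\bigr|^2_{g^H_\pi\otimes g},\qquad f(\pi)=ve(\pi)\,\frac{\mathrm{vol}^H_\pi}{\mathrm{vol}_\pi}.$$ Let $\Sigma$ be a compact oriented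 smooth $q$-manifold without boundary. An immersion $\iota:\Sigma\to M$ is positive horizontally projectable if all its oriented tangent planes $\iota_*(T_\sigma\Sigma)$ are; for such $\iota$, with $\mathrm{vol}^H_\iota$ and $ve(\iota)$ given at $\sigma\in\Sigma$ by the plane $\pi=\iota_*(T_\sigma\Sigma)$, put $$\mathrm{Vol}^H(\iota)=\int_\Sigma \mathrm{vol}^H_\iota,\qquad VE(\iota)=\int_\Sigma ve(\iota)\,\mathrm{vol}^H_\iota .$$ A positive horizontally projectable immersion $\iota$ is called $f$-calibrated if $\alpha_2|_\pi=f(\pi)\,\mathrm{vol}_\pi$ for every tangent plane $\pi=\iota_*(T_\sigma\Sigma)$. Two immersions $\iota,\iota'$ of $\Sigma$ are homologous if $\iota_*[\Sigma]=\iota'_*[\Sigma]$ in $H_q(M;\mathbb R)$ (smooth singular homology; this holds in particular if the classes agree in $H_q(M;\mathbb Z)$). (1) Suppose that $\alpha=\alpha_0+\alpha_2$ and $d\alpha=0$. Then every $f$-calibrated immersion $\iota:\Sigma\to M$ of a compact oriented $q$-manifold minimizes $VE+\mathrm{Vol}^H$ in its restricted homology class: $VE(\iota)+\mathrm{Vol}^H(\iota)\le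 VE(\iota')+\mathrm{Vol}^H(\iota')$ for every positive horizontally projectable immersion $\iota':\Sigma\to M$ homologous to $\iota$. (2) Let $M$ be a $7$-manifold with a smooth $G_2$-structure $\varphi\in\Omega^3(M)$, i.e. at each point $\varphi$ corresponds under some linear isomorphism $T_xM\cong\mathbb R^7$ to $$\varphi_0=dx_{123}+dx_{145}+dx_{167}+dx_{246}-dx_{257}-dx_{347}-dx_{356},$$ and let $g$ be the induced metric, i.e. the one corresponding to the standard inner product. Let $H$ be a smooth $3$-dimensional distribution calibrated by $\varphi$ (an associative distribution). Then $\varphi=\varphi_0^{H}+\varphi_2^{H}=\underline\lambda+\underline\omega$, where $\varphi_i^{H}$ denotes the component of $\varphi$ in $\Gamma(\Lambda^{3-i}H^*\otimes\Lambda^iV^*)$, $\underline\lambda=\varphi_0^H$ and $\underline\omega=\varphi_2^H$. If moreover $d\varphi=0$, then every Fueter immersion $\iota:\Sigma\to M$ of a compact oriented $3$-manifold, i.e. every positive horizontally projectable immersion whose tangent planes satisfy $\underline\omega|_\pi=f(\pi)\,\mathrm{vol}_\pi$, minimizes $VE+\mathrm{Vol}^H$ in its restricted homology class. -/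

import Mathlib

open Set Module MeasureTheory
open scoped Manifold ContDiff Topology Bundle

noncomputable section

/-! ### Linear algebra of oriented planes -/

section LinearAlgebra

/-- The sign (`1`, `0` or `-1`) of a `k`-tuple of vectors with respect to an orientation: it is `1` on
positive bases, `-1` on negative bases, and `0` on linearly dependent tuples (for `k = dim W`). -/
def Orientation.frameSign {W : Type*} [AddCommGroup W] [Module ℝ W] {k : ℕ}
    (o : Orientation ℝ W (Fin k)) (v : Fin k → W) : ℝ :=
  (SignType.sign (o.someVector v) : ℝ)

/-- The volume form of a `k`-dimensional oriented vector space with inner product `b`: the top-degree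
form that is positive for the orientation and has unit norm for `b`. -/
def Orientation.volOf {W : Type*} [AddCommGroup W] [Module ℝ W] {k : ℕ}
    (o : Orientation ℝ W (Fin k)) (b : W → W → ℝ) (v : Fin k → W) : ℝ :=
  o.frameSign v * √ (Matrix.of fun i j => b (v i) (v j)).det

/-- An oriented `k`-plane in `W`, i.e. a point of the oriented Grassmannian. -/
structure OrientedPlane (W : Type*) [AddCommGroup W] [Module ℝ W] (k : ℕ) where
  carrier : Submodule ℝ W
  finrank_eq : finrank ℝ carrier = k
  orientation : Orientation ℝ carrier (Fin k)

namespace OrientedPlane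

variable {W : Type*} [NormedAddCommGroup W] [InnerProductSpace ℝ W] [FiniteDimensional ℝ W] {k : ℕ}

/-- Some basis of the plane. -/
def basis (P : OrientedPlane W k) : Basis (Fin k) ℝ P.carrier :=
  finBasisOfFinrankEq ℝ P.carrier P.finrank_eq

/-- The volume form `vol_P` induced by the ambient inner product and the orientation. -/
def vol (P : OrientedPlane W k) (v : Fin k → P.carrier) : ℝ :=
  P.orientation.volOf (fun a b => inner ℝ (a : W) (b : W)) v

/-- `α|_P ≤ c vol_P`, as multiples of the positive form `vol_P`. -/
def RestrictLE (P : OrientedPlane W k) (α : MultilinearMap ℝ (fun _ : Fin k => W) ℝ) (c : ℝ) : Prop :=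
  ∀ v : Fin k → P.carrier, P.orientation.frameSign v = 1 → α (fun i => (v i : W)) ≤ c * P.vol v

/-- `α|_P = c vol_P`. -/
def RestrictEq (P : OrientedPlane W k) (α : MultilinearMap ℝ (fun _ : Fin k => W) ℝ) (c : ℝ) : Prop :=
  ∀ v : Fin k → P.carrier, α (fun i => (v i : W)) = c * P.vol v

/-- The orthogonal projection `p_H` onto the plane `H`. -/
def projH (H : OrientedPlane W k) : W →L[ℝ] W := H.carrier.starProjection

/-- The orthogonal projection `p_V` onto the orthogonal complement `V` of `H`. -/
def projV (H : OrientedPlane W k) : W →L[ℝ] W := H.carrierᗮ.starProjection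

/-- `P` is positive horizontally projectable: `p_H` restricts to an orientation-preserving
isomorphism `P → H`. -/
def PosProjectable (H P : OrientedPlane W k) : Prop :=
  ∃ e : P.carrier ≃ₗ[ℝ] H.carrier, (∀ v : P.carrier, (e v : W) = H.projH v) ∧
    Orientation.map (Fin k) e P.orientation = H.orientation

/-- The horizontal inner product `g^H_P = (p_H|_P)^* g`. -/
def innerH (H P : OrientedPlane W k) (v w : P.carrier) : ℝ := inner ℝ (H.projH v) (H.projH w)

/-- The horizontal volume form `vol^H_P`. -/
def volH (H P : OrientedPlane W k) (v : Fin k → P.carrier) : ℝ :=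
  P.orientation.volOf (H.innerH P) v

/-- Half the squared norm of `p_V|_P` with respect to `g^H_P` on `P` and `g` on `V`, written in a basis
`v` of `P`: `½ ∑ (G⁻¹)_{ij} g(p_V v_j, p_V v_i)`, where `G` is the Gram matrix of `g^H_P`. -/
def veIn (H P : OrientedPlane W k) (v : Fin k → P.carrier) : ℝ :=
  (1 / 2) * ((Matrix.of fun i j => H.innerH P (v i) (v j))⁻¹ *
    (Matrix.of fun i j => inner ℝ (H.projV (v i)) (H.projV (v j)))).trace

/-- The vertical energy density `ve(P) = ½ |p_V|_P|²` with respect to `g^H_P` and `g`. -/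
def ve (H P : OrientedPlane W k) : ℝ := H.veIn P P.basis

/-- The weight `f(P) = ve(P) vol^H_P / vol_P`; the quotient of the two top-degree forms is evaluated in
a basis. -/
def weight (H P : OrientedPlane W k) : ℝ :=
  H.ve P * (H.volH P P.basis / P.vol P.basis)

/-- The component `α_i ∈ Λ^{k-i} H^* ⊗ Λ^i V^*` of a `k`-form `α`: vertical projections are inserted in
exactly `i` slots and horizontal projections in the others, in all possible ways. -/
def component (H : OrientedPlane W k) (α : W [⋀^Fin k]→L[ℝ] ℝ) (i : ℕ) :
    MultilinearMap ℝ (fun _ : Fin k => W) ℝ :=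
  ∑ s ∈ Finset.powersetCard i (Finset.univ : Finset (Fin k)),
    α.toMultilinearMap.compLinearMap
      (fun j => if j ∈ s then (H.projV : W →ₗ[ℝ] W) else (H.projH : W →ₗ[ℝ] W))

/-- The value of the formula for the vertical energy does not depend on the basis. -/
theorem veIn_basis_eq (H P : OrientedPlane W k) (v w : Basis (Fin k) ℝ P.carrier) :
    H.veIn P v = H.veIn P w := by
  have key : ∀ (p : W →L[ℝ] W), (Matrix.of fun i j => inner ℝ (p (v i)) (p (v j)))
      = (w.toMatrix v).transpose * (Matrix.of fun i j => inner ℝ (p (w i)) (p (w j)))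
        * w.toMatrix v := by
    intro p
    ext i j
    have hexp : ∀ a, p (v a) = ∑ l, w.toMatrix v l a • p (w l) := by
      intro a
      conv_lhs => rw [← w.sum_toMatrix_smul_self v a]
      simp only [Submodule.coe_sum, Submodule.coe_smul, map_sum, map_smul]
    simp only [Matrix.of_apply, Matrix.mul_apply, Matrix.transpose_apply, hexp i, hexp j]
    simp only [sum_inner, inner_sum, real_inner_smul_left, real_inner_smul_right, Finset.sum_mul]
    refine Finset.sum_congr rfl fun a _ => Finset.sum_congr rfl fun b _ => ?_
    ring
  have hP : IsUnit (w.toMatrix v) := by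
    have := Basis.invertibleToMatrix w v
    exact isUnit_of_invertible _
  have hPd : IsUnit (w.toMatrix v).det := (Matrix.isUnit_iff_isUnit_det _).1 hP
  have hPt : IsUnit (w.toMatrix v).transpose.det := by rwa [Matrix.det_transpose]
  unfold veIn innerH
  rw [key H.projH, key H.projV, Matrix.mul_inv_rev, Matrix.mul_inv_rev]
  generalize (Matrix.of fun i j => inner ℝ (H.projH (w i)) (H.projH (w j))) = G
  generalize (Matrix.of fun i j => inner ℝ (H.projV (w i)) (H.projV (w j))) = A
  congr 1
  have h1 : (w.toMatrix v)⁻¹ * (G⁻¹ * (w.toMatrix v).transpose⁻¹) *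
      ((w.toMatrix v).transpose * A * w.toMatrix v) =
      (w.toMatrix v)⁻¹ * (G⁻¹ * A * w.toMatrix v) := by
    simp only [Matrix.mul_assoc]
    rw [Matrix.nonsing_inv_mul_cancel_left _ _ hPt]
  rw [h1, Matrix.trace_mul_comm, Matrix.mul_assoc, Matrix.mul_nonsing_inv _ hPd, Matrix.mul_one]

/-- In a basis that is orthonormal for `g^H_P`, `ve(P) = ½ ∑ |p_V v_i|²`. -/
theorem ve_eq_of_orthonormal (H P : OrientedPlane W k) (v : Basis (Fin k) ℝ P.carrier)
    (hv : ∀ i j, H.innerH P (v i) (v j) = if i = j then 1 else 0) :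
    H.ve P = (1 / 2) * ∑ i, ‖H.projV (v i)‖ ^ 2 := by
  have h1 : (Matrix.of fun i j => H.innerH P (v i) (v j)) = (1 : Matrix (Fin k) (Fin k) ℝ) := by
    ext i j
    simp [hv, Matrix.one_apply]
  rw [ve, veIn_basis_eq H P P.basis v, veIn, h1]
  simp [Matrix.trace]

end OrientedPlane

end LinearAlgebra

/-! ### Differential forms and distributions on a manifold -/

section Forms

variable {n : ℕ} {M : Type*} [TopologicalSpace M] [ChartedSpace (EuclideanSpace ℝ (Fin n)) M]
  [IsManifold (𝓡 n) ∞ M]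

/-- The expression of a `k`-form in the chart centred at `x₀`. -/
def formInChart {k : ℕ} (α : ∀ x : M, TangentSpace (𝓡 n) x [⋀^Fin k]→L[ℝ] ℝ) (x₀ : M)
    (y : EuclideanSpace ℝ (Fin n)) : EuclideanSpace ℝ (Fin n) [⋀^Fin k]→L[ℝ] ℝ :=
  (α ((extChartAt (𝓡 n) x₀).symm y)).compContinuousLinearMap
    (mfderiv 𝓘(ℝ, EuclideanSpace ℝ (Fin n)) (𝓡 n) (extChartAt (𝓡 n) x₀).symm y)

/-- A smooth differential `k`-form. -/
def IsSmoothForm {k : ℕ} (α : ∀ x : M, TangentSpace (𝓡 n) x [⋀^Fin k]→L[ℝ] ℝ) : Prop :=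
  ∀ x₀ : M, ContDiffOn ℝ ∞ (formInChart α x₀) (extChartAt (𝓡 n) x₀).target

/-- `dα = 0`, checked in charts. -/
def IsClosedForm {k : ℕ} (α : ∀ x : M, TangentSpace (𝓡 n) x [⋀^Fin k]→L[ℝ] ℝ) : Prop :=
  ∀ x₀ : M, ∀ y ∈ (extChartAt (𝓡 n) x₀).target, extDeriv (formInChart α x₀) y = 0

/-- The family of planes `H` is a smooth distribution: locally spanned by smooth vector fields. -/
def IsSmoothDistribution {k : ℕ} (H : ∀ x : M, OrientedPlane (TangentSpace (𝓡 n) x) k) : Prop :=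
  ∀ x₀ : M, ∃ U ∈ 𝓝 x₀, ∃ X : Fin k → ∀ x : M, TangentSpace (𝓡 n) x,
    (∀ i, ContMDiffOn (𝓡 n) (𝓡 n).tangent ∞ (fun x => (⟨x, X i x⟩ : TangentBundle (𝓡 n) M)) U) ∧
    ∀ x ∈ U, Submodule.span ℝ (range fun i => X i x) = (H x).carrier

end Forms

section Riemannian

variable {n : ℕ} {M : Type*} [TopologicalSpace M] [ChartedSpace (EuclideanSpace ℝ (Fin n)) M]
  [IsManifold (𝓡 n) ∞ M] [Bundle.RiemannianBundle (fun x : M => TangentSpace (𝓡 n) x)]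

instance (x : M) : FiniteDimensional ℝ (TangentSpace (𝓡 n) x) :=
  inferInstanceAs (FiniteDimensional ℝ (EuclideanSpace ℝ (Fin n)))

/-- `α` is a semi-calibration: `α|_P ≤ vol_P` for every oriented tangent `k`-plane `P`. -/
def IsSemiCalibration {k : ℕ} (α : ∀ x : M, TangentSpace (𝓡 n) x [⋀^Fin k]→L[ℝ] ℝ) : Prop :=
  ∀ (x : M) (P : OrientedPlane (TangentSpace (𝓡 n) x) k), P.RestrictLE (α x).toMultilinearMap 1

/-- The distribution `H` is calibrated by `α`, and oriented by it: `α|_H = vol_H` at each point. -/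
def IsCalibratedDistribution {k : ℕ} (α : ∀ x : M, TangentSpace (𝓡 n) x [⋀^Fin k]→L[ℝ] ℝ)
    (H : ∀ x : M, OrientedPlane (TangentSpace (𝓡 n) x) k) : Prop :=
  IsSmoothDistribution H ∧ ∀ x : M, (H x).RestrictEq (α x).toMultilinearMap 1

/-- `α = α₀ + α₂` in the decomposition of `k`-forms induced by `TM = H ⊕ V`. -/
def IsZeroPlusTwo {k : ℕ} (α : ∀ x : M, TangentSpace (𝓡 n) x [⋀^Fin k]→L[ℝ] ℝ)
    (H : ∀ x : M, OrientedPlane (TangentSpace (𝓡 n) x) k) : Prop :=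
  ∀ x : M, (α x).toMultilinearMap = (H x).component (α x) 0 + (H x).component (α x) 2

end Riemannian

/-! ### Oriented manifolds and integration of top-degree forms -/

section Integration

variable {q : ℕ} (S : Type*) [TopologicalSpace S] [ChartedSpace (EuclideanSpace ℝ (Fin q)) S]

/-- The coordinate frame of the chart centred at `x₀`, at the point with coordinates `y`. -/
def chartFrame {S : Type*} [TopologicalSpace S] [ChartedSpace (EuclideanSpace ℝ (Fin q)) S]
    (x₀ : S) (y : EuclideanSpace ℝ (Fin q)) (i : Fin q) :
    TangentSpace (𝓡 q) ((extChartAt (𝓡 q) x₀).symm y) :=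
  mfderiv 𝓘(ℝ, EuclideanSpace ℝ (Fin q)) (𝓡 q) (extChartAt (𝓡 q) x₀).symm y
    (EuclideanSpace.single i (1 : ℝ))

/-- An orientation of the `q`-manifold `S`: orientations of all tangent spaces such that each
coordinate frame has locally constant sign. -/
structure ManifoldOrientation (q : ℕ) (S : Type*) [TopologicalSpace S]
    [ChartedSpace (EuclideanSpace ℝ (Fin q)) S] where
  orient : ∀ x : S, Orientation ℝ (TangentSpace (𝓡 q) x) (Fin q)
  locally_const : ∀ x₀ : S, ∀ᶠ y in 𝓝 (extChartAt (𝓡 q) x₀ x₀),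
    (orient ((extChartAt (𝓡 q) x₀).symm y)).frameSign (chartFrame x₀ y) =
      (orient ((extChartAt (𝓡 q) x₀).symm (extChartAt (𝓡 q) x₀ x₀))).frameSign
        (chartFrame x₀ (extChartAt (𝓡 q) x₀ x₀))

/-- A smooth partition of unity subordinate to the domains of the charts. -/
def chartPartition [CompactSpace S] [T2Space S] [IsManifold (𝓡 q) ∞ S] :
    SmoothPartitionOfUnity S (𝓡 q) S univ :=
  Classical.choose (SmoothPartitionOfUnity.exists_isSubordinate_chartAt_source (𝓡 q) S)

/-- The integral over a compact oriented `q`-manifold of a top-degree form, given by its values on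
frames: the sum over a partition of unity of integrals in charts, each with the sign of the chart. -/
def integrateTop {S : Type*} [TopologicalSpace S] [ChartedSpace (EuclideanSpace ℝ (Fin q)) S]
    [CompactSpace S] [T2Space S] [IsManifold (𝓡 q) ∞ S] (o : ManifoldOrientation q S)
    (η : ∀ x : S, (Fin q → TangentSpace (𝓡 q) x) → ℝ) : ℝ :=
  ∑ᶠ x₀ : S, ∫ y in (extChartAt (𝓡 q) x₀).target,
    chartPartition (q := q) S x₀ ((extChartAt (𝓡 q) x₀).symm y) *
      ((o.orient ((extChartAt (𝓡 q) x₀).symm y)).frameSign (chartFrame x₀ y) *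
        η ((extChartAt (𝓡 q) x₀).symm y) (chartFrame x₀ y))

end Integration

/-! ### Smooth singular homology -/

section Homology

/-- A smooth singular `k`-simplex in `M`: a map on the standard simplex that extends smoothly to an open
neighbourhood of the simplex. -/
structure SmoothSimplex (n : ℕ) (M : Type*) [TopologicalSpace M]
    [ChartedSpace (EuclideanSpace ℝ (Fin n)) M] (k : ℕ) where
  toFun : stdSimplex ℝ (Fin (k + 1)) → M
  exists_extension : ∃ (U : Set (Fin (k + 1) → ℝ)) (F : (Fin (k + 1) → ℝ) → M), IsOpen U ∧
    stdSimplex ℝ (Fin (k + 1)) ⊆ U ∧ ContMDiffOn 𝓘(ℝ, Fin (k + 1) → ℝ) (𝓡 n) ∞ F U ∧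
    ∀ t : stdSimplex ℝ (Fin (k + 1)), F t = toFun t

variable {n : ℕ} {M : Type*} [TopologicalSpace M] [ChartedSpace (EuclideanSpace ℝ (Fin n)) M]
  {q : ℕ} {S : Type*} [TopologicalSpace S] [ChartedSpace (EuclideanSpace ℝ (Fin q)) S] {k : ℕ}

/-- The `i`-th face of a smooth simplex (opposite to the vertex `i`). -/
def SmoothSimplex.face (σ : SmoothSimplex n M (k + 1)) (i : Fin (k + 2)) : SmoothSimplex n M k where
  toFun t := σ.toFun (stdSimplex.map i.succAbove t)
  exists_extension := by
    obtain ⟨U, F, hU, hsub, hF, hFσ⟩ := σ.exists_extension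
    let L : (Fin (k + 1) → ℝ) →L[ℝ] (Fin (k + 2) → ℝ) :=
      LinearMap.toContinuousLinearMap (FunOnFinite.linearMap ℝ ℝ i.succAbove)
    refine ⟨L ⁻¹' U, F ∘ L, hU.preimage L.continuous, ?_, ?_, ?_⟩
    · intro t ht
      exact hsub (stdSimplex.map i.succAbove ⟨t, ht⟩).2
    · exact hF.comp L.contMDiff.contMDiffOn (fun t ht => ht)
    · intro t
      exact hFσ (stdSimplex.map i.succAbove t)

/-- The composition of a smooth simplex with a smooth map. -/
def SmoothSimplex.push (σ : SmoothSimplex q S k) (f : S → M) (hf : ContMDiff (𝓡 q) (𝓡 n) ∞ f) :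
    SmoothSimplex n M k where
  toFun t := f (σ.toFun t)
  exists_extension := by
    obtain ⟨U, F, hU, hsub, hF, hFσ⟩ := σ.exists_extension
    exact ⟨U, f ∘ F, hU, hsub, hf.comp_contMDiffOn hF, fun t => by simp [hFσ t]⟩

/-- Smooth singular `k`-chains with real coefficients. -/
abbrev SmoothChain (n : ℕ) (M : Type*) [TopologicalSpace M]
    [ChartedSpace (EuclideanSpace ℝ (Fin n)) M] (k : ℕ) := SmoothSimplex n M k →₀ ℝ

/-- The singular boundary operator `∂σ = ∑ (-1)^i σ ∘ δ_i`. -/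
def SmoothChain.boundary : SmoothChain n M (k + 1) →ₗ[ℝ] SmoothChain n M k :=
  Finsupp.linearCombination ℝ fun σ =>
    ∑ i : Fin (k + 2), Finsupp.single (σ.face i) ((-1 : ℝ) ^ (i : ℕ))

/-- The chain `c` is a cycle (every `0`-chain is one). -/
def SmoothChain.IsCycle : {k : ℕ} → SmoothChain n M k → Prop
  | 0, _ => True
  | _ + 1, c => SmoothChain.boundary c = 0

/-- The map induced on chains by a smooth map. -/
def SmoothChain.push (c : SmoothChain q S k) (f : S → M) (hf : ContMDiff (𝓡 q) (𝓡 n) ∞ f) :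
    SmoothChain n M k :=
  Finsupp.mapDomain (fun σ => σ.push f hf) c

/-- A chain `c` on the oriented `q`-manifold `S` which represents its fundamental class: a cycle, the
signed sum of the embedded `q`-simplices of a smooth triangulation. The simplices cover `S` and have
disjoint interiors, and each coefficient is `1` or `-1` according to whether the simplex preserves or
reverses orientation (the standard simplex being oriented by `e₁ - e₀, …, e_q - e₀`). -/
structure IsFundamentalCycle (o : ManifoldOrientation q S) (c : SmoothChain q S q) : Prop where
  cycle : c.IsCycle
  injective : ∀ σ ∈ c.support, Function.Injective σ.toFun
  sign : ∀ σ ∈ c.support, ∃ (U : Set (Fin (q + 1) → ℝ)) (F : (Fin (q + 1) → ℝ) → S), IsOpen U ∧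
    stdSimplex ℝ (Fin (q + 1)) ⊆ U ∧ ContMDiffOn 𝓘(ℝ, Fin (q + 1) → ℝ) (𝓡 q) ∞ F U ∧
    (∀ t : stdSimplex ℝ (Fin (q + 1)), F t = σ.toFun t) ∧
    ∀ t ∈ stdSimplex ℝ (Fin (q + 1)), (o.orient (F t)).frameSign (fun i : Fin q =>
      mfderiv 𝓘(ℝ, Fin (q + 1) → ℝ) (𝓡 q) F t
        (Pi.single i.succ (1 : ℝ) - Pi.single 0 (1 : ℝ) : Fin (q + 1) → ℝ)) = c σ
  cover : ∀ x : S, ∃ σ ∈ c.support, x ∈ range σ.toFun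
  disjoint_interiors : ∀ σ ∈ c.support, ∀ τ ∈ c.support, ∀ s t : stdSimplex ℝ (Fin (q + 1)),
    (∀ i, 0 < s i) → (∀ i, 0 < t i) → σ.toFun s = τ.toFun t → σ = τ

end Homology

/-! ### Immersions, functionals and minimization -/

section Immersions

/-- A smooth immersion of a `q`-manifold `S` into an `n`-manifold `M`. -/
structure SmoothImmersion (q n : ℕ) (S M : Type*) [TopologicalSpace S]
    [ChartedSpace (EuclideanSpace ℝ (Fin q)) S] [TopologicalSpace M]
    [ChartedSpace (EuclideanSpace ℝ (Fin n)) M] where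
  toFun : S → M
  contMDiff : ContMDiff (𝓡 q) (𝓡 n) ∞ toFun
  injective_mfderiv : ∀ x : S, Function.Injective (mfderiv (𝓡 q) (𝓡 n) toFun x)

variable {q n : ℕ} {S M : Type*} [TopologicalSpace S] [ChartedSpace (EuclideanSpace ℝ (Fin q)) S]
  [TopologicalSpace M] [ChartedSpace (EuclideanSpace ℝ (Fin n)) M]

namespace SmoothImmersion

/-- The differential as an isomorphism from `T_x S` onto its image. -/
def tangentEquiv (ι : SmoothImmersion q n S M) (x : S) :
    TangentSpace (𝓡 q) x ≃ₗ[ℝ]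
      LinearMap.range (mfderiv (𝓡 q) (𝓡 n) ι.toFun x : TangentSpace (𝓡 q) x →ₗ[ℝ]
        TangentSpace (𝓡 n) (ι.toFun x)) :=
  LinearEquiv.ofInjective _ (ι.injective_mfderiv x)

/-- The oriented tangent plane `ι_*(T_x S)`. -/
def plane (ι : SmoothImmersion q n S M) (o : ManifoldOrientation q S) (x : S) :
    OrientedPlane (TangentSpace (𝓡 n) (ι.toFun x)) q where
  carrier := LinearMap.range (mfderiv (𝓡 q) (𝓡 n) ι.toFun x : TangentSpace (𝓡 q) x →ₗ[ℝ]
    TangentSpace (𝓡 n) (ι.toFun x))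
  finrank_eq := by
    rw [← (ι.tangentEquiv x).finrank_eq]
    exact finrank_euclideanSpace_fin (𝕜 := ℝ)
  orientation := Orientation.map (Fin q) (ι.tangentEquiv x) (o.orient x)

/-- Two immersions of a compact oriented manifold are homologous: their images of the fundamental class
agree in smooth singular homology with real coefficients. -/
def Homologous (o : ManifoldOrientation q S) (ι ι' : SmoothImmersion q n S M) : Prop :=
  ∃ c : SmoothChain q S q, IsFundamentalCycle o c ∧ ∃ b : SmoothChain n M (q + 1),
    c.push ι.toFun ι.contMDiff - c.push ι'.toFun ι'.contMDiff = SmoothChain.boundary b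

variable [Bundle.RiemannianBundle (fun x : M => TangentSpace (𝓡 n) x)]

/-- `ι` is a positive horizontally projectable immersion with respect to the oriented distribution `H`. -/
def PosProjectable (ι : SmoothImmersion q n S M) (o : ManifoldOrientation q S)
    (H : ∀ x : M, OrientedPlane (TangentSpace (𝓡 n) x) q) : Prop :=
  ∀ x : S, (H (ι.toFun x)).PosProjectable (ι.plane o x)

/-- `ι` is `f`-calibrated by `α₂`: each tangent plane `P` is positive horizontally projectable and
`α₂|_P = f(P) vol_P`, where `f(P) = ve(P) vol^H_P / vol_P`. -/
def IsFCalibrated (ι : SmoothImmersion q n S M) (o : ManifoldOrientation q S)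
    (H : ∀ x : M, OrientedPlane (TangentSpace (𝓡 n) x) q)
    (α : ∀ x : M, TangentSpace (𝓡 n) x [⋀^Fin q]→L[ℝ] ℝ) : Prop :=
  ∀ x : S, (H (ι.toFun x)).PosProjectable (ι.plane o x) ∧
    (ι.plane o x).RestrictEq ((H (ι.toFun x)).component (α (ι.toFun x)) 2)
      ((H (ι.toFun x)).weight (ι.plane o x))

variable [CompactSpace S] [T2Space S] [IsManifold (𝓡 q) ∞ S]

/-- The functional `Vol^H(ι) = ∫_S vol^H_ι`. -/
def VolH (ι : SmoothImmersion q n S M) (o : ManifoldOrientation q S)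
    (H : ∀ x : M, OrientedPlane (TangentSpace (𝓡 n) x) q) : ℝ :=
  integrateTop o fun x w =>
    (H (ι.toFun x)).volH (ι.plane o x) (fun i => ι.tangentEquiv x (w i))

/-- The vertical energy `VE(ι) = ∫_S ve(ι) vol^H_ι`. -/
def VE (ι : SmoothImmersion q n S M) (o : ManifoldOrientation q S)
    (H : ∀ x : M, OrientedPlane (TangentSpace (𝓡 n) x) q) : ℝ :=
  integrateTop o fun x w =>
    (H (ι.toFun x)).ve (ι.plane o x) *
      (H (ι.toFun x)).volH (ι.plane o x) (fun i => ι.tangentEquiv x (w i))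

/-- `ι` minimizes `VE + Vol^H` in its restricted homology class, i.e. among the positive horizontally
projectable immersions of `S` homologous to `ι`. -/
def MinimizesVEAddVolH (ι : SmoothImmersion q n S M) (o : ManifoldOrientation q S)
    (H : ∀ x : M, OrientedPlane (TangentSpace (𝓡 n) x) q) : Prop :=
  ι.PosProjectable o H ∧ ∀ ι' : SmoothImmersion q n S M, ι'.PosProjectable o H →
    Homologous o ι ι' → ι.VE o H + ι.VolH o H ≤ ι'.VE o H + ι'.VolH o H

end SmoothImmersion

end Immersions

/-! ### `G₂`-structures -/

section GTwo

/-- The form `dx_a ∧ dx_b ∧ dx_c` on `ℝ⁷`. -/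
def dxWedge (a b c : Fin 7) (v : Fin 3 → Fin 7 → ℝ) : ℝ :=
  (Matrix.of fun i j : Fin 3 => v i (![a, b, c] j)).det

/-- The standard `3`-form `φ₀ = dx₁₂₃ + dx₁₄₅ + dx₁₆₇ + dx₂₄₆ - dx₂₅₇ - dx₃₄₇ - dx₃₅₆` on `ℝ⁷`
(coordinates are numbered from `0` in the code). -/
def stdGTwoForm (v : Fin 3 → Fin 7 → ℝ) : ℝ :=
  dxWedge 0 1 2 v + dxWedge 0 3 4 v + dxWedge 0 5 6 v + dxWedge 1 3 5 v
    - dxWedge 1 4 6 v - dxWedge 2 3 6 v - dxWedge 2 4 5 v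

/-- `φ` is a `G₂`-structure and the Riemannian metric of `M` is the one induced by `φ`: at each point
there is a linear isomorphism `T : T_x M → ℝ⁷` with `T^* φ₀ = φ`, and `T^* g₀` is the metric. -/
def IsGTwoStructure {M : Type*} [TopologicalSpace M] [ChartedSpace (EuclideanSpace ℝ (Fin 7)) M]
    [Bundle.RiemannianBundle (fun x : M => TangentSpace (𝓡 7) x)]
    (φ : ∀ x : M, TangentSpace (𝓡 7) x [⋀^Fin 3]→L[ℝ] ℝ) : Prop :=
  ∀ x : M, ∃ T : TangentSpace (𝓡 7) x ≃ₗ[ℝ] (Fin 7 → ℝ),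
    (∀ v : Fin 3 → TangentSpace (𝓡 7) x, φ x v = stdGTwoForm fun i => T (v i)) ∧
    ∀ u v : TangentSpace (𝓡 7) x, inner ℝ u v = ∑ i, T u i * T v i

end GTwo

end

/-!
The proof is a calibration argument with the form `α` itself. For a positive horizontally projectable
plane `P`, `α₀|_P = vol^H_P` because `α` calibrates `H`. Applying the semi-calibration inequality to
the planes obtained from `P` by multiplying vertical parts by `t`, in a frame whose horizontal
projection is orthonormal, gives `1 + t² α₂(P) ≤ √det(1 + t² A)` with `A` the Gram matrix of the
vertical parts; comparing second order terms as `t → 0` gives `α₂(P) ≤ ½ tr A = ve(P)`. Hence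
`α|_P ≤ (ve(P) + 1) vol^H_P` (`OrientedPlane.frameSign_mul_le`), with equality for `f`-calibrated planes
(`OrientedPlane.apply_eq_of_restrictEq_weight`). Integrating, `∫ ι^*α ≤ VE(ι) + Vol^H(ι)` for every
competitor, with equality for `f`-calibrated immersions, and it remains to see that the left-hand side
depends only on the homology class.

Forms are integrated over smooth simplices by means of the collapse `cubeToSimplex` of the cube onto the
simplex, under which every face of the simplex is the image of one face of the cube, the remaining faces
of the cube being degenerate. Stokes' theorem for closed forms thus follows from the divergence theorem
on the cube (`sum_simplexIntegral_face_eq_zero`), and the integral over a boundary vanishes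
(`chainIntegral_boundary`). That the integral over `S`, defined by a partition of unity, is the integral
over the image of a fundamental cycle (`IsFundamentalCycle.finsum_setIntegral_eq_chainIntegral`) is the
change of variables formula: in each chart the simplices tile the coordinate domain up to a null set.

To split and compare the integrals the densities of `VE` and `Vol^H` have to be integrable. In charts
they are expressed by the Gram matrices of the horizontal and vertical parts of a coordinate frame, which
are continuous because the projection onto `H` is computed from inner products with a local smooth frame
of `H` (`OrientedPlane.gram_projH`).

For `G₂`-structures the form is `φ(u, v, w) = ⟪u × v, w⟫` for a vector cross product. The identity
`|u × v|² = |u|² |v|² - ⟪u, v⟫²` yields the semi-calibration inequality, by Cauchy–Schwarz. A calibrated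
space `H` is closed under the product, by the equality case, so `φ₁ = 0`; and `φ₃ = 0` since `V = H^⊥` is
spanned by `u` and `u × eᵢ` for any nonzero `u ∈ V`, where `u × (u × eᵢ) = -|u|² eᵢ` is horizontal. The
second statement is then a case of the first.
-/

noncomputable section

/-! ### Alternating forms, signs and volumes of frames -/

section FrameChange

variable {W : Type*} [AddCommGroup W] [Module ℝ W] {k : ℕ}

theorem AlternatingMap.map_matrix_sum_smul (f : W [⋀^Fin k]→ₗ[ℝ] ℝ) (D : Matrix (Fin k) (Fin k) ℝ)
    (v : Fin k → W) : f (fun j => ∑ i, D i j • v i) = D.det * f v := by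
  have h := (f.compLinearMap (Fintype.linearCombination ℝ v)).eq_smul_basis_det
    (Pi.basisFun ℝ (Fin k))
  have h2 : f (fun j => Fintype.linearCombination ℝ v (fun i => D i j)) =
      f (fun j => Fintype.linearCombination ℝ v (Pi.basisFun ℝ (Fin k) j)) *
        (Pi.basisFun ℝ (Fin k)).det (fun j i => D i j) :=
    congrArg (fun g => g (fun j i => D i j)) h
  have e1 : (fun j => Fintype.linearCombination ℝ v (fun i => D i j)) =
      fun j => ∑ i, D i j • v i := by
    funext j
    simp [Fintype.linearCombination_apply]
  have e2 : (fun j => Fintype.linearCombination ℝ v (Pi.basisFun ℝ (Fin k) j)) = v := by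
    funext j
    simp [Fintype.linearCombination_apply, Pi.single_apply]
  have e3 : (Pi.basisFun ℝ (Fin k)).det (fun j i => D i j) = D.det := by
    rw [Pi.basisFun_det_apply, ← Matrix.det_transpose]
    rfl
  rw [e1, e2, e3] at h2
  rw [h2, mul_comm]

theorem Orientation.frameSign_matrix_sum_smul (o : Orientation ℝ W (Fin k))
    (D : Matrix (Fin k) (Fin k) ℝ) (v : Fin k → W) :
    o.frameSign (fun j => ∑ i, D i j • v i) = (SignType.sign D.det : ℝ) * o.frameSign v := by
  rw [Orientation.frameSign, AlternatingMap.map_matrix_sum_smul, sign_mul]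
  push_cast
  rfl

/-- The sign of a frame may be computed with any form representing the orientation. -/
theorem Orientation.frameSign_eq_sign {o : Orientation ℝ W (Fin k)} {f : W [⋀^Fin k]→ₗ[ℝ] ℝ}
    (hf : f ≠ 0) (h : rayOfNeZero ℝ f hf = o) (v : Fin k → W) :
    o.frameSign v = (SignType.sign (f v) : ℝ) := by
  have h1 : rayOfNeZero ℝ f hf = rayOfNeZero ℝ o.someVector o.someVector_ne_zero := by
    rw [h, Module.Ray.someVector_ray]
  rw [ray_eq_iff] at h1
  obtain ⟨r, hr, hrf⟩ := h1.exists_pos_left hf o.someVector_ne_zero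
  rw [Orientation.frameSign, ← hrf, AlternatingMap.smul_apply, smul_eq_mul, sign_mul, sign_pos hr,
    one_mul]

theorem Orientation.frameSign_map {W' : Type*} [AddCommGroup W'] [Module ℝ W']
    (o : Orientation ℝ W (Fin k)) (e : W ≃ₗ[ℝ] W') (v : Fin k → W) :
    (Orientation.map (Fin k) e o).frameSign (fun i => e (v i)) = o.frameSign v := by
  have hne : o.someVector.compLinearMap (e.symm : W' →ₗ[ℝ] W) ≠ 0 := by
    intro h0
    apply o.someVector_ne_zero
    ext w
    have := congrArg (fun g => g (fun i => e (w i))) h0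
    simpa using this
  have h : rayOfNeZero ℝ _ hne = Orientation.map (Fin k) e o := by
    conv_rhs => rw [← Module.Ray.someVector_ray o]
    rw [Orientation.map_apply]
  rw [Orientation.frameSign_eq_sign hne h, Orientation.frameSign]
  simp

theorem Orientation.frameSign_mul_self_basis (o : Orientation ℝ W (Fin k)) (b : Basis (Fin k) ℝ W) :
    o.frameSign b * o.frameSign b = 1 := by
  have h : o.someVector b ≠ 0 := by
    rw [Ne, AlternatingMap.map_basis_eq_zero_iff b]
    exact o.someVector_ne_zero
  rcases lt_or_gt_of_ne h with h | h
  · simp [Orientation.frameSign, sign_neg h]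
  · simp [Orientation.frameSign, sign_pos h]

theorem Module.Basis.sum_toMatrix_smul (b : Basis (Fin k) ℝ W) (v : Fin k → W) :
    (fun j => ∑ i, b.toMatrix v i j • b i) = v := by
  funext j
  exact b.sum_toMatrix_smul_self v j

variable {U : Type*} [NormedAddCommGroup U] [InnerProductSpace ℝ U]

theorem det_gram_matrix_sum_smul (L : W →ₗ[ℝ] U) (D : Matrix (Fin k) (Fin k) ℝ) (v : Fin k → W) :
    (Matrix.of fun i j => inner ℝ (L (∑ a, D a i • v a)) (L (∑ a, D a j • v a))).det
      = D.det ^ 2 * (Matrix.of fun i j => inner ℝ (L (v i)) (L (v j))).det := by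
  have key : (Matrix.of fun i j => inner ℝ (L (∑ a, D a i • v a)) (L (∑ a, D a j • v a)))
      = D.transpose * (Matrix.of fun i j => inner ℝ (L (v i)) (L (v j))) * D := by
    ext i j
    simp only [Matrix.of_apply, Matrix.mul_apply, Matrix.transpose_apply, map_sum, map_smul]
    simp only [sum_inner, inner_sum, real_inner_smul_left, real_inner_smul_right, Finset.sum_mul]
    refine Finset.sum_congr rfl fun a _ => Finset.sum_congr rfl fun b _ => ?_
    ring
  rw [key, Matrix.det_mul, Matrix.det_mul, Matrix.det_transpose]
  ring

/-- Volume forms transform like alternating forms under a change of frame. -/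
theorem Orientation.volOf_matrix_sum_smul (o : Orientation ℝ W (Fin k)) (L : W →ₗ[ℝ] U)
    (D : Matrix (Fin k) (Fin k) ℝ) (v : Fin k → W) :
    o.volOf (fun a b => inner ℝ (L a) (L b)) (fun j => ∑ i, D i j • v i)
      = D.det * o.volOf (fun a b => inner ℝ (L a) (L b)) v := by
  rw [Orientation.volOf, Orientation.volOf, Orientation.frameSign_matrix_sum_smul,
    det_gram_matrix_sum_smul, Real.sqrt_mul (sq_nonneg _), Real.sqrt_sq_eq_abs]
  rw [show ((SignType.sign D.det : ℝ) * o.frameSign v) *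
    (|D.det| * √(Matrix.of fun i j => inner ℝ (L (v i)) (L (v j))).det) =
    ((SignType.sign D.det : ℝ) * |D.det|) * (o.frameSign v *
      √(Matrix.of fun i j => inner ℝ (L (v i)) (L (v j))).det) by ring]
  rw [sign_mul_abs]

end FrameChange

/-! ### Semi-calibrations and horizontally projectable planes -/

namespace OrientedPlane

variable {W : Type*} [NormedAddCommGroup W] [InnerProductSpace ℝ W] {k : ℕ}

/-- A nonempty basis of an oriented space may be taken orthonormal and positive. -/
theorem exists_orthonormal_positive_basis (P : OrientedPlane W k) (hk : 0 < k) :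
    ∃ h : Basis (Fin k) ℝ P.carrier, P.orientation.frameSign h = 1 ∧
      ∀ i j, (inner ℝ (h i : W) (h j : W) : ℝ) = if i = j then 1 else 0 := by
  refine ⟨(P.orientation.finOrthonormalBasis hk P.finrank_eq).toBasis, ?_, fun i j => ?_⟩
  · have h := P.orientation.finOrthonormalBasis_orientation hk P.finrank_eq
    have hne : (P.orientation.finOrthonormalBasis hk P.finrank_eq).toBasis.det ≠ 0 :=
      Basis.det_ne_zero _
    rw [Orientation.frameSign_eq_sign hne h, Basis.det_self]
    simp
  · have := orthonormal_iff_ite.1 (P.orientation.finOrthonormalBasis hk P.finrank_eq).orthonormal i j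
    simpa using this

theorem vol_eq_volOf (P : OrientedPlane W k) (v : Fin k → P.carrier) :
    P.vol v = P.orientation.volOf
      (fun a b => inner ℝ (P.carrier.subtype a) (P.carrier.subtype b)) v := rfl

/-- Testing `α|_P ≤ vol_P` on the oriented span of `w`: a semi-calibration is at most the square root of
the Gram determinant. -/
theorem le_sqrt_det_gram {α : W [⋀^Fin k]→L[ℝ] ℝ}
    (hα : ∀ P : OrientedPlane W k, P.RestrictLE α.toMultilinearMap 1) {w : Fin k → W}
    (hw : LinearIndependent ℝ w) :
    α w ≤ √ (Matrix.of fun i j => (inner ℝ (w i) (w j) : ℝ)).det := by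
  let b := Basis.span hw
  let P : OrientedPlane W k := ⟨Submodule.span ℝ (range w),
    (finrank_span_eq_card hw).trans (Fintype.card_fin k), b.orientation⟩
  have hs : P.orientation.frameSign b = 1 := by
    have hne : b.det ≠ 0 := Basis.det_ne_zero _
    rw [Orientation.frameSign_eq_sign (o := P.orientation) hne rfl, Basis.det_self]
    simp
  have hb : ∀ i, (b i : W) = w i := fun i => congrArg Subtype.val (Basis.span_apply hw i)
  have h := hα P b hs
  rw [OrientedPlane.vol, Orientation.volOf, hs, one_mul, one_mul] at h
  simp only [hb] at h
  exact h

variable [FiniteDimensional ℝ W]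

theorem volH_eq_volOf (H P : OrientedPlane W k) (v : Fin k → P.carrier) :
    H.volH P v = P.orientation.volOf
      (fun a b => inner ℝ (((H.projH : W →ₗ[ℝ] W) ∘ₗ P.carrier.subtype) a)
        (((H.projH : W →ₗ[ℝ] W) ∘ₗ P.carrier.subtype) b)) v := rfl

theorem component_zero_apply (H : OrientedPlane W k) (α : W [⋀^Fin k]→L[ℝ] ℝ) (v : Fin k → W) :
    H.component α 0 v = α (fun i => H.projH (v i)) := by
  simp [component]

/-- Rescaling the vertical parts by `t` multiplies the component `αᵢ` by `tⁱ`. -/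
theorem component_add_smul (H : OrientedPlane W k) (α : W [⋀^Fin k]→L[ℝ] ℝ) (i : ℕ) (t : ℝ)
    {h a : Fin k → W} (hh : ∀ j, h j ∈ H.carrier) (ha : ∀ j, a j ∈ H.carrierᗮ) :
    H.component α i (fun j => h j + t • a j) = t ^ i * H.component α i (fun j => h j + a j) := by
  have hH1 : ∀ j, H.projH (h j) = h j := fun j => Submodule.starProjection_eq_self_iff.2 (hh j)
  have hH2 : ∀ j, H.projH (a j) = 0 := fun j =>
    (Submodule.starProjection_apply_eq_zero_iff _).2 (ha j)
  have hV1 : ∀ j, H.projV (h j) = 0 := fun j =>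
    Submodule.starProjection_orthogonal_apply_eq_zero (hh j)
  have hV2 : ∀ j, H.projV (a j) = a j := fun j => Submodule.starProjection_eq_self_iff.2 (ha j)
  simp only [component, _root_.sum_apply, Finset.mul_sum, MultilinearMap.compLinearMap_apply]
  refine Finset.sum_congr rfl fun s hs => ?_
  rw [Finset.mem_powersetCard] at hs
  have e : ∀ c : ℝ, (fun j => (if j ∈ s then (H.projV : W →ₗ[ℝ] W) else (H.projH : W →ₗ[ℝ] W))
      (h j + c • a j)) = s.piecewise (fun j => c • s.piecewise a h j) (s.piecewise a h) := by
    intro c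
    funext j
    by_cases hj : j ∈ s <;> simp [hj, hH1, hH2, hV1, hV2]
  have e1 := e 1
  simp only [one_smul] at e1
  rw [e t, e1, MultilinearMap.map_piecewise_smul, Finset.piecewise_idem_right]
  simp [hs.2]

/-- On a positive horizontally projectable plane the purely horizontal component of a form calibrating
`H` is the horizontal volume form. -/
theorem component_zero_eq_volH {H P : OrientedPlane W k} {α : W [⋀^Fin k]→L[ℝ] ℝ}
    (hH : H.RestrictEq α.toMultilinearMap 1) (hP : H.PosProjectable P) (v : Fin k → P.carrier) :
    H.component α 0 (fun i => (v i : W)) = H.volH P v := by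
  obtain ⟨e, he, ho⟩ := hP
  have h := hH (fun i => e (v i))
  rw [component_zero_apply]
  simp only [he] at h
  refine h.trans ?_
  rw [one_mul, vol, volH, Orientation.volOf, Orientation.volOf, ← ho, Orientation.frameSign_map]
  simp only [he]
  rfl

/-- The second order comparison behind the vertical energy bound: if `1 + t² c ≤ √det(1 + t² A)` for all
`t`, then `c ≤ ½ tr A`. -/
theorem le_half_trace_of_forall_le_sqrt_det {A : Matrix (Fin k) (Fin k) ℝ} {c : ℝ}
    (hc : ∀ t : ℝ, 1 + t ^ 2 * c ≤ √ (1 + t ^ 2 • A).det) : c ≤ (1 / 2) * A.trace := by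
  obtain ⟨p, hp⟩ : ∃ p : Polynomial ℝ,
      ∀ s : ℝ, (1 + s • A).det = 1 + A.trace * s + p.eval s * s ^ 2 :=
    ⟨_, fun s => Matrix.det_one_add_smul s A⟩
  -- Square the hypothesis, subtract `1`, divide by `t²` and let `t → 0`.
  have key : ∀ᶠ t : ℝ in 𝓝[>] 0, 2 * c + t ^ 2 * c ^ 2 ≤ A.trace + p.eval (t ^ 2) * t ^ 2 := by
    have hpos : ∀ᶠ t : ℝ in 𝓝 0, 0 < 1 + t ^ 2 * c := by
      have : ContinuousAt (fun t : ℝ => 1 + t ^ 2 * c) 0 := by fun_prop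
      exact this.eventually (lt_mem_nhds (by norm_num))
    filter_upwards [nhdsWithin_le_nhds hpos, self_mem_nhdsWithin] with t ht ht0
    have h1 := hc t
    have h2 : (1 + t ^ 2 * c) ^ 2 ≤ (1 + t ^ 2 • A).det :=
      (Real.le_sqrt' ht).1 h1
    rw [hp] at h2
    have ht0' : 0 < t ^ 2 := pow_pos ht0 2
    refine le_of_mul_le_mul_left ?_ ht0'
    nlinarith [h2]
  have hl : Filter.Tendsto (fun t : ℝ => 2 * c + t ^ 2 * c ^ 2) (𝓝[>] 0) (𝓝 (2 * c)) := by
    have : ContinuousAt (fun t : ℝ => 2 * c + t ^ 2 * c ^ 2) 0 := by fun_prop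
    have h := this.tendsto.mono_left (nhdsWithin_le_nhds (s := Ioi (0 : ℝ)))
    simpa using h
  have hr : Filter.Tendsto (fun t : ℝ => A.trace + p.eval (t ^ 2) * t ^ 2) (𝓝[>] 0)
      (𝓝 A.trace) := by
    have : ContinuousAt (fun t : ℝ => A.trace + p.eval (t ^ 2) * t ^ 2) 0 := by fun_prop
    have h := this.tendsto.mono_left (nhdsWithin_le_nhds (s := Ioi (0 : ℝ)))
    simpa using h
  have := le_of_tendsto_of_tendsto hl hr key
  linarith

/-- A positive horizontally projectable plane has a positive basis projecting to an orthonormal positive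
basis of `H`. -/
theorem PosProjectable.exists_adapted_basis {H P : OrientedPlane W k} (hP : H.PosProjectable P)
    (hk : 0 < k) : ∃ b : Basis (Fin k) ℝ P.carrier, P.orientation.frameSign b = 1 ∧
      ∀ i j, H.innerH P (b i) (b j) = if i = j then 1 else 0 := by
  obtain ⟨h, hs, ho⟩ := H.exists_orthonormal_positive_basis hk
  obtain ⟨e, he, heo⟩ := hP
  have hb : ∀ i, H.projH ((h.map e.symm) i : W) = h i := by
    intro i
    rw [← he]
    simp
  refine ⟨h.map e.symm, ?_, fun i j => ?_⟩
  · rw [← Orientation.frameSign_map P.orientation e, heo]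
    simpa using hs
  · rw [innerH, hb, hb, ho]

/-- The vertical energy dominates `α₂`: compare `α` with the volume on the planes obtained from `P` by
rescaling its vertical part. -/
theorem component_two_le_ve {H P : OrientedPlane W k} {α : W [⋀^Fin k]→L[ℝ] ℝ}
    (hα : ∀ P : OrientedPlane W k, P.RestrictLE α.toMultilinearMap 1)
    (hH : H.RestrictEq α.toMultilinearMap 1)
    (hd : α.toMultilinearMap = H.component α 0 + H.component α 2) (hP : H.PosProjectable P)
    {b : Basis (Fin k) ℝ P.carrier} (hs : P.orientation.frameSign b = 1)
    (hb : ∀ i j, H.innerH P (b i) (b j) = if i = j then 1 else 0) :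
    H.component α 2 (fun i => (b i : W)) ≤ H.ve P := by
  set h : Fin k → W := fun i => H.projH (b i) with hh
  set a : Fin k → W := fun i => H.projV (b i) with ha
  have hmem : ∀ i, h i ∈ H.carrier := fun i => Submodule.starProjection_apply_mem _ _
  have amem : ∀ i, a i ∈ H.carrierᗮ := fun i => Submodule.starProjection_apply_mem _ _
  have hsum : ∀ i, h i + a i = b i := fun i =>
    H.carrier.starProjection_add_starProjection_orthogonal _
  have hbo : ∀ i j, (inner ℝ (h i) (h j) : ℝ) = if i = j then 1 else 0 := hb
  have gram : ∀ t : ℝ, (Matrix.of fun i j => (inner ℝ (h i + t • a i) (h j + t • a j) : ℝ)) =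
      1 + t ^ 2 • Matrix.of fun i j => (inner ℝ (a i) (a j) : ℝ) := by
    intro t
    ext i j
    have h1 : (inner ℝ (h i) (a j) : ℝ) = 0 := (amem j) _ (hmem i)
    have h2 : (inner ℝ (a i) (h j) : ℝ) = 0 := by
      rw [real_inner_comm]
      exact (amem i) _ (hmem j)
    simp only [Matrix.of_apply, inner_add_left, inner_add_right, real_inner_smul_left,
      real_inner_smul_right, h1, h2, hbo, Matrix.add_apply, Matrix.one_apply, Matrix.smul_apply,
      smul_eq_mul]
    ring
  have hli : ∀ t : ℝ, LinearIndependent ℝ (fun i => h i + t • a i) := by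
    intro t
    have : Orthonormal ℝ h := orthonormal_iff_ite.2 hbo
    refine LinearIndependent.of_comp (H.projH : W →ₗ[ℝ] W) ?_
    have e0 : (⇑(H.projH : W →ₗ[ℝ] W) ∘ fun i => h i + t • a i) = h := by
      funext i
      have e1 : H.projH (h i) = h i := Submodule.starProjection_eq_self_iff.2 (hmem i)
      have e2 : H.projH (a i) = 0 := (Submodule.starProjection_apply_eq_zero_iff _).2 (amem i)
      simp [e1, e2]
    rw [e0]
    exact this.linearIndependent
  have hval : ∀ t : ℝ, α (fun i => h i + t • a i) =
      1 + t ^ 2 * H.component α 2 (fun i => (b i : W)) := by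
    intro t
    have h0 : H.component α 0 (fun i => (b i : W)) = 1 := by
      rw [component_zero_eq_volH hH hP, volH, Orientation.volOf, hs]
      have : (Matrix.of fun i j => H.innerH P (b i) (b j)) = (1 : Matrix (Fin k) (Fin k) ℝ) := by
        ext i j
        simp [hb, Matrix.one_apply]
      rw [this]
      simp
    have h1 := congrArg (fun g => g (fun i => h i + t • a i)) hd
    simp only [_root_.add_apply] at h1
    rw [component_add_smul H α 0 t hmem amem, component_add_smul H α 2 t hmem amem] at h1
    simp only [hsum, h0, pow_zero, one_mul] at h1
    exact h1
  rw [ve_eq_of_orthonormal H P b hb]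
  have := le_half_trace_of_forall_le_sqrt_det (A := Matrix.of fun i j => (inner ℝ (a i) (a j) : ℝ))
    (c := H.component α 2 (fun i => (b i : W))) (fun t => by
      rw [← hval, ← gram]
      exact le_sqrt_det_gram hα (hli t))
  simpa [Matrix.trace] using this

/-- The restriction of a continuous alternating form to the plane. -/
def restrict (P : OrientedPlane W k) (α : W [⋀^Fin k]→L[ℝ] ℝ) : P.carrier [⋀^Fin k]→ₗ[ℝ] ℝ :=
  α.toAlternatingMap.compLinearMap P.carrier.subtype

/-- The calibration inequality `α|_P ≤ (ve + 1) vol^H_P`, in arbitrary frames. -/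
theorem frameSign_mul_le {H P : OrientedPlane W k} {α : W [⋀^Fin k]→L[ℝ] ℝ}
    (hα : ∀ P : OrientedPlane W k, P.RestrictLE α.toMultilinearMap 1)
    (hH : H.RestrictEq α.toMultilinearMap 1)
    (hd : α.toMultilinearMap = H.component α 0 + H.component α 2) (hP : H.PosProjectable P)
    (v : Fin k → P.carrier) :
    P.orientation.frameSign v * α (fun i => (v i : W)) ≤
      P.orientation.frameSign v * (H.ve P * H.volH P v + H.volH P v) := by
  have hval : ∀ u : Fin k → P.carrier, α (fun i => (u i : W)) =
      H.volH P u + H.component α 2 (fun i => (u i : W)) := by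
    intro u
    have h1 := congrArg (fun g => g (fun i => (u i : W))) hd
    simp only [_root_.add_apply] at h1
    rw [component_zero_eq_volH hH hP] at h1
    exact h1
  rcases Nat.eq_zero_or_pos k with rfl | hk
  -- For `k = 0` there are no vertical slots: both `α₂` and the vertical energy vanish.
  · have h1 : H.component α 2 = 0 := by
      rw [component, Finset.powersetCard_eq_empty.2 (by simp), Finset.sum_empty]
    have h2 : H.ve P = 0 := by simp [ve, veIn, Matrix.trace]
    rw [hval, h1, h2]
    simp
  obtain ⟨b, hs, hb⟩ := hP.exists_adapted_basis hk
  have hb1 : H.volH P b = 1 := by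
    rw [volH, Orientation.volOf, hs]
    have : (Matrix.of fun i j => H.innerH P (b i) (b j)) = (1 : Matrix (Fin k) (Fin k) ℝ) := by
      ext i j
      simp [hb, Matrix.one_apply]
    rw [this]
    simp
  have hle := component_two_le_ve hα hH hd hP hs hb
  have hvb := b.sum_toMatrix_smul v
  set D := b.toMatrix v
  have e1 : α (fun i => (v i : W)) = D.det * α (fun i => (b i : W)) := by
    conv_lhs => rw [← hvb]
    exact AlternatingMap.map_matrix_sum_smul (P.restrict α) D b
  have e2 : H.volH P v = D.det := by
    conv_lhs => rw [← hvb]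
    rw [volH_eq_volOf, Orientation.volOf_matrix_sum_smul, ← volH_eq_volOf, hb1, mul_one]
  have e3 : P.orientation.frameSign v = (SignType.sign D.det : ℝ) := by
    conv_lhs => rw [← hvb]
    rw [Orientation.frameSign_matrix_sum_smul, hs, mul_one]
  have e4 : (SignType.sign D.det : ℝ) * D.det = |D.det| := sign_mul_self _
  rw [e1, e2, e3, hval, hb1]
  have := mul_le_mul_of_nonneg_left hle (abs_nonneg D.det)
  calc _ = |D.det| * (1 + H.component α 2 (fun i => (b i : W))) := by rw [← e4]; ring
    _ ≤ |D.det| * (1 + H.ve P) := by gcongr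
    _ = _ := by rw [← e4]; ring

/-- The quotient of the horizontal and the full volume form may be evaluated in any frame. -/
theorem weight_mul_vol (H P : OrientedPlane W k) (v : Fin k → P.carrier) :
    H.weight P * P.vol v = H.ve P * H.volH P v := by
  have hvb := P.basis.sum_toMatrix_smul v
  set D := P.basis.toMatrix v
  have e2 : H.volH P v = D.det * H.volH P P.basis := by
    conv_lhs => rw [← hvb]
    rw [volH_eq_volOf, Orientation.volOf_matrix_sum_smul, ← volH_eq_volOf]
  have e3 : P.vol v = D.det * P.vol P.basis := by
    conv_lhs => rw [← hvb]
    rw [vol_eq_volOf, Orientation.volOf_matrix_sum_smul, ← vol_eq_volOf]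
  have hne : P.vol P.basis ≠ 0 := by
    rw [vol, Orientation.volOf]
    refine mul_ne_zero ?_ ?_
    · intro h0
      have := P.orientation.frameSign_mul_self_basis P.basis
      rw [h0] at this
      norm_num at this
    · have hli : LinearIndependent ℝ (fun i => (P.basis i : W)) :=
        P.basis.linearIndependent.map' P.carrier.subtype (Submodule.ker_subtype _)
      have hpd : (Matrix.gram ℝ fun i => (P.basis i : W)).PosDef :=
        Matrix.posDef_gram_of_linearIndependent hli
      exact (Real.sqrt_pos.2 hpd.det_pos).ne'
  rw [weight, e2, e3]
  field_simp

/-- For an `f`-calibrated plane, `α|_P = (ve + 1) vol^H_P`. -/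
theorem apply_eq_of_restrictEq_weight {H P : OrientedPlane W k} {α : W [⋀^Fin k]→L[ℝ] ℝ}
    (hH : H.RestrictEq α.toMultilinearMap 1)
    (hd : α.toMultilinearMap = H.component α 0 + H.component α 2) (hP : H.PosProjectable P)
    (hf : P.RestrictEq (H.component α 2) (H.weight P)) (v : Fin k → P.carrier) :
    α (fun i => (v i : W)) = H.ve P * H.volH P v + H.volH P v := by
  have h1 := congrArg (fun g => g (fun i => (v i : W))) hd
  simp only [_root_.add_apply] at h1
  rw [component_zero_eq_volH hH hP, hf v, weight_mul_vol, add_comm] at h1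
  exact h1

end OrientedPlane

/-! ### The linear algebra of `G₂`-forms -/

section CrossProduct

/-- The cross product on `ℝ⁷` obtained from `φ₀` by raising an index. -/
def stdCross (u v : Fin 7 → ℝ) : Fin 7 → ℝ :=
  ![u 1 * v 2 - u 2 * v 1 + (u 3 * v 4 - u 4 * v 3) + (u 5 * v 6 - u 6 * v 5),
    u 2 * v 0 - u 0 * v 2 + (u 3 * v 5 - u 5 * v 3) - (u 4 * v 6 - u 6 * v 4),
    u 0 * v 1 - u 1 * v 0 - (u 3 * v 6 - u 6 * v 3) - (u 4 * v 5 - u 5 * v 4),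
    u 4 * v 0 - u 0 * v 4 + (u 5 * v 1 - u 1 * v 5) - (u 6 * v 2 - u 2 * v 6),
    u 0 * v 3 - u 3 * v 0 - (u 6 * v 1 - u 1 * v 6) - (u 5 * v 2 - u 2 * v 5),
    u 6 * v 0 - u 0 * v 6 + (u 1 * v 3 - u 3 * v 1) - (u 2 * v 4 - u 4 * v 2),
    u 0 * v 5 - u 5 * v 0 - (u 1 * v 4 - u 4 * v 1) - (u 2 * v 3 - u 3 * v 2)]

theorem sum_stdCross_mul (u v w : Fin 7 → ℝ) :
    ∑ i, stdCross u v i * w i = stdGTwoForm ![u, v, w] := by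
  simp only [stdCross, stdGTwoForm, dxWedge, Matrix.det_fin_three, Matrix.of_apply,
    Fin.sum_univ_seven, Matrix.cons_val]
  ring

/-- Beyond its skew-symmetry, this is the only identity for `φ₀` that the calibration property needs. -/
theorem sum_stdCross_mul_stdCross (u v w : Fin 7 → ℝ) :
    ∑ i, stdCross u v i * stdCross u w i =
      (∑ i, u i * u i) * (∑ i, v i * w i) - (∑ i, u i * v i) * (∑ i, u i * w i) := by
  simp only [stdCross, Fin.sum_univ_seven, Matrix.cons_val]
  ring

theorem stdCross_swap (u v : Fin 7 → ℝ) : stdCross u v = -stdCross v u := by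
  simp only [stdCross, Matrix.neg_cons, Matrix.neg_empty]
  ring_nf

theorem stdCross_add_left (u u' v : Fin 7 → ℝ) :
    stdCross (u + u') v = stdCross u v + stdCross u' v := by
  simp only [stdCross, Matrix.cons_add_cons, Matrix.empty_add_empty, Pi.add_apply]
  ring_nf

theorem stdCross_smul_left (c : ℝ) (u v : Fin 7 → ℝ) : stdCross (c • u) v = c • stdCross u v := by
  simp only [stdCross, Matrix.smul_cons, Matrix.smul_empty, Pi.smul_apply, smul_eq_mul]
  ring_nf

theorem stdGTwoForm_cyclic (u v w : Fin 7 → ℝ) :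
    stdGTwoForm ![u, v, w] = stdGTwoForm ![v, w, u] := by
  simp only [stdGTwoForm, dxWedge, Matrix.det_fin_three, Matrix.of_apply, Matrix.cons_val]
  ring

variable {W : Type*} [NormedAddCommGroup W] [InnerProductSpace ℝ W]

/-- A vector cross product on an inner product space: a bilinear skew product such that `⟪u × v, w⟫` is
totally skew and `u × ·` scales lengths orthogonally to `u` by `|u|` (the last condition in polarized
form). -/
structure VectorCrossProduct (W : Type*) [NormedAddCommGroup W] [InnerProductSpace ℝ W] where
  cross : W →ₗ[ℝ] W →ₗ[ℝ] W
  skew : ∀ u v, cross u v = -cross v u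
  cyclic : ∀ u v w, (inner ℝ (cross u v) w : ℝ) = inner ℝ (cross v w) u
  inner_cross_cross : ∀ u v w, (inner ℝ (cross u v) (cross u w) : ℝ) =
    inner ℝ u u * inner ℝ v w - inner ℝ u v * inner ℝ u w

/-- An isometry with `ℝ⁷` taking `φ` to the standard `G₂`-form yields a cross product whose associated
form is `φ`. -/
theorem exists_vectorCrossProduct (φ : W [⋀^Fin 3]→L[ℝ] ℝ) (T : W ≃ₗ[ℝ] (Fin 7 → ℝ))
    (hφ : ∀ v : Fin 3 → W, φ v = stdGTwoForm fun i => T (v i))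
    (hT : ∀ u v : W, inner ℝ u v = ∑ i, T u i * T v i) :
    ∃ X : VectorCrossProduct W, ∀ u v w, φ ![u, v, w] = inner ℝ (X.cross u v) w := by
  let B : W →ₗ[ℝ] W →ₗ[ℝ] W := LinearMap.mk₂ ℝ (fun u v => T.symm (stdCross (T u) (T v)))
    (fun u u' v => by rw [← map_add, ← stdCross_add_left, ← map_add])
    (fun c u v => by rw [← map_smul, ← stdCross_smul_left, ← map_smul])
    (fun u v v' => by
      rw [← map_add, map_add, stdCross_swap, stdCross_add_left, neg_add, ← stdCross_swap,
        ← stdCross_swap])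
    (fun c u v => by
      rw [← map_smul, map_smul, stdCross_swap, stdCross_smul_left, ← smul_neg, ← stdCross_swap])
  have hB : ∀ u v, T (B u v) = stdCross (T u) (T v) := fun u v => by simp [B]
  have hF : ∀ u v w, (inner ℝ (B u v) w : ℝ) = stdGTwoForm ![T u, T v, T w] := by
    intro u v w
    rw [hT, hB, sum_stdCross_mul]
  refine ⟨⟨B, ?_, ?_, ?_⟩, ?_⟩
  · intro u v
    apply T.injective
    rw [map_neg, hB, hB, stdCross_swap]
  · intro u v w
    rw [hF, hF, stdGTwoForm_cyclic]
  · intro u v w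
    rw [hT, hB, hB, sum_stdCross_mul_stdCross, hT, hT, hT, hT]
  · intro u v w
    rw [hφ, hF]
    congr 1
    ext i
    fin_cases i <;> rfl

namespace VectorCrossProduct

variable (X : VectorCrossProduct W)

theorem cross_self (u : W) : X.cross u u = 0 := by
  have := IsAddTorsionFree.of_isTorsionFree ℝ W
  exact self_eq_neg.1 (X.skew u u)

theorem inner_cross_self_left (u v : W) : (inner ℝ (X.cross u v) u : ℝ) = 0 := by
  rw [X.cyclic, X.cyclic, X.cross_self, inner_zero_left]

theorem inner_cross_le_one {a b c : W} (ha : (inner ℝ a a : ℝ) = 1) (hb : (inner ℝ b b : ℝ) = 1)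
    (hc : (inner ℝ c c : ℝ) = 1) (hab : (inner ℝ a b : ℝ) = 0) :
    (inner ℝ (X.cross a b) c : ℝ) ≤ 1 := by
  have h1 : (inner ℝ (X.cross a b) (X.cross a b) : ℝ) = 1 := by
    rw [X.inner_cross_cross, ha, hb, hab]
    norm_num
  have h2 : (0 : ℝ) ≤ inner ℝ (X.cross a b - c) (X.cross a b - c) := real_inner_self_nonneg
  rw [inner_sub_left, inner_sub_right, inner_sub_right, h1, hc, real_inner_comm (X.cross a b) c] at h2
  linarith

/-- Equality in the Cauchy–Schwarz inequality. -/
theorem cross_eq_of_inner_eq_one {a b c : W} (ha : (inner ℝ a a : ℝ) = 1)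
    (hb : (inner ℝ b b : ℝ) = 1) (hc : (inner ℝ c c : ℝ) = 1) (hab : (inner ℝ a b : ℝ) = 0)
    (h : (inner ℝ (X.cross a b) c : ℝ) = 1) : X.cross a b = c := by
  have h1 : (inner ℝ (X.cross a b) (X.cross a b) : ℝ) = 1 := by
    rw [X.inner_cross_cross, ha, hb, hab]
    norm_num
  have h2 : (inner ℝ (X.cross a b - c) (X.cross a b - c) : ℝ) = 0 := by
    rw [inner_sub_left, inner_sub_right, inner_sub_right, h1, hc, real_inner_comm (X.cross a b) c, h]
    norm_num
  exact sub_eq_zero.1 (inner_self_eq_zero.1 h2)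

/-- A three-dimensional subspace with orthonormal basis `e₀, e₁, e₂ = e₀ × e₁` is closed under the cross
product. -/
theorem inner_cross_eq_zero_of_mem {e : Fin 3 → W}
    (he : ∀ i j, (inner ℝ (e i) (e j) : ℝ) = if i = j then 1 else 0)
    (h1 : (inner ℝ (X.cross (e 0) (e 1)) (e 2) : ℝ) = 1) {a u v : W}
    (ha : ∀ i, (inner ℝ (e i) a : ℝ) = 0) (hu : u ∈ Submodule.span ℝ (range e))
    (hv : v ∈ Submodule.span ℝ (range e)) : (inner ℝ (X.cross u v) a : ℝ) = 0 := by
  have hee : ∀ i, (inner ℝ (e i) (e i) : ℝ) = 1 := fun i => by rw [he, if_pos rfl]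
  have c01 : X.cross (e 0) (e 1) = e 2 :=
    X.cross_eq_of_inner_eq_one (hee _) (hee _) (hee _) (by simp [he]) h1
  have c12 : X.cross (e 1) (e 2) = e 0 :=
    X.cross_eq_of_inner_eq_one (hee _) (hee _) (hee _) (by simp [he])
      (by rw [← X.cyclic, h1])
  have c20 : X.cross (e 2) (e 0) = e 1 :=
    X.cross_eq_of_inner_eq_one (hee _) (hee _) (hee _) (by simp [he])
      (by rw [X.cyclic, h1])
  have c10 : X.cross (e 1) (e 0) = -e 2 := by rw [X.skew, c01]
  have c21 : X.cross (e 2) (e 1) = -e 0 := by rw [X.skew, c12]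
  have c02 : X.cross (e 0) (e 2) = -e 1 := by rw [X.skew, c20]
  have hij : ∀ i j, (inner ℝ (X.cross (e i) (e j)) a : ℝ) = 0 := by
    intro i j
    fin_cases i <;> fin_cases j <;>
      simp [X.cross_self, c01, c12, c20, c10, c21, c02, ha, inner_neg_left]
  obtain ⟨c, rfl⟩ := (Submodule.mem_span_range_iff_exists_fun ℝ).1 hu
  obtain ⟨d, rfl⟩ := (Submodule.mem_span_range_iff_exists_fun ℝ).1 hv
  simp [sum_inner, real_inner_smul_left, hij]

/-- Inside `V = H^⊥`, four-dimensional, the associated form vanishes: for `0 ≠ u ∈ V` the vectors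
`u, eᵢ × u` form an orthogonal basis of `V`, and `u × (eᵢ × u) = |u|² eᵢ` lies in `H`. -/
theorem inner_cross_eq_zero_of_orthogonal [FiniteDimensional ℝ W] (hW : finrank ℝ W = 7)
    {e : Fin 3 → W} (he : ∀ i j, (inner ℝ (e i) (e j) : ℝ) = if i = j then 1 else 0)
    (h1 : (inner ℝ (X.cross (e 0) (e 1)) (e 2) : ℝ) = 1) {u v w : W}
    (hu : ∀ i, (inner ℝ (e i) u : ℝ) = 0) (hv : ∀ i, (inner ℝ (e i) v : ℝ) = 0)
    (hw : ∀ i, (inner ℝ (e i) w : ℝ) = 0) : (inner ℝ (X.cross u v) w : ℝ) = 0 := by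
  by_cases hu0 : u = 0
  · simp [hu0]
  have huu : (inner ℝ u u : ℝ) ≠ 0 := fun h => hu0 (inner_self_eq_zero.1 h)
  have hu' : ∀ i, (inner ℝ u (e i) : ℝ) = 0 := fun i => by rw [real_inner_comm, hu]
  have hmem : ∀ i, e i ∈ Submodule.span ℝ (range e) := fun i => Submodule.subset_span ⟨i, rfl⟩
  have hce : ∀ i j, (inner ℝ (e j) (X.cross u (e i)) : ℝ) = 0 := by
    intro i j
    rw [real_inner_comm, X.cyclic]
    exact X.inner_cross_eq_zero_of_mem he h1 hu (hmem i) (hmem j)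
  let f : Fin 4 → W := Fin.cons u (fun i => X.cross u (e i))
  let V := (Submodule.span ℝ (range e))ᗮ
  have memV : ∀ x : W, (∀ i, (inner ℝ (e i) x : ℝ) = 0) → x ∈ V := by
    intro x hx
    rw [Submodule.mem_orthogonal]
    intro y hy
    obtain ⟨c, rfl⟩ := (Submodule.mem_span_range_iff_exists_fun ℝ).1 hy
    simp [sum_inner, real_inner_smul_left, hx]
  have hfV : ∀ i, f i ∈ V := by
    intro i
    refine Fin.cases (memV u hu) (fun i => memV _ (hce i)) i
  have hfo : ∀ i j, i ≠ j → (inner ℝ (f i) (f j) : ℝ) = 0 := by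
    intro i j
    refine Fin.cases (Fin.cases (fun h => absurd rfl h) (fun j _ => ?_) j)
      (fun i => Fin.cases (fun _ => ?_) (fun j h => ?_) j) i
    · change (inner ℝ u (X.cross u (e j)) : ℝ) = 0
      rw [real_inner_comm, X.inner_cross_self_left]
    · change (inner ℝ (X.cross u (e i)) u : ℝ) = 0
      rw [X.inner_cross_self_left]
    · change (inner ℝ (X.cross u (e i)) (X.cross u (e j)) : ℝ) = 0
      rw [X.inner_cross_cross, hu', hu', he, if_neg (fun h' => h (congrArg Fin.succ h'))]
      ring
  have hf0 : ∀ i, f i ≠ 0 := by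
    intro i
    refine Fin.cases hu0 (fun i h => ?_) i
    have h2 : (inner ℝ (X.cross u (e i)) (X.cross u (e i)) : ℝ) = 0 := by
      change X.cross u (e i) = 0 at h
      rw [h, inner_zero_left]
    rw [X.inner_cross_cross, hu', he, if_pos rfl] at h2
    apply huu
    linarith
  have hli : LinearIndependent ℝ (fun i => (⟨f i, hfV i⟩ : V)) := by
    refine LinearIndependent.of_comp V.subtype ?_
    exact linearIndependent_of_ne_zero_of_inner_eq_zero hf0 hfo
  have hdim : finrank ℝ V = 4 := by
    have h2 := Submodule.finrank_add_finrank_orthogonal (Submodule.span ℝ (range e))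
    have h3 : finrank ℝ (Submodule.span ℝ (range e)) = 3 := by
      rw [finrank_span_eq_card (orthonormal_iff_ite.2 he).linearIndependent, Fintype.card_fin]
    change finrank ℝ (Submodule.span ℝ (range e)) + finrank ℝ V = finrank ℝ W at h2
    omega
  have hspan := hli.span_eq_top_of_card_eq_finrank' (by rw [hdim, Fintype.card_fin])
  have hvV : (⟨v, memV v hv⟩ : V) ∈ Submodule.span ℝ (range fun i => (⟨f i, hfV i⟩ : V)) := by
    rw [hspan]
    trivial
  obtain ⟨c, hc⟩ := (Submodule.mem_span_range_iff_exists_fun ℝ).1 hvV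
  have hcv : v = ∑ i, c i • f i := by
    have := congrArg Subtype.val hc
    simpa using this.symm
  have huf : ∀ i, (inner ℝ (X.cross u (f i)) w : ℝ) = 0 := by
    intro i
    refine Fin.cases ?_ (fun i => ?_) i
    · change (inner ℝ (X.cross u u) w : ℝ) = 0
      rw [X.cross_self, inner_zero_left]
    · change (inner ℝ (X.cross u (X.cross u (e i))) w : ℝ) = 0
      rw [X.cyclic, X.cyclic, X.skew w u, inner_neg_left, X.inner_cross_cross, hu',
        real_inner_comm (e i) w, hw]
      ring
  rw [hcv]
  simp [sum_inner, real_inner_smul_left, huf]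

end VectorCrossProduct

end CrossProduct

section GTwoForm

variable {W : Type*} [NormedAddCommGroup W] [InnerProductSpace ℝ W]

/-- The form of a cross product has comass at most one: on an orthonormal frame it is
`⟪b₀ × b₁, b₂⟫ ≤ |b₀ × b₁| |b₂| = 1`. -/
theorem VectorCrossProduct.restrictLE {X : VectorCrossProduct W} {φ : W [⋀^Fin 3]→L[ℝ] ℝ}
    (hφ : ∀ u v w, φ ![u, v, w] = inner ℝ (X.cross u v) w) (P : OrientedPlane W 3) :
    P.RestrictLE φ.toMultilinearMap 1 := by
  intro v hv
  obtain ⟨b, hs, hb⟩ := P.exists_orthonormal_positive_basis (by norm_num)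
  have hvb := b.sum_toMatrix_smul v
  set D := b.toMatrix v
  have e1 : φ (fun i => (v i : W)) = D.det * φ (fun i => (b i : W)) := by
    conv_lhs => rw [← hvb]
    exact AlternatingMap.map_matrix_sum_smul
      (φ.toAlternatingMap.compLinearMap P.carrier.subtype) D b
  have e2 : P.vol v = D.det * P.vol b := by
    conv_lhs => rw [← hvb]
    rw [P.vol_eq_volOf, Orientation.volOf_matrix_sum_smul, ← P.vol_eq_volOf]
  have e3 : P.vol b = 1 := by
    have : (Matrix.of fun i j => (inner ℝ (b i : W) (b j : W) : ℝ)) = 1 := by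
      ext i j
      simp [hb, Matrix.one_apply]
    rw [OrientedPlane.vol, Orientation.volOf, hs, this]
    simp
  have e4 : 0 < D.det := by
    have : P.orientation.frameSign v = (SignType.sign D.det : ℝ) := by
      conv_lhs => rw [← hvb]
      rw [Orientation.frameSign_matrix_sum_smul, hs, mul_one]
    rw [this] at hv
    by_contra h
    rcases lt_or_eq_of_le (not_lt.1 h) with h | h
    · rw [sign_neg h] at hv
      norm_num at hv
    · rw [h, sign_zero] at hv
      norm_num at hv
  have e5 : φ (fun i => (b i : W)) ≤ 1 := by
    have : (fun i => (b i : W)) = ![(b 0 : W), b 1, b 2] := by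
      ext i
      fin_cases i <;> rfl
    rw [this, hφ]
    exact X.inner_cross_le_one (by simp only [hb, if_true]) (by simp only [hb, if_true])
      (by simp only [hb, if_true]) (by simp [hb])
  change φ (fun i => (v i : W)) ≤ _
  rw [e1, one_mul, e2, e3]
  gcongr

/-- If `H` is calibrated by the form of a cross product, then `H × H ⊆ H` kills the component with one
vertical slot, and the vanishing of the form on `H^⊥` kills the one with three. -/
theorem VectorCrossProduct.eq_component_zero_add_component_two [FiniteDimensional ℝ W]
    (hW : finrank ℝ W = 7) {X : VectorCrossProduct W} {φ : W [⋀^Fin 3]→L[ℝ] ℝ}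
    (hφ : ∀ u v w, φ ![u, v, w] = inner ℝ (X.cross u v) w) {H : OrientedPlane W 3}
    (hH : H.RestrictEq φ.toMultilinearMap 1) :
    φ.toMultilinearMap = H.component φ 0 + H.component φ 2 := by
  obtain ⟨b, hs, hb⟩ := H.exists_orthonormal_positive_basis (by norm_num)
  have h1 : (inner ℝ (X.cross (b 0) (b 1)) (b 2 : W) : ℝ) = 1 := by
    have e := hH b
    have e0 : (fun i => (b i : W)) = ![(b 0 : W), b 1, b 2] := by
      ext i
      fin_cases i <;> rfl
    have e3 : H.vol b = 1 := by
      have : (Matrix.of fun i j => (inner ℝ (b i : W) (b j : W) : ℝ)) = 1 := by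
        ext i j
        simp [hb, Matrix.one_apply]
      rw [OrientedPlane.vol, Orientation.volOf, hs, this]
      simp
    rw [e0, e3, mul_one] at e
    rw [← hφ]
    exact e
  have hspan : ∀ x ∈ H.carrier, x ∈ Submodule.span ℝ (range fun i => (b i : W)) := by
    intro x hx
    have h := congrArg H.carrier.subtype (b.sum_repr ⟨x, hx⟩)
    rw [map_sum] at h
    exact (Submodule.mem_span_range_iff_exists_fun ℝ).2 ⟨b.repr ⟨x, hx⟩, h⟩
  have horth : ∀ x ∈ H.carrierᗮ, ∀ i, (inner ℝ (b i : W) x : ℝ) = 0 := fun x hx i =>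
    hx _ (b i).2
  have hhv : ∀ u ∈ H.carrier, ∀ v ∈ H.carrier, ∀ a ∈ H.carrierᗮ,
      (inner ℝ (X.cross u v) a : ℝ) = 0 := fun u hu v hv a ha =>
    X.inner_cross_eq_zero_of_mem hb h1 (horth a ha) (hspan u hu) (hspan v hv)
  have hvv : ∀ u ∈ H.carrierᗮ, ∀ v ∈ H.carrierᗮ, ∀ a ∈ H.carrierᗮ,
      (inner ℝ (X.cross u v) a : ℝ) = 0 := fun u hu v hv a ha =>
    X.inner_cross_eq_zero_of_orthogonal hW hb h1 (horth u hu) (horth v hv) (horth a ha)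
  ext v
  have hF : ∀ u : Fin 3 → W, φ u = inner ℝ (X.cross (u 0) (u 1)) (u 2) := by
    intro u
    rw [← hφ]
    congr 1
    ext i
    fin_cases i <;> rfl
  have hpow : Finset.powersetCard 2 (Finset.univ : Finset (Fin 3)) = {{0, 1}, {0, 2}, {1, 2}} := by
    decide
  have hc2 : H.component φ 2 v =
      inner ℝ (X.cross (H.projV (v 0)) (H.projV (v 1))) (H.projH (v 2)) +
      (inner ℝ (X.cross (H.projV (v 0)) (H.projH (v 1))) (H.projV (v 2)) +
      inner ℝ (X.cross (H.projH (v 0)) (H.projV (v 1))) (H.projV (v 2))) := by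
    rw [OrientedPlane.component, hpow, Finset.sum_insert (by decide), Finset.sum_insert (by decide),
      Finset.sum_singleton]
    simp only [_root_.add_apply, MultilinearMap.compLinearMap_apply]
    change φ _ + (φ _ + φ _) = _
    rw [hF, hF, hF]
    simp
  change φ v = H.component φ 0 v + H.component φ 2 v
  rw [H.component_zero_apply, hc2, hF, hF]
  have hd : ∀ i, ∃ x ∈ H.carrier, ∃ y ∈ H.carrierᗮ, H.projH (v i) = x ∧ H.projV (v i) = y ∧
      v i = x + y := fun i =>
    ⟨_, Submodule.starProjection_apply_mem _ _, _, Submodule.starProjection_apply_mem _ _, rfl, rfl,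
      (H.carrier.starProjection_add_starProjection_orthogonal _).symm⟩
  obtain ⟨x0, hx0, y0, hy0, e0, f0, g0⟩ := hd 0
  obtain ⟨x1, hx1, y1, hy1, e1, f1, g1⟩ := hd 1
  obtain ⟨x2, hx2, y2, hy2, e2, f2, g2⟩ := hd 2
  have k1 := hhv x0 hx0 x1 hx1 y2 hy2
  have k2 : (inner ℝ (X.cross x0 y1) x2 : ℝ) = 0 := by
    rw [X.cyclic, X.cyclic]
    exact hhv _ hx2 _ hx0 _ hy1
  have k3 : (inner ℝ (X.cross y0 x1) x2 : ℝ) = 0 := by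
    rw [X.cyclic]
    exact hhv _ hx1 _ hx2 _ hy0
  have k4 := hvv y0 hy0 y1 hy1 y2 hy2
  rw [e0, e1, e2, f0, f1, f2, g0, g1, g2]
  simp only [map_add, LinearMap.add_apply, inner_add_left, inner_add_right, k1, k2, k3, k4]
  ring

end GTwoForm

/-! ### Parametrizing the simplex by the cube -/

section CubeToSimplex

/-- The collapse `[0,1]^q → Δ^q`, given recursively by `(s₀, s') ↦ (1 - s₀, s₀ κ(s'))`, where `κ` is
the collapse in the previous dimension; it is a diffeomorphism on the interiors. -/
def cubeToSimplex : (q : ℕ) → (Fin q → ℝ) → Fin (q + 1) → ℝ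
  | 0, _ => fun _ => 1
  | q + 1, s => Fin.cons (1 - s 0) (s 0 • cubeToSimplex q (Fin.tail s))

/-- The open unit cube. -/
def openCube (q : ℕ) : Set (Fin q → ℝ) := univ.pi fun _ => Ioo 0 1

theorem cubeToSimplex_succ_zero {q : ℕ} (s : Fin (q + 1) → ℝ) :
    cubeToSimplex (q + 1) s 0 = 1 - s 0 := rfl

theorem cubeToSimplex_succ_succ {q : ℕ} (s : Fin (q + 1) → ℝ) (i : Fin (q + 1)) :
    cubeToSimplex (q + 1) s i.succ = s 0 * cubeToSimplex q (Fin.tail s) i := rfl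

theorem isOpen_openCube (q : ℕ) : IsOpen (openCube q) :=
  isOpen_set_pi finite_univ fun _ _ => isOpen_Ioo

theorem openCube_subset_Icc (q : ℕ) : openCube q ⊆ Icc 0 1 := fun _ hs =>
  ⟨fun i => (hs i (mem_univ i)).1.le, fun i => (hs i (mem_univ i)).2.le⟩

theorem openCube_ae_eq_Icc (q : ℕ) : openCube q =ᵐ[volume] Icc (0 : Fin q → ℝ) 1 :=
  Measure.univ_pi_Ioo_ae_eq_Icc (f := (0 : Fin q → ℝ)) (g := 1)

theorem contDiff_tail {q : ℕ} : ContDiff ℝ ∞ fun s : Fin (q + 1) → ℝ => Fin.tail s :=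
  contDiff_pi.2 fun i => contDiff_apply ℝ ℝ i.succ

theorem contDiff_cubeToSimplex (q : ℕ) : ContDiff ℝ ∞ (cubeToSimplex q) := by
  induction q with
  | zero => exact contDiff_const
  | succ q ih =>
    refine contDiff_pi.2 fun i => ?_
    refine Fin.cases ?_ (fun i => ?_) i
    · exact contDiff_const.sub (contDiff_apply ℝ ℝ 0)
    · exact (contDiff_apply ℝ ℝ 0).mul ((contDiff_apply ℝ ℝ i).comp (ih.comp contDiff_tail))

theorem sum_cubeToSimplex (q : ℕ) (s : Fin q → ℝ) : ∑ i, cubeToSimplex q s i = 1 := by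
  induction q with
  | zero => simp [cubeToSimplex]
  | succ q ih =>
    simp only [Fin.sum_univ_succ (n := q + 1), cubeToSimplex_succ_zero, cubeToSimplex_succ_succ,
      ← Finset.mul_sum, ih]
    ring

theorem tail_mem_Icc {q : ℕ} {s : Fin (q + 1) → ℝ} (hs : s ∈ Icc (0 : Fin (q + 1) → ℝ) 1) :
    Fin.tail s ∈ Icc (0 : Fin q → ℝ) 1 :=
  ⟨fun i => hs.1 i.succ, fun i => hs.2 i.succ⟩

theorem tail_mem_openCube {q : ℕ} {s : Fin (q + 1) → ℝ} (hs : s ∈ openCube (q + 1)) :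
    Fin.tail s ∈ openCube q := fun i _ => hs i.succ (mem_univ _)

theorem cubeToSimplex_mem_stdSimplex {q : ℕ} {s : Fin q → ℝ} (hs : s ∈ Icc (0 : Fin q → ℝ) 1) :
    cubeToSimplex q s ∈ stdSimplex ℝ (Fin (q + 1)) := by
  refine ⟨?_, sum_cubeToSimplex q s⟩
  induction q with
  | zero => exact fun _ => zero_le_one
  | succ q ih =>
    intro i
    refine Fin.cases ?_ (fun i => ?_) i
    · exact sub_nonneg.2 (hs.2 0)
    · exact mul_nonneg (hs.1 0) (ih (tail_mem_Icc hs) i)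

theorem cubeToSimplex_pos {q : ℕ} {s : Fin q → ℝ} (hs : s ∈ openCube q) (i : Fin (q + 1)) :
    0 < cubeToSimplex q s i := by
  induction q with
  | zero => exact one_pos
  | succ q ih =>
    refine Fin.cases ?_ (fun i => ?_) i
    · exact sub_pos.2 (hs 0 (mem_univ _)).2
    · exact mul_pos (hs 0 (mem_univ _)).1 (ih (tail_mem_openCube hs) i)

theorem injOn_cubeToSimplex (q : ℕ) : InjOn (cubeToSimplex q) (openCube q) := by
  induction q with
  | zero => exact fun _ _ _ _ _ => Subsingleton.elim _ _
  | succ q ih =>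
    intro s hs t ht h
    have h0 : s 0 = t 0 := by
      have := congrFun h 0
      rw [cubeToSimplex_succ_zero, cubeToSimplex_succ_zero] at this
      linarith
    have h1 : Fin.tail s = Fin.tail t := by
      refine ih (tail_mem_openCube hs) (tail_mem_openCube ht) (funext fun i => ?_)
      have := congrFun h i.succ
      rw [cubeToSimplex_succ_succ, cubeToSimplex_succ_succ, h0] at this
      exact mul_left_cancel₀ (hs 0 (mem_univ _)).1.ne' (h0 ▸ this)
    rw [← Fin.cons_self_tail s, ← Fin.cons_self_tail t, h0, h1]

/-- The collapse maps the closed cube onto the simplex. -/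
theorem exists_cubeToSimplex_eq {q : ℕ} {t : Fin (q + 1) → ℝ}
    (ht : t ∈ stdSimplex ℝ (Fin (q + 1))) : ∃ s ∈ Icc (0 : Fin q → ℝ) 1, cubeToSimplex q s = t := by
  induction q with
  | zero =>
    refine ⟨0, ⟨le_rfl, zero_le_one⟩, funext fun i => ?_⟩
    have := ht.2
    rw [Fin.sum_univ_one] at this
    rw [Fin.fin_one_eq_zero i, this]
    rfl
  | succ q ih =>
    have hsum : t 0 + ∑ i : Fin (q + 1), t i.succ = 1 := by
      rw [← Fin.sum_univ_succ]
      exact ht.2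
    have hnn : 0 ≤ ∑ i : Fin (q + 1), t i.succ := Finset.sum_nonneg fun i _ => ht.1 i.succ
    have ht0 : t 0 ≤ 1 := by linarith
    rcases hnn.eq_or_lt with h0 | hpos
    · have hz : ∀ i : Fin (q + 1), t i.succ = 0 := fun i =>
        (Finset.sum_eq_zero_iff_of_nonneg fun i _ => ht.1 i.succ).1 h0.symm i (Finset.mem_univ i)
      refine ⟨0, ⟨le_rfl, zero_le_one⟩, funext fun i => ?_⟩
      refine Fin.cases ?_ (fun i => ?_) i
      · rw [cubeToSimplex_succ_zero, Pi.zero_apply]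
        linarith
      · rw [cubeToSimplex_succ_succ, hz, Pi.zero_apply, zero_mul]
    · set r := ∑ i : Fin (q + 1), t i.succ
      obtain ⟨s, hs, hst⟩ := ih (t := fun i => t i.succ / r)
        ⟨fun i => div_nonneg (ht.1 _) hnn, by rw [← Finset.sum_div]; exact div_self hpos.ne'⟩
      refine ⟨Fin.cons r s, ⟨fun i => ?_, fun i => ?_⟩, funext fun i => ?_⟩
      · exact Fin.cases hnn hs.1 i
      · exact Fin.cases (by have := ht.1 0; change r ≤ 1; linarith) hs.2 i
      · refine Fin.cases ?_ (fun i => ?_) i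
        · rw [cubeToSimplex_succ_zero, Fin.cons_zero]
          linarith
        · rw [cubeToSimplex_succ_succ, Fin.cons_zero, Fin.tail_cons, hst]
          field_simp

/-- The face `sᵢ = 1` of the cube parametrizes the face of the simplex opposite to the `i`-th vertex. -/
theorem cubeToSimplex_of_eq_one {q : ℕ} (i : Fin (q + 1)) (s : Fin (q + 1) → ℝ) (hs : s i = 1) :
    cubeToSimplex (q + 1) s i.castSucc = 0 ∧ ∀ j, cubeToSimplex (q + 1) s (i.castSucc.succAbove j) =
      cubeToSimplex q (fun l => s (i.succAbove l)) j := by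
  induction q with
  | zero =>
    obtain rfl := Fin.fin_one_eq_zero i
    refine ⟨by simp [cubeToSimplex_succ_zero, hs], fun j => ?_⟩
    obtain rfl := Fin.fin_one_eq_zero j
    change s 0 * 1 = 1
    rw [hs, mul_one]
  | succ q ih =>
    refine Fin.cases (fun hs => ?_) (fun i hs => ?_) i hs
    · refine ⟨by rw [Fin.castSucc_zero, cubeToSimplex_succ_zero, hs, sub_self], fun j => ?_⟩
      rw [Fin.castSucc_zero, Fin.succAbove_zero, cubeToSimplex_succ_succ, hs, one_mul]
      rfl
    · obtain ⟨h0, h1⟩ := ih i (Fin.tail s) hs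
      refine ⟨?_, fun j => ?_⟩
      · rw [Fin.castSucc_succ, cubeToSimplex_succ_succ, h0, mul_zero]
      · refine Fin.cases ?_ (fun j => ?_) j
        · rw [Fin.castSucc_succ, Fin.succ_succAbove_zero, cubeToSimplex_succ_zero,
            cubeToSimplex_succ_zero, Fin.succ_succAbove_zero]
        · rw [Fin.castSucc_succ, Fin.succ_succAbove_succ, cubeToSimplex_succ_succ, h1,
            cubeToSimplex_succ_succ, Fin.succ_succAbove_zero]
          congr 2
          funext l
          simp [Fin.tail]

/-- The face `s_q = 0` of the cube parametrizes the face of the simplex opposite to the last vertex. -/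
theorem cubeToSimplex_of_last_eq_zero {q : ℕ} (s : Fin (q + 1) → ℝ) (hs : s (Fin.last q) = 0) :
    cubeToSimplex (q + 1) s (Fin.last (q + 1)) = 0 ∧ ∀ j, cubeToSimplex (q + 1) s j.castSucc =
      cubeToSimplex q (fun l => s l.castSucc) j := by
  induction q with
  | zero =>
    have h0 : s 0 = 0 := hs
    refine ⟨?_, fun j => ?_⟩
    · change s 0 * _ = 0
      rw [h0, zero_mul]
    · obtain rfl := Fin.fin_one_eq_zero j
      change 1 - s 0 = 1
      rw [h0, sub_zero]
  | succ q ih =>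
    obtain ⟨h0, h1⟩ := ih (Fin.tail s) hs
    refine ⟨?_, fun j => ?_⟩
    · rw [← Fin.succ_last, cubeToSimplex_succ_succ, h0, mul_zero]
    · refine Fin.cases ?_ (fun j => ?_) j
      · rw [Fin.castSucc_zero, cubeToSimplex_succ_zero, cubeToSimplex_succ_zero, Fin.castSucc_zero]
      · rw [Fin.castSucc_succ, cubeToSimplex_succ_succ, h1, cubeToSimplex_succ_succ]
        rfl

/-- On the face `sᵢ = 0` the collapse does not depend on the later coordinates. -/
theorem cubeToSimplex_congr_of_eq_zero {q : ℕ} (i : Fin q) {s t : Fin q → ℝ} (hs : s i = 0)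
    (hst : ∀ j ≤ i, s j = t j) : cubeToSimplex q s = cubeToSimplex q t := by
  induction q with
  | zero => exact i.elim0
  | succ q ih =>
    have h0 := hst 0 (Fin.zero_le i)
    funext j
    refine Fin.cases ?_ (fun j => ?_) j
    · rw [cubeToSimplex_succ_zero, cubeToSimplex_succ_zero, h0]
    · rw [cubeToSimplex_succ_succ, cubeToSimplex_succ_succ, ← h0]
      revert hs hst
      refine Fin.cases (fun hs _ => ?_) (fun i hs hst => ?_) i
      · rw [hs, zero_mul, zero_mul]
      · rw [ih i (s := Fin.tail s) (t := Fin.tail t) hs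
          fun j hj => hst j.succ (Fin.succ_le_succ_iff.2 hj)]

theorem funOnFinite_linearMap_succAbove {q : ℕ} (i : Fin (q + 1)) (x : Fin q → ℝ) :
    FunOnFinite.linearMap ℝ ℝ i.succAbove x = i.insertNth (0 : ℝ) x := by
  rw [eq_comm, Fin.insertNth_eq_iff]
  constructor
  · rw [FunOnFinite.linearMap_apply_apply, Finset.sum_eq_zero]
    intro j hj
    simp [Fin.succAbove_ne] at hj
  · funext j
    rw [Fin.removeNth, FunOnFinite.linearMap_apply_apply]
    simp [Finset.filter_eq']

theorem fderiv_cubeToSimplex_succ_succ {q : ℕ} (s v : Fin (q + 1) → ℝ) (i : Fin (q + 1)) :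
    fderiv ℝ (cubeToSimplex (q + 1)) s v i.succ = v 0 * cubeToSimplex q (Fin.tail s) i +
      s 0 * fderiv ℝ (cubeToSimplex q) (Fin.tail s) (Fin.tail v) i := by
  have hd := (contDiff_cubeToSimplex (q + 1)).differentiable (by simp) s
  have h := (hasFDerivAt_pi'.1 hd.hasFDerivAt) i.succ
  let T : (Fin (q + 1) → ℝ) →L[ℝ] (Fin q → ℝ) :=
    ContinuousLinearMap.pi fun i => ContinuousLinearMap.proj i.succ
  have h1 : HasFDerivAt (fun s : Fin (q + 1) → ℝ => s 0)
      (ContinuousLinearMap.proj (R := ℝ) (φ := fun _ : Fin (q + 1) => ℝ) 0) s :=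
    (ContinuousLinearMap.proj (R := ℝ) (φ := fun _ : Fin (q + 1) => ℝ) 0).hasFDerivAt
  have hd' := ((contDiff_cubeToSimplex q).differentiable (by simp) (Fin.tail s)).hasFDerivAt
  have h2 : HasFDerivAt (fun s : Fin (q + 1) → ℝ => cubeToSimplex q (Fin.tail s) i)
      (((ContinuousLinearMap.proj i).comp (fderiv ℝ (cubeToSimplex q) (Fin.tail s))).comp T) s :=
    HasFDerivAt.comp (g := fun u => cubeToSimplex q u i) (f := T) s
      ((hasFDerivAt_pi'.1 hd') i) T.hasFDerivAt
  have h3 := congrArg (fun L => L v) (h.unique (h1.mul h2))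
  refine h3.trans ?_
  simp [T]
  ring_nf
  rfl

/-- On a face `sᵢ = 0` the derivative of the collapse annihilates the later directions. Unless `i` is the
last index, the face is therefore degenerate. -/
theorem fderiv_cubeToSimplex_single_eq_zero {q : ℕ} {i j : Fin q} (hij : i < j) {s : Fin q → ℝ}
    (hs : s i = 0) : fderiv ℝ (cubeToSimplex q) s (Pi.single j 1) = 0 := by
  have hd := ((contDiff_cubeToSimplex q).differentiable (by simp) s).hasFDerivAt
  have h := hd.hasLineDerivAt (Pi.single j 1)
  have hc : (fun t : ℝ => cubeToSimplex q (s + t • Pi.single j (1 : ℝ))) =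
      fun _ => cubeToSimplex q s := by
    funext t
    refine (cubeToSimplex_congr_of_eq_zero i hs fun l hl => ?_).symm
    have : l ≠ j := fun h => absurd hij (by rw [← h]; exact not_lt.2 hl)
    simp [Pi.single_eq_of_ne this]
  rw [HasLineDerivAt, hc] at h
  exact h.unique (hasDerivAt_const 0 _)

theorem sum_fderiv_cubeToSimplex (q : ℕ) (s v : Fin q → ℝ) :
    ∑ i, fderiv ℝ (cubeToSimplex q) s v i = 0 := by
  have hd := ((contDiff_cubeToSimplex q).differentiable (by simp) s).hasFDerivAt
  have h := HasFDerivAt.fun_sum (u := Finset.univ) fun i _ => (hasFDerivAt_pi'.1 hd) i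
  simp only [sum_cubeToSimplex] at h
  have h2 := congrArg (fun L => L v) (h.unique (hasFDerivAt_const 1 s))
  simpa using h2

/-- The Jacobian matrix of the collapse, with respect to the frame `eᵢ - e₀` of the simplex. -/
def cubeJacobian (q : ℕ) (s : Fin q → ℝ) : Matrix (Fin q) (Fin q) ℝ :=
  Matrix.of fun i j => fderiv ℝ (cubeToSimplex q) s (Pi.single j 1) i.succ

theorem fderiv_cubeToSimplex_single (q : ℕ) (s : Fin q → ℝ) (j : Fin q) :
    fderiv ℝ (cubeToSimplex q) s (Pi.single j 1) =
      ∑ i, cubeJacobian q s i j • (Pi.single i.succ 1 - Pi.single 0 1 : Fin (q + 1) → ℝ) := by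
  funext l
  have h := sum_fderiv_cubeToSimplex q s (Pi.single j 1)
  rw [Fin.sum_univ_succ] at h
  rw [Finset.sum_apply]
  refine Fin.cases ?_ (fun l => ?_) l
  · simp only [Pi.smul_apply, Pi.sub_apply, Pi.single_eq_same, smul_eq_mul]
    rw [eq_neg_of_add_eq_zero_left h, ← Finset.sum_neg_distrib]
    refine Finset.sum_congr rfl fun i _ => ?_
    rw [Pi.single_eq_of_ne (Fin.succ_ne_zero i).symm]
    simp [cubeJacobian]
  · simp only [Pi.smul_apply, Pi.sub_apply, smul_eq_mul, Pi.single_eq_of_ne (Fin.succ_ne_zero l),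
      sub_zero]
    rw [Finset.sum_eq_single l]
    · simp [cubeJacobian]
    · intro b _ hb
      rw [Pi.single_eq_of_ne (fun h => hb (Fin.succ_injective _ h).symm), mul_zero]
    · simp

/-- The collapse preserves orientation: adding all rows to the first one reduces the Jacobian
determinant to the one in the previous dimension. -/
theorem det_cubeJacobian_pos {q : ℕ} {s : Fin q → ℝ} (hs : s ∈ openCube q) :
    0 < (cubeJacobian q s).det := by
  induction q with
  | zero => simp
  | succ q ih =>
    have h0 : ∀ i, cubeJacobian (q + 1) s i 0 = cubeToSimplex q (Fin.tail s) i := by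
      intro i
      have : Fin.tail (Pi.single 0 1 : Fin (q + 1) → ℝ) = 0 := by
        funext l
        simp [Fin.tail]
      rw [cubeJacobian, Matrix.of_apply, fderiv_cubeToSimplex_succ_succ, this, map_zero]
      simp
    have h1 : ∀ i j, cubeJacobian (q + 1) s i (Fin.succ j) =
        s 0 * fderiv ℝ (cubeToSimplex q) (Fin.tail s) (Pi.single j 1) i := by
      intro i j
      have : Fin.tail (Pi.single j.succ 1 : Fin (q + 1) → ℝ) = Pi.single j 1 := by
        funext l
        simp [Fin.tail, Pi.single_apply]
      rw [cubeJacobian, Matrix.of_apply, fderiv_cubeToSimplex_succ_succ, this]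
      simp
    have hrow : (∑ k, (1 : ℝ) • cubeJacobian (q + 1) s k) = Pi.single 0 1 := by
      funext j
      simp only [one_smul]
      refine (Finset.sum_apply j _ _).trans ?_
      refine Fin.cases ?_ (fun j => ?_) j
      · simp [h0, sum_cubeToSimplex]
      · simp [h1, ← Finset.mul_sum, sum_fderiv_cubeToSimplex]
    have hdet := Matrix.det_updateRow_sum (cubeJacobian (q + 1) s) 0 (fun _ => 1)
    rw [hrow, one_smul] at hdet
    rw [← hdet, Matrix.det_succ_row_zero, Finset.sum_eq_single 0]
    · have hsub : ((cubeJacobian (q + 1) s).updateRow 0 (Pi.single 0 1)).submatrix Fin.succ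
          (Fin.succAbove 0) = s 0 • cubeJacobian q (Fin.tail s) := by
        ext i j
        simp only [Matrix.submatrix_apply, Fin.succAbove_zero, Matrix.smul_apply, smul_eq_mul,
          Matrix.updateRow_ne (Fin.succ_ne_zero i), h1]
        rfl
      rw [hsub, Matrix.det_smul]
      simp only [Fin.val_zero, pow_zero, Matrix.updateRow_self, Pi.single_eq_same, one_mul]
      exact mul_pos (pow_pos (hs 0 (mem_univ _)).1 _) (ih (tail_mem_openCube hs))
    · intro j _ hj
      rw [Matrix.updateRow_self, Pi.single_eq_of_ne hj]
      ring
    · simp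

end CubeToSimplex

/-! ### Pulling forms back to Euclidean spaces -/

section Pullback

variable {n : ℕ} {M : Type*} [TopologicalSpace M] [ChartedSpace (EuclideanSpace ℝ (Fin n)) M]
  {E E' : Type*} [NormedAddCommGroup E] [NormedSpace ℝ E] [NormedAddCommGroup E']
  [NormedSpace ℝ E'] {k : ℕ}

/-- The pull-back `G^*α` of a form on `M` along a map from a normed space. -/
def pullbackForm (α : ∀ x : M, TangentSpace (𝓡 n) x [⋀^Fin k]→L[ℝ] ℝ) (G : E → M) (y : E) :
    E [⋀^Fin k]→L[ℝ] ℝ :=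
  (α (G y)).compContinuousLinearMap (mfderiv 𝓘(ℝ, E) (𝓡 n) G y)

theorem pullbackForm_apply (α : ∀ x : M, TangentSpace (𝓡 n) x [⋀^Fin k]→L[ℝ] ℝ) (G : E → M) (y : E)
    (v : Fin k → E) :
    pullbackForm α G y v = α (G y) (fun i => mfderiv 𝓘(ℝ, E) (𝓡 n) G y (v i)) := rfl

theorem pullbackForm_congr (α : ∀ x : M, TangentSpace (𝓡 n) x [⋀^Fin k]→L[ℝ] ℝ) {G G' : E → M}
    {y : E} (h : G =ᶠ[𝓝 y] G') : pullbackForm α G y = pullbackForm α G' y := by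
  let A : M → EuclideanSpace ℝ (Fin n) [⋀^Fin k]→L[ℝ] ℝ := α
  have h1 : A (G y) = A (G' y) := congrArg A h.eq_of_nhds
  have h2 : (mfderiv 𝓘(ℝ, E) (𝓡 n) G y : E →L[ℝ] EuclideanSpace ℝ (Fin n)) =
    mfderiv 𝓘(ℝ, E) (𝓡 n) G' y := h.mfderiv_eq
  change (A (G y)).compContinuousLinearMap _ = (A (G' y)).compContinuousLinearMap _
  rw [h1]
  exact congrArg _ h2

theorem pullbackForm_comp (α : ∀ x : M, TangentSpace (𝓡 n) x [⋀^Fin k]→L[ℝ] ℝ) {G : E → M}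
    {f : E' → E} {y : E'} (hG : MDifferentiableAt 𝓘(ℝ, E) (𝓡 n) G (f y))
    (hf : DifferentiableAt ℝ f y) :
    pullbackForm α (G ∘ f) y = (pullbackForm α G (f y)).compContinuousLinearMap (fderiv ℝ f y) := by
  have h : mfderiv 𝓘(ℝ, E') (𝓡 n) (G ∘ f) y =
      (mfderiv 𝓘(ℝ, E) (𝓡 n) G (f y)).comp (mfderiv 𝓘(ℝ, E') 𝓘(ℝ, E) f y) :=
    mfderiv_comp y hG hf.mdifferentiableAt
  rw [mfderiv_eq_fderiv] at h
  ext v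
  rw [pullbackForm_apply, h]
  rfl

variable [IsManifold (𝓡 n) ∞ M]

/-- Locally, a pull-back from a manifold is a pull-back of the coordinate expression of the form. -/
theorem pullbackForm_eventuallyEq (α : ∀ x : M, TangentSpace (𝓡 n) x [⋀^Fin k]→L[ℝ] ℝ) {G : E → M}
    {y : E} (hG : ContMDiffAt 𝓘(ℝ, E) (𝓡 n) ∞ G y) :
    pullbackForm α G =ᶠ[𝓝 y] fun z => (formInChart α (G y) (extChartAt (𝓡 n) (G y) (G z))
      ).compContinuousLinearMap (fderiv ℝ (fun z => extChartAt (𝓡 n) (G y) (G z)) z) := by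
  have h12 : (1 : WithTop ℕ∞) ≤ ∞ := by exact_mod_cast le_top
  have := IsManifold.of_le (I := 𝓡 n) (M := M) h12
  have h1 : ∀ᶠ z in 𝓝 y, ContMDiffAt 𝓘(ℝ, E) (𝓡 n) 1 G z :=
    (contMDiffAt_iff_contMDiffAt_nhds (by simp)).1 (hG.of_le h12)
  have h2 : ∀ᶠ z in 𝓝 y, G z ∈ (chartAt (EuclideanSpace ℝ (Fin n)) (G y)).source :=
    hG.continuousAt.eventually ((chartAt _ (G y)).open_source.mem_nhds (mem_chart_source _ _))
  filter_upwards [h1, h2, h2.eventually_nhds] with z hz hz2 hz3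
  have hφ : ContMDiffAt (𝓡 n) 𝓘(ℝ, EuclideanSpace ℝ (Fin n)) 1 (extChartAt (𝓡 n) (G y)) (G z) :=
    contMDiffAt_extChartAt' hz2
  have hs : G z ∈ (extChartAt (𝓡 n) (G y)).source := by rwa [extChartAt_source]
  have ht : extChartAt (𝓡 n) (G y) (G z) ∈ (extChartAt (𝓡 n) (G y)).target :=
    (extChartAt (𝓡 n) (G y)).map_source hs
  have hsymm : ContMDiffAt 𝓘(ℝ, EuclideanSpace ℝ (Fin n)) (𝓡 n) ∞ (extChartAt (𝓡 n) (G y)).symm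
      (extChartAt (𝓡 n) (G y) (G z)) :=
    (contMDiffOn_extChartAt_symm (G y)).contMDiffAt ((isOpen_extChartAt_target (G y)).mem_nhds ht)
  have hd : DifferentiableAt ℝ (fun z => extChartAt (𝓡 n) (G y) (G z)) z :=
    ((hφ.comp z hz).contDiffAt).differentiableAt (by simp)
  have hcongr : G =ᶠ[𝓝 z] (extChartAt (𝓡 n) (G y)).symm ∘ fun z => extChartAt (𝓡 n) (G y) (G z) := by
    filter_upwards [hz3] with w hw
    exact ((extChartAt (𝓡 n) (G y)).left_inv (by rwa [extChartAt_source])).symm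
  rw [pullbackForm_congr α hcongr, pullbackForm_comp α
    (f := fun z => extChartAt (𝓡 n) (G y) (G z)) (hsymm.mdifferentiableAt (by simp)) hd]
  rfl

theorem IsSmoothForm.differentiableAt_pullbackForm
    {α : ∀ x : M, TangentSpace (𝓡 n) x [⋀^Fin k]→L[ℝ] ℝ} (hα : IsSmoothForm α) {G : E → M}
    {y : E} (hG : ContMDiffAt 𝓘(ℝ, E) (𝓡 n) ∞ G y) :
    DifferentiableAt ℝ (pullbackForm α G) y := by
  refine DifferentiableAt.congr_of_eventuallyEq ?_ (pullbackForm_eventuallyEq α hG)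
  have hφ : ContMDiffAt (𝓡 n) 𝓘(ℝ, EuclideanSpace ℝ (Fin n)) ∞ (extChartAt (𝓡 n) (G y)) (G y) :=
    contMDiffAt_extChartAt
  have hc : ContDiffAt ℝ ∞ (fun z => extChartAt (𝓡 n) (G y) (G z)) y := (hφ.comp y hG).contDiffAt
  have hform : DifferentiableAt ℝ (formInChart α (G y)) (extChartAt (𝓡 n) (G y) (G y)) :=
    ((hα (G y)).contDiffAt (extChartAt_target_mem_nhds (G y))).differentiableAt (by simp)
  refine DifferentiableAt.continuousAlternatingMapCompContinuousLinearMap ?_ ?_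
  · exact hform.comp y (hc.differentiableAt (by simp))
  · exact (hc.fderiv_right (m := ∞) (by simp)).differentiableAt (by simp)

theorem IsClosedForm.extDeriv_pullbackForm
    {α : ∀ x : M, TangentSpace (𝓡 n) x [⋀^Fin k]→L[ℝ] ℝ} (hs : IsSmoothForm α)
    (hα : IsClosedForm α) {G : E → M} {y : E} (hG : ContMDiffAt 𝓘(ℝ, E) (𝓡 n) ∞ G y) :
    extDeriv (pullbackForm α G) y = 0 := by
  rw [(pullbackForm_eventuallyEq α hG).extDeriv_eq]
  have hφ : ContMDiffAt (𝓡 n) 𝓘(ℝ, EuclideanSpace ℝ (Fin n)) ∞ (extChartAt (𝓡 n) (G y)) (G y) :=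
    contMDiffAt_extChartAt
  have hc : ContDiffAt ℝ ∞ (fun z => extChartAt (𝓡 n) (G y) (G z)) y := (hφ.comp y hG).contDiffAt
  have hform : DifferentiableAt ℝ (formInChart α (G y)) (extChartAt (𝓡 n) (G y) (G y)) :=
    ((hs (G y)).contDiffAt (extChartAt_target_mem_nhds (G y))).differentiableAt (by simp)
  rw [extDeriv_pullback (r := ∞) (f := fun z => extChartAt (𝓡 n) (G y) (G z)) hform hc
    (by
      rw [minSmoothness_of_isRCLikeNormedField]
      exact WithTop.coe_le_coe.2 (le_top (a := (2 : ℕ∞)))),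
    hα (G y) _ (mem_extChartAt_target (G y))]
  ext v
  rfl

end Pullback

/-! ### Integration over smooth simplices and Stokes' theorem -/

section Stokes

variable {n : ℕ} {M : Type*} [TopologicalSpace M] [ChartedSpace (EuclideanSpace ℝ (Fin n)) M]
  {k q : ℕ}

open Classical in
/-- A smooth simplex precomposed with the collapse of the cube onto the standard simplex (and extended
by a constant where the collapse leaves the simplex). -/
def SmoothSimplex.onCube (σ : SmoothSimplex n M q) (s : Fin q → ℝ) : M :=
  if h : cubeToSimplex q s ∈ stdSimplex ℝ (Fin (q + 1)) then σ.toFun ⟨cubeToSimplex q s, h⟩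
  else σ.toFun ⟨cubeToSimplex q 0, cubeToSimplex_mem_stdSimplex ⟨le_rfl, zero_le_one⟩⟩

theorem SmoothSimplex.onCube_of_mem (σ : SmoothSimplex n M q) {s : Fin q → ℝ}
    (hs : s ∈ Icc (0 : Fin q → ℝ) 1) :
    σ.onCube s = σ.toFun ⟨cubeToSimplex q s, cubeToSimplex_mem_stdSimplex hs⟩ :=
  dif_pos _

/-- The integral of a `q`-form over a smooth singular `q`-simplex, computed on the cube. -/
def simplexIntegral (α : ∀ x : M, TangentSpace (𝓡 n) x [⋀^Fin q]→L[ℝ] ℝ)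
    (σ : SmoothSimplex n M q) : ℝ :=
  ∫ s in openCube q, pullbackForm α σ.onCube s (fun i => Pi.single i 1)

/-- The integral over a simplex may be computed with any map extending it. -/
theorem simplexIntegral_eq_of_extension (α : ∀ x : M, TangentSpace (𝓡 n) x [⋀^Fin q]→L[ℝ] ℝ)
    (σ : SmoothSimplex n M q) {F : (Fin (q + 1) → ℝ) → M}
    (hF : ∀ t : stdSimplex ℝ (Fin (q + 1)), F t = σ.toFun t) :
    simplexIntegral α σ =
      ∫ s in openCube q, pullbackForm α (F ∘ cubeToSimplex q) s (fun i => Pi.single i 1) := by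
  refine setIntegral_congr_fun (isOpen_openCube q).measurableSet fun s hs => ?_
  have : σ.onCube =ᶠ[𝓝 s] F ∘ cubeToSimplex q := by
    filter_upwards [(isOpen_openCube q).mem_nhds hs] with t ht
    rw [σ.onCube_of_mem (openCube_subset_Icc q ht), ← hF]
    rfl
  simp only [pullbackForm_congr α this]

theorem contMDiffAt_comp_cubeToSimplex {U : Set (Fin (q + 1) → ℝ)} {F : (Fin (q + 1) → ℝ) → M}
    (hU : IsOpen U) (hsub : stdSimplex ℝ (Fin (q + 1)) ⊆ U)
    (hF : ContMDiffOn 𝓘(ℝ, Fin (q + 1) → ℝ) (𝓡 n) ∞ F U) {s : Fin q → ℝ}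
    (hs : s ∈ Icc (0 : Fin q → ℝ) 1) :
    ContMDiffAt 𝓘(ℝ, Fin q → ℝ) (𝓡 n) ∞ (F ∘ cubeToSimplex q) s :=
  (hF.contMDiffAt (hU.mem_nhds (hsub (cubeToSimplex_mem_stdSimplex hs)))).comp s
    (contDiff_cubeToSimplex q).contMDiff.contMDiffAt

theorem hasFDerivAt_insertNth (i : Fin (q + 1)) (c : ℝ) (x : Fin q → ℝ) :
    HasFDerivAt (fun x : Fin q → ℝ => (i.insertNth c x : Fin (q + 1) → ℝ))
      (ContinuousLinearMap.pi (i.insertNth (0 : (Fin q → ℝ) →L[ℝ] ℝ)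
        fun j => ContinuousLinearMap.proj j)) x := by
  refine hasFDerivAt_pi.2 fun l => ?_
  refine Fin.succAboveCases i ?_ (fun j => ?_) l
  · simpa using hasFDerivAt_const c x
  · simpa using hasFDerivAt_apply (𝕜 := ℝ) j x

variable [IsManifold (𝓡 n) ∞ M]

/-- **Stokes' theorem** for a closed form on a smooth simplex. On the cube, the faces `sᵢ = 1` and
`s_q = 0` parametrize the faces of the simplex, and the other ones are degenerate. -/
theorem sum_simplexIntegral_face_eq_zero {α : ∀ x : M, TangentSpace (𝓡 n) x [⋀^Fin q]→L[ℝ] ℝ}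
    (hs : IsSmoothForm α) (hα : IsClosedForm α) (σ : SmoothSimplex n M (q + 1)) :
    ∑ i : Fin (q + 2), (-1 : ℝ) ^ (i : ℕ) * simplexIntegral α (σ.face i) = 0 := by
  obtain ⟨U, F, hU, hsub, hF, hFσ⟩ := σ.exists_extension
  set G : (Fin (q + 1) → ℝ) → M := F ∘ cubeToSimplex (q + 1) with hG
  have hGs : ∀ s ∈ Icc (0 : Fin (q + 1) → ℝ) 1, ContMDiffAt 𝓘(ℝ, Fin (q + 1) → ℝ) (𝓡 n) ∞ G s :=
    fun s hs => contMDiffAt_comp_cubeToSimplex hU hsub hF hs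
  set β := pullbackForm α G with hβ
  have hβd : ∀ s ∈ Icc (0 : Fin (q + 1) → ℝ) 1, DifferentiableAt ℝ β s := fun s h =>
    hs.differentiableAt_pullbackForm (hGs s h)
  let e : Fin (q + 1) → Fin (q + 1) → ℝ := fun j => Pi.single j 1
  let f : Fin (q + 1) → (Fin (q + 1) → ℝ) → ℝ := fun i s => (-1) ^ (i : ℕ) * β s (i.removeNth e)
  let ev : Fin (q + 1) → ((Fin (q + 1) → ℝ) [⋀^Fin q]→L[ℝ] ℝ) →L[ℝ] ℝ := fun i : Fin (q + 1) =>
    ContinuousAlternatingMap.apply ℝ (Fin (q + 1) → ℝ) ℝ (Fin.removeNth i e)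
  let f' : Fin (q + 1) → (Fin (q + 1) → ℝ) → (Fin (q + 1) → ℝ) →L[ℝ] ℝ := fun i s =>
    (-1 : ℝ) ^ (i : ℕ) • fderiv ℝ (fun s => β s (i.removeNth e)) s
  have hβi : ∀ s ∈ Icc (0 : Fin (q + 1) → ℝ) 1, ∀ i : Fin (q + 1),
      DifferentiableAt ℝ (fun s => β s (i.removeNth e)) s := fun s h i =>
    (ev i).differentiableAt.comp s (hβd s h)
  have hsum : ∀ s ∈ Icc (0 : Fin (q + 1) → ℝ) 1, ∑ i, f' i s (Pi.single i 1) = 0 := by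
    intro s h
    have h1 := extDeriv_apply (hβd s h) e
    rw [hα.extDeriv_pullbackForm hs (hGs s h)] at h1
    refine Eq.trans ?_ h1.symm
    simp [f', e]
  have hzero : ∫ s in Icc (0 : Fin (q + 1) → ℝ) 1, ∑ i, f' i s (Pi.single i 1) = 0 := by
    rw [setIntegral_congr_fun measurableSet_Icc (g := fun _ => (0 : ℝ)) hsum]
    simp
  have hdiv := integral_divergence_of_hasFDerivAt_off_countable' (0 : Fin (q + 1) → ℝ) 1 zero_le_one
    f f' ∅ countable_empty
    (fun i s h => ((hβi s h i).continuousAt.const_mul _).continuousWithinAt)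
    (fun s h i => by
      have hmem : s ∈ Icc (0 : Fin (q + 1) → ℝ) 1 := openCube_subset_Icc (q + 1) h.1
      exact (hβi s hmem i).hasFDerivAt.const_mul _)
    (by
      refine IntegrableOn.congr_fun (f := fun _ => (0 : ℝ)) (integrableOn_zero) ?_ measurableSet_Icc
      exact fun s h => (hsum s h).symm)
  rw [hzero] at hdiv
  have hins : ∀ (i : Fin (q + 1)) (c : ℝ), c ∈ Icc (0 : ℝ) 1 → ∀ x ∈ Icc (0 : Fin q → ℝ) 1,
      (i.insertNth c x : Fin (q + 1) → ℝ) ∈ Icc (0 : Fin (q + 1) → ℝ) 1 := by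
    intro i c hc x hx
    constructor
    · intro l
      refine Fin.succAboveCases i ?_ (fun j => ?_) l
      · simpa using hc.1
      · simpa using hx.1 j
    · intro l
      refine Fin.succAboveCases i ?_ (fun j => ?_) l
      · simpa using hc.2
      · simpa using hx.2 j
  -- On each face of the cube `β` restricts to the pull-back of `α` along the restricted map.
  have hres : ∀ (i : Fin (q + 1)) (c : ℝ), c ∈ Icc (0 : ℝ) 1 → ∀ x ∈ Icc (0 : Fin q → ℝ) 1,
      β (i.insertNth c x) (i.removeNth e) =
        pullbackForm α (fun x => G (i.insertNth c x)) x (fun j => Pi.single j 1) := by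
    intro i c hc x hx
    have hd := hasFDerivAt_insertNth i c x
    have h1 := pullbackForm_comp α (G := G) (f := fun x => i.insertNth c x) (y := x)
      ((hGs _ (hins i c hc x hx)).mdifferentiableAt (by simp)) hd.differentiableAt
    have h2 : (i.removeNth e) = fun j => fderiv ℝ (fun x : Fin q → ℝ =>
        (i.insertNth c x : Fin (q + 1) → ℝ)) x (Pi.single j 1) := by
      funext j l
      rw [hd.fderiv]
      refine Fin.succAboveCases i ?_ (fun m => ?_) l
      · simp [e, Fin.removeNth]
      · simp [e, Fin.removeNth, Pi.single_apply]
    rw [h2]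
    exact (congrArg (fun g => g (fun j => Pi.single j 1)) h1).symm
  -- If the face `sᵢ = c` of the cube parametrizes the face of the simplex opposite to the vertex `m`,
  -- the two integrals agree.
  have hface : ∀ (i : Fin (q + 1)) (c : ℝ) (m : Fin (q + 2)), c ∈ Icc (0 : ℝ) 1 →
      (∀ x, cubeToSimplex (q + 1) (i.insertNth c x) = m.insertNth (0 : ℝ) (cubeToSimplex q x)) →
      ∫ x in Icc (0 : Fin q → ℝ) 1, f i (i.insertNth c x) =
        (-1 : ℝ) ^ (i : ℕ) * simplexIntegral α (σ.face m) := by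
    intro i c m hc hm
    rw [simplexIntegral_eq_of_extension α (σ.face m)
      (F := F ∘ fun t => m.insertNth (0 : ℝ) t) (fun t => by
        change F _ = σ.toFun (stdSimplex.map m.succAbove t)
        rw [← hFσ]
        exact congrArg F (funOnFinite_linearMap_succAbove m t).symm),
      setIntegral_congr_set (openCube_ae_eq_Icc q), ← integral_const_mul]
    refine setIntegral_congr_fun measurableSet_Icc fun x hx => ?_
    simp only [f]
    rw [hres i c hc x hx]
    simp only [hG, Function.comp_def, hm]
  have hfront : ∀ i : Fin (q + 1), ∫ x in Icc (0 : Fin q → ℝ) 1, f i (i.insertNth (1 : ℝ) x) =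
      (-1 : ℝ) ^ (i : ℕ) * simplexIntegral α (σ.face i.castSucc) := by
    intro i
    refine hface i 1 i.castSucc ⟨zero_le_one, le_rfl⟩ fun x => ?_
    obtain ⟨h0, h1⟩ := cubeToSimplex_of_eq_one i (i.insertNth (1 : ℝ) x) (by simp)
    rw [eq_comm, Fin.insertNth_eq_iff]
    refine ⟨h0.symm, funext fun j => ?_⟩
    rw [Fin.removeNth, h1]
    simp
  have hlast : ∫ x in Icc (0 : Fin q → ℝ) 1, f (Fin.last q) ((Fin.last q).insertNth (0 : ℝ) x) =
      (-1 : ℝ) ^ q * simplexIntegral α (σ.face (Fin.last (q + 1))) := by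
    refine hface (Fin.last q) 0 (Fin.last (q + 1)) ⟨le_rfl, zero_le_one⟩ fun x => ?_
    obtain ⟨h0, h1⟩ := cubeToSimplex_of_last_eq_zero ((Fin.last q).insertNth (0 : ℝ) x) (by simp)
    rw [eq_comm, Fin.insertNth_eq_iff]
    refine ⟨h0.symm, funext fun j => ?_⟩
    rw [Fin.removeNth, Fin.succAbove_last, h1]
    simp
  -- The faces `sᵢ = 0` with `i < q` are degenerate in the direction of the next coordinate.
  have hback : ∀ i : Fin q, ∫ x in Icc (0 : Fin q → ℝ) 1,
      f i.castSucc (i.castSucc.insertNth (0 : ℝ) x) = 0 := by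
    intro i
    rw [setIntegral_congr_fun measurableSet_Icc (g := fun _ => (0 : ℝ)) fun x hx => ?_]
    · simp
    have hmem := hins i.castSucc 0 ⟨le_rfl, zero_le_one⟩ x hx
    have h1 := pullbackForm_comp α (G := F) (f := cubeToSimplex (q + 1))
      (y := i.castSucc.insertNth (0 : ℝ) x)
      ((hF.contMDiffAt (hU.mem_nhds (hsub (cubeToSimplex_mem_stdSimplex hmem)))).mdifferentiableAt
        (by simp)) ((contDiff_cubeToSimplex (q + 1)).differentiable (by simp) _)
    simp only [f, hβ, hG]
    rw [h1, ContinuousAlternatingMap.compContinuousLinearMap_apply,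
      ContinuousAlternatingMap.map_coord_zero _ i, mul_zero]
    simp only [Function.comp_apply, e, Fin.removeNth]
    refine fderiv_cubeToSimplex_single_eq_zero (i := i.castSucc) ?_ (by simp)
    rw [Fin.succAbove_castSucc_self]
    exact Fin.castSucc_lt_succ
  rw [Fin.sum_univ_castSucc]
  rw [Finset.sum_sub_distrib, Fin.sum_univ_castSucc (n := q)
    (f := fun i => ∫ x in _, f i (i.insertNth ((0 : Fin (q + 1) → ℝ) i) x))] at hdiv
  have e0 : ∀ i : Fin (q + 1), (0 : Fin (q + 1) → ℝ) ∘ i.succAbove = 0 := fun i => rfl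
  have e1 : ∀ i : Fin (q + 1), (1 : Fin (q + 1) → ℝ) ∘ i.succAbove = 1 := fun i => rfl
  simp only [e0, e1, Pi.zero_apply, Pi.one_apply, hfront, hlast, hback, Finset.sum_const_zero,
    zero_add] at hdiv
  rw [Fin.val_last, pow_succ]
  simp only [Fin.val_castSucc]
  linarith

/-- Integration of a form over chains. -/
def chainIntegral (α : ∀ x : M, TangentSpace (𝓡 n) x [⋀^Fin q]→L[ℝ] ℝ) :
    SmoothChain n M q →ₗ[ℝ] ℝ :=
  Finsupp.linearCombination ℝ (simplexIntegral α)

theorem chainIntegral_boundary {α : ∀ x : M, TangentSpace (𝓡 n) x [⋀^Fin q]→L[ℝ] ℝ}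
    (hs : IsSmoothForm α) (hα : IsClosedForm α) (b : SmoothChain n M (q + 1)) :
    chainIntegral α (SmoothChain.boundary b) = 0 := by
  have : (chainIntegral α).comp SmoothChain.boundary = 0 := by
    refine Finsupp.lhom_ext' fun σ => LinearMap.ext_ring ?_
    simp only [LinearMap.comp_apply, Finsupp.lsingle_apply, SmoothChain.boundary,
      Finsupp.linearCombination_single, one_smul, map_sum, chainIntegral, smul_eq_mul,
      LinearMap.zero_apply]
    exact sum_simplexIntegral_face_eq_zero hs hα σ
  exact congrArg (fun L => L b) this

end Stokes

/-! ### Coordinates and signs on an oriented manifold -/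

section Coordinates

variable {q : ℕ} {S : Type*} [TopologicalSpace S] [ChartedSpace (EuclideanSpace ℝ (Fin q)) S]
  {E E' : Type*} [NormedAddCommGroup E] [NormedSpace ℝ E] [NormedAddCommGroup E']
  [NormedSpace ℝ E']

/-- The sign of the image under `dG` of a frame `v`, with respect to an orientation of the target. -/
def frameSignAlong (o : ManifoldOrientation q S) (G : E → S) (v : Fin q → E) (y : E) : ℝ :=
  (o.orient (G y)).frameSign fun i => mfderiv 𝓘(ℝ, E) (𝓡 q) G y (v i)

theorem frameSignAlong_congr (o : ManifoldOrientation q S) {G G' : E → S} {y : E} (v : Fin q → E)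
    (h : G =ᶠ[𝓝 y] G') : frameSignAlong o G v y = frameSignAlong o G' v y := by
  let A : S → Orientation ℝ (EuclideanSpace ℝ (Fin q)) (Fin q) := o.orient
  have h1 : A (G y) = A (G' y) := congrArg A h.eq_of_nhds
  have h2 : (mfderiv 𝓘(ℝ, E) (𝓡 q) G y : E →L[ℝ] EuclideanSpace ℝ (Fin q)) =
    mfderiv 𝓘(ℝ, E) (𝓡 q) G' y := h.mfderiv_eq
  change (A (G y)).frameSign (fun i => (mfderiv 𝓘(ℝ, E) (𝓡 q) G y : E →L[ℝ]
    EuclideanSpace ℝ (Fin q)) (v i)) = (A (G' y)).frameSign (fun i =>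
    (mfderiv 𝓘(ℝ, E) (𝓡 q) G' y : E →L[ℝ] EuclideanSpace ℝ (Fin q)) (v i))
  rw [h1, h2]
  rfl

theorem mfderiv_comp_of_normedSpace {n : ℕ} {M : Type*} [TopologicalSpace M]
    [ChartedSpace (EuclideanSpace ℝ (Fin n)) M] {G : E → M} {f : E' → E} {y : E'}
    (hG : MDifferentiableAt 𝓘(ℝ, E) (𝓡 n) G (f y)) (hf : DifferentiableAt ℝ f y) (v : E') :
    mfderiv 𝓘(ℝ, E') (𝓡 n) (G ∘ f) y v = mfderiv 𝓘(ℝ, E) (𝓡 n) G (f y) (fderiv ℝ f y v) := by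
  have h : mfderiv 𝓘(ℝ, E') (𝓡 n) (G ∘ f) y =
      (mfderiv 𝓘(ℝ, E) (𝓡 n) G (f y)).comp (mfderiv 𝓘(ℝ, E') 𝓘(ℝ, E) f y) :=
    mfderiv_comp y hG hf.mdifferentiableAt
  rw [mfderiv_eq_fderiv] at h
  exact congrArg (fun L => L v) h

theorem frameSignAlong_comp (o : ManifoldOrientation q S) {G : E → S} {f : E' → E} {y : E'}
    (hG : MDifferentiableAt 𝓘(ℝ, E) (𝓡 q) G (f y)) (hf : DifferentiableAt ℝ f y)
    {v : Fin q → E'} {w : Fin q → E} {D : Matrix (Fin q) (Fin q) ℝ}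
    (hD : ∀ j, fderiv ℝ f y (v j) = ∑ i, D i j • w i) :
    frameSignAlong o (G ∘ f) v y = (SignType.sign D.det : ℝ) * frameSignAlong o G w (f y) := by
  have h : (fun j => mfderiv 𝓘(ℝ, E') (𝓡 q) (G ∘ f) y (v j)) =
      fun j => ∑ i, D i j • mfderiv 𝓘(ℝ, E) (𝓡 q) G (f y) (w i) := by
    funext j
    rw [mfderiv_comp_of_normedSpace hG hf, hD]
    exact (map_sum _ _ _).trans (Finset.sum_congr rfl fun i _ => map_smul _ _ _)
  rw [frameSignAlong, h]
  exact Orientation.frameSign_matrix_sum_smul _ D _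

theorem pullbackForm_comp_apply {n : ℕ} {M : Type*} [TopologicalSpace M]
    [ChartedSpace (EuclideanSpace ℝ (Fin n)) M]
    (α : ∀ x : M, TangentSpace (𝓡 n) x [⋀^Fin q]→L[ℝ] ℝ) {G : E → M} {f : E' → E} {y : E'}
    (hG : MDifferentiableAt 𝓘(ℝ, E) (𝓡 n) G (f y)) (hf : DifferentiableAt ℝ f y)
    {v : Fin q → E'} {w : Fin q → E} {D : Matrix (Fin q) (Fin q) ℝ}
    (hD : ∀ j, fderiv ℝ f y (v j) = ∑ i, D i j • w i) :
    pullbackForm α (G ∘ f) y v = D.det * pullbackForm α G (f y) w := by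
  rw [pullbackForm_comp α hG hf]
  have h : (fun j => fderiv ℝ f y (v j)) = fun j => ∑ i, D i j • w i := funext hD
  change pullbackForm α G (f y) (fun j => fderiv ℝ f y (v j)) = _
  rw [h]
  exact AlternatingMap.map_matrix_sum_smul (pullbackForm α G (f y)).toAlternatingMap D w

/-- The standard frame of `ℝ^q`. -/
def stdFrame (q : ℕ) (i : Fin q) : Fin q → ℝ := Pi.single i 1

theorem fderiv_stdFrame (f : (Fin q → ℝ) → Fin q → ℝ) (y : Fin q → ℝ) (j : Fin q) :
    fderiv ℝ f y (stdFrame q j) =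
      ∑ i, LinearMap.toMatrix' (fderiv ℝ f y : (Fin q → ℝ) →ₗ[ℝ] Fin q → ℝ) i j • stdFrame q i := by
  funext l
  rw [Finset.sum_apply, Finset.sum_eq_single l]
  · simp [stdFrame, LinearMap.toMatrix'_apply]
  · intro i _ hi
    simp [stdFrame, Pi.single_eq_of_ne hi.symm]
  · simp

theorem det_toMatrix'_fderiv (f : (Fin q → ℝ) → Fin q → ℝ) (y : Fin q → ℝ) :
    (LinearMap.toMatrix' (fderiv ℝ f y : (Fin q → ℝ) →ₗ[ℝ] Fin q → ℝ)).det = (fderiv ℝ f y).det :=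
  LinearMap.det_toMatrix' _

/-- The chart centred at `x₀`, with values in `ℝ^q` with its product measure. -/
def coordMap (x₀ : S) (x : S) : Fin q → ℝ := EuclideanSpace.equiv (Fin q) ℝ (extChartAt (𝓡 q) x₀ x)

/-- The parametrization inverse to `coordMap`. -/
def coordInv (x₀ : S) (u : Fin q → ℝ) : S :=
  (extChartAt (𝓡 q) x₀).symm ((EuclideanSpace.equiv (Fin q) ℝ).symm u)

/-- The coordinate domain of the chart centred at `x₀`. -/
def coordTarget (x₀ : S) : Set (Fin q → ℝ) :=
  (EuclideanSpace.equiv (Fin q) ℝ).symm ⁻¹' (extChartAt (𝓡 q) x₀).target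

theorem isOpen_coordTarget (x₀ : S) : IsOpen (coordTarget (q := q) x₀) :=
  (isOpen_extChartAt_target x₀).preimage (EuclideanSpace.equiv (Fin q) ℝ).symm.continuous

theorem coordInv_mem_source {x₀ : S} {u : Fin q → ℝ} (hu : u ∈ coordTarget x₀) :
    coordInv x₀ u ∈ (extChartAt (𝓡 q) x₀).source := (extChartAt (𝓡 q) x₀).map_target hu

theorem coordMap_mem_target {x₀ x : S} (hx : x ∈ (extChartAt (𝓡 q) x₀).source) :
    coordMap x₀ x ∈ coordTarget (q := q) x₀ := by
  simpa [coordMap, coordTarget] using (extChartAt (𝓡 q) x₀).map_source hx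

theorem coordInv_coordMap {x₀ x : S} (hx : x ∈ (extChartAt (𝓡 q) x₀).source) :
    coordInv x₀ (coordMap (q := q) x₀ x) = x := by
  simpa [coordMap, coordInv] using (extChartAt (𝓡 q) x₀).left_inv hx

theorem coordMap_coordInv {x₀ : S} {u : Fin q → ℝ} (hu : u ∈ coordTarget x₀) :
    coordMap x₀ (coordInv x₀ u) = u := by
  rw [coordMap, coordInv, (extChartAt (𝓡 q) x₀).right_inv hu, ContinuousLinearEquiv.apply_symm_apply]

variable [IsManifold (𝓡 q) ∞ S]

theorem contMDiffAt_coordInv {x₀ : S} {u : Fin q → ℝ} (hu : u ∈ coordTarget x₀) :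
    ContMDiffAt 𝓘(ℝ, Fin q → ℝ) (𝓡 q) ∞ (coordInv x₀) u :=
  ((contMDiffOn_extChartAt_symm x₀).contMDiffAt ((isOpen_extChartAt_target x₀).mem_nhds hu)).comp u
    ((EuclideanSpace.equiv (Fin q) ℝ).symm.contDiff.contMDiff.contMDiffAt)

theorem contMDiffAt_coordMap {x₀ x : S} (hx : x ∈ (extChartAt (𝓡 q) x₀).source) :
    ContMDiffAt (𝓡 q) 𝓘(ℝ, Fin q → ℝ) ∞ (coordMap (q := q) x₀) x :=
  ((EuclideanSpace.equiv (Fin q) ℝ).contDiff.contMDiff.contMDiffAt).comp x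
    (contMDiffAt_extChartAt' (by rwa [extChartAt_source] at hx))

theorem contDiffAt_coordMap_comp {x₀ : S} {G : E → S} {y : E}
    (hG : ContMDiffAt 𝓘(ℝ, E) (𝓡 q) ∞ G y) (hy : G y ∈ (extChartAt (𝓡 q) x₀).source) :
    ContDiffAt ℝ ∞ (fun y => coordMap (q := q) x₀ (G y)) y :=
  (ContMDiffAt.comp (g := coordMap (q := q) x₀) y (contMDiffAt_coordMap hy) hG).contDiffAt

theorem continuousOn_coordInv (x₀ : S) : ContinuousOn (coordInv (q := q) x₀) (coordTarget x₀) :=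
  fun _ hu => (contMDiffAt_coordInv hu).continuousAt.continuousWithinAt

theorem mfderiv_coordInv_stdFrame {x₀ : S} {u : Fin q → ℝ} (hu : u ∈ coordTarget x₀) (i : Fin q) :
    mfderiv 𝓘(ℝ, Fin q → ℝ) (𝓡 q) (coordInv x₀) u (stdFrame q i) =
      chartFrame x₀ ((EuclideanSpace.equiv (Fin q) ℝ).symm u) i := by
  have h := mfderiv_comp_of_normedSpace (G := (extChartAt (𝓡 q) x₀).symm)
    (f := (EuclideanSpace.equiv (Fin q) ℝ).symm) (y := u)
    (((contMDiffOn_extChartAt_symm x₀).contMDiffAt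
      ((isOpen_extChartAt_target x₀).mem_nhds hu)).mdifferentiableAt (n := ∞) (by simp))
    (EuclideanSpace.equiv (Fin q) ℝ).symm.differentiableAt (stdFrame q i)
  rw [ContinuousLinearEquiv.fderiv] at h
  exact h

theorem frameSignAlong_coordInv (o : ManifoldOrientation q S) {x₀ : S} {u : Fin q → ℝ}
    (hu : u ∈ coordTarget x₀) : frameSignAlong o (coordInv x₀) (stdFrame q) u =
      (o.orient (coordInv x₀ u)).frameSign
        (chartFrame x₀ ((EuclideanSpace.equiv (Fin q) ℝ).symm u)) := by
  rw [frameSignAlong, funext (mfderiv_coordInv_stdFrame hu)]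

/-- The integral of a top-degree form, with all charts taking values in `ℝ^q`. -/
theorem integrateTop_eq [CompactSpace S] [T2Space S] (o : ManifoldOrientation q S)
    (η : ∀ x : S, (Fin q → TangentSpace (𝓡 q) x) → ℝ) :
    integrateTop o η = ∑ᶠ x₀ : S, ∫ u in coordTarget x₀,
      chartPartition (q := q) S x₀ (coordInv x₀ u) *
        (frameSignAlong o (coordInv x₀) (stdFrame q) u * η (coordInv x₀ u) (fun i =>
          mfderiv 𝓘(ℝ, Fin q → ℝ) (𝓡 q) (coordInv x₀) u (stdFrame q i))) := by
  refine finsum_congr fun x₀ => ?_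
  rw [← (PiLp.volume_preserving_toLp (Fin q)).setIntegral_preimage_emb
    (MeasurableEquiv.toLp 2 (Fin q → ℝ)).measurableEmbedding]
  refine setIntegral_congr_fun (isOpen_coordTarget x₀).measurableSet fun u hu => ?_
  rw [frameSignAlong_coordInv o hu, funext (mfderiv_coordInv_stdFrame hu)]
  rfl

/-- A transition map between two charts, near a point of the first. -/
theorem coordInv_eventuallyEq {x₀ z : S} {u : Fin q → ℝ} (hu : u ∈ coordTarget x₀)
    (hz : coordInv x₀ u ∈ (extChartAt (𝓡 q) z).source) :
    coordInv x₀ =ᶠ[𝓝 u] coordInv z ∘ fun u => coordMap (q := q) z (coordInv x₀ u) := by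
  filter_upwards [(contMDiffAt_coordInv hu).continuousAt
    ((isOpen_extChartAt_source z).mem_nhds hz)] with w hw
  exact (coordInv_coordMap hw).symm

/-- The sign of the coordinate frame is locally constant on the whole coordinate domain. -/
theorem eventually_frameSignAlong_coordInv_eq (o : ManifoldOrientation q S) {x₀ : S} {u : Fin q → ℝ}
    (hu : u ∈ coordTarget x₀) : ∀ᶠ w in 𝓝 u, frameSignAlong o (coordInv x₀) (stdFrame q) w =
      frameSignAlong o (coordInv x₀) (stdFrame q) u := by
  set z := coordInv x₀ u with hz
  set f : (Fin q → ℝ) → Fin q → ℝ := fun u => coordMap z (coordInv x₀ u) with hf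
  have hzs : z ∈ (extChartAt (𝓡 q) z).source := mem_extChartAt_source z
  have hfd : ContDiffAt ℝ ∞ f u :=
    contDiffAt_coordMap_comp (contMDiffAt_coordInv hu) hzs
  have hft : f u ∈ coordTarget z := coordMap_mem_target hzs
  -- The sign in the chart centred at `z` is constant near `z`.
  have hloc : ∀ᶠ w in 𝓝 u, frameSignAlong o (coordInv z) (stdFrame q) (f w) =
      frameSignAlong o (coordInv z) (stdFrame q) (f u) := by
    have h1 := o.locally_const z
    have h2 : Filter.Tendsto (fun w => (EuclideanSpace.equiv (Fin q) ℝ).symm (f w)) (𝓝 u)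
        (𝓝 (extChartAt (𝓡 q) z z)) := by
      have : extChartAt (𝓡 q) z z = (EuclideanSpace.equiv (Fin q) ℝ).symm (f u) := by
        simp [hf, coordMap, ← hz]
      rw [this]
      exact ((EuclideanSpace.equiv (Fin q) ℝ).symm.continuous.tendsto _).comp hfd.continuousAt
    have h3 := h2.eventually h1
    have h4 : ∀ᶠ w in 𝓝 u, f w ∈ coordTarget z :=
      hfd.continuousAt ((isOpen_coordTarget z).mem_nhds hft)
    filter_upwards [h3, h4] with w hw hw4
    have h5 := h3.self_of_nhds
    rw [frameSignAlong_coordInv o hw4, frameSignAlong_coordInv o hft]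
    exact hw.trans h5.symm
  have hdiff : ∀ᶠ w in 𝓝 u, frameSignAlong o (coordInv x₀) (stdFrame q) w =
      (SignType.sign (fderiv ℝ f w).det : ℝ) *
        frameSignAlong o (coordInv z) (stdFrame q) (f w) := by
    have h1 : ∀ᶠ w in 𝓝 u, w ∈ coordTarget x₀ := (isOpen_coordTarget x₀).mem_nhds hu
    have h2 : ∀ᶠ w in 𝓝 u, coordInv x₀ w ∈ (extChartAt (𝓡 q) z).source :=
      (contMDiffAt_coordInv hu).continuousAt ((isOpen_extChartAt_source z).mem_nhds hzs)
    filter_upwards [h1, h2] with w hw1 hw2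
    rw [frameSignAlong_congr o _ (coordInv_eventuallyEq hw1 hw2), ← det_toMatrix'_fderiv]
    refine frameSignAlong_comp (f := f) o ((contMDiffAt_coordInv
      (coordMap_mem_target hw2)).mdifferentiableAt (by simp)) ?_ (fderiv_stdFrame f w)
    exact (contDiffAt_coordMap_comp (contMDiffAt_coordInv hw1) hw2).differentiableAt (by simp)
  -- The transition map has an inverse, so its Jacobian determinant does not vanish at `u`.
  have hdet : (fderiv ℝ f u).det ≠ 0 := by
    set g : (Fin q → ℝ) → Fin q → ℝ := fun u => coordMap x₀ (coordInv z u) with hg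
    have hcz : coordInv z (f u) = z := coordInv_coordMap hzs
    have hgd : DifferentiableAt ℝ g (f u) := by
      refine (contDiffAt_coordMap_comp (contMDiffAt_coordInv hft) ?_).differentiableAt (by simp)
      rw [hcz]
      exact coordInv_mem_source hu
    have hgf : g ∘ f =ᶠ[𝓝 u] id := by
      filter_upwards [coordInv_eventuallyEq (z := z) hu hzs, (isOpen_coordTarget x₀).mem_nhds hu]
        with w hw hw2
      change coordMap x₀ ((coordInv z ∘ f) w) = w
      rw [← hw, coordMap_coordInv hw2]
    have h1 := hgf.fderiv_eq (𝕜 := ℝ)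
    rw [fderiv_comp u hgd (hfd.differentiableAt (by simp)), fderiv_id] at h1
    have h2 := congrArg ContinuousLinearMap.det h1
    intro h0
    have h3 : ((fderiv ℝ g (f u)).comp (fderiv ℝ f u)).det =
      (fderiv ℝ g (f u)).det * (fderiv ℝ f u).det := LinearMap.det_comp _ _
    rw [h3, h0, mul_zero] at h2
    have h4 : (ContinuousLinearMap.id ℝ (Fin q → ℝ)).det = 1 := LinearMap.det_id
    rw [h4] at h2
    exact zero_ne_one h2
  have hsign : ∀ᶠ w in 𝓝 u, (SignType.sign (fderiv ℝ f w).det : ℝ) =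
      (SignType.sign (fderiv ℝ f u).det : ℝ) := by
    have hc : ContinuousAt (fun w => (fderiv ℝ f w).det) u :=
      ContinuousLinearMap.continuous_det.continuousAt.comp
        (hfd.fderiv_right (m := ∞) (by simp)).continuousAt
    rcases lt_or_gt_of_ne hdet with h | h
    · filter_upwards [hc.eventually (gt_mem_nhds h)] with w hw
      rw [sign_neg hw, sign_neg h]
    · filter_upwards [hc.eventually (lt_mem_nhds h)] with w hw
      rw [sign_pos hw, sign_pos h]
  filter_upwards [hloc, hdiff, hsign] with w h1 h2 h3
  rw [h2, h3, h1, hdiff.self_of_nhds]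

theorem injective_mfderiv_coordInv {x₀ : S} {u : Fin q → ℝ} (hu : u ∈ coordTarget x₀) :
    Function.Injective (mfderiv 𝓘(ℝ, Fin q → ℝ) (𝓡 q) (coordInv x₀) u) := by
  have h1 : coordMap x₀ ∘ coordInv x₀ =ᶠ[𝓝 u] id := by
    filter_upwards [(isOpen_coordTarget x₀).mem_nhds hu] with w hw
    exact coordMap_coordInv hw
  have h2 := h1.mfderiv_eq (I := 𝓘(ℝ, Fin q → ℝ)) (I' := 𝓘(ℝ, Fin q → ℝ))
  rw [mfderiv_comp u ((contMDiffAt_coordMap (coordInv_mem_source hu)).mdifferentiableAt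
    (n := ∞) (by simp)) ((contMDiffAt_coordInv hu).mdifferentiableAt (by simp)), mfderiv_id] at h2
  intro v w hvw
  have h3 := fun v => congrArg (fun L => L v) h2
  exact (h3 v).symm.trans ((congrArg (mfderiv (𝓡 q) 𝓘(ℝ, Fin q → ℝ) (coordMap x₀)
    (coordInv x₀ u)) hvw).trans (h3 w))

theorem frameSignAlong_coordInv_mul_self (o : ManifoldOrientation q S) {x₀ : S} {u : Fin q → ℝ}
    (hu : u ∈ coordTarget x₀) : frameSignAlong o (coordInv x₀) (stdFrame q) u *
      frameSignAlong o (coordInv x₀) (stdFrame q) u = 1 := by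
  let L : (Fin q → ℝ) →ₗ[ℝ] EuclideanSpace ℝ (Fin q) :=
    (mfderiv 𝓘(ℝ, Fin q → ℝ) (𝓡 q) (coordInv x₀) u).toLinearMap
  let A : S → Orientation ℝ (EuclideanSpace ℝ (Fin q)) (Fin q) := o.orient
  let b := (Pi.basisFun ℝ (Fin q)).map
    (LinearEquiv.ofInjectiveOfFinrankEq L (injective_mfderiv_coordInv hu) (by simp))
  have hb : frameSignAlong o (coordInv x₀) (stdFrame q) u = (A (coordInv x₀ u)).frameSign b := by
    refine congrArg (A (coordInv x₀ u)).frameSign (funext fun i => ?_)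
    simp only [b, Basis.map_apply, Pi.basisFun_apply]
    rfl
  rw [hb]
  exact Orientation.frameSign_mul_self_basis _ b

end Coordinates

/-! ### Integration over a triangulated manifold -/

section PartitionOfUnity

variable {q : ℕ} {S : Type*} [TopologicalSpace S] [ChartedSpace (EuclideanSpace ℝ (Fin q)) S]
  [CompactSpace S] [T2Space S] [IsManifold (𝓡 q) ∞ S]

theorem tsupport_chartPartition_subset (x₀ : S) :
    tsupport (chartPartition (q := q) S x₀) ⊆ (extChartAt (𝓡 q) x₀).source := by
  rw [extChartAt_source]
  exact Classical.choose_spec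
    (SmoothPartitionOfUnity.exists_isSubordinate_chartAt_source (𝓡 q) S) x₀

theorem chartPartition_eq_zero {x₀ x : S} (hx : x ∉ (extChartAt (𝓡 q) x₀).source) :
    chartPartition (q := q) S x₀ x = 0 := by
  by_contra h
  exact hx (tsupport_chartPartition_subset x₀ (subset_closure h))

theorem continuous_chartPartition (x₀ : S) : Continuous (chartPartition (q := q) S x₀) :=
  (chartPartition (q := q) S x₀).contMDiff.continuous

/-- Only finitely many members of the partition of unity are nonzero. -/
theorem exists_finset_chartPartition (q : ℕ) (S : Type*) [TopologicalSpace S]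
    [ChartedSpace (EuclideanSpace ℝ (Fin q)) S] [CompactSpace S] [T2Space S]
    [IsManifold (𝓡 q) ∞ S] : ∃ A : Finset S,
      (∀ x₀ ∉ A, ∀ x, chartPartition (q := q) S x₀ x = 0) ∧
      ∀ x, ∑ x₀ ∈ A, chartPartition (q := q) S x₀ x = 1 := by
  have hfin := (chartPartition (q := q) S).locallyFinite.finite_nonempty_of_compact
  have hA : ∀ x₀ ∉ hfin.toFinset, ∀ x, chartPartition (q := q) S x₀ x = 0 := by
    intro x₀ hx₀ x
    by_contra h
    exact hx₀ (hfin.mem_toFinset.2 ⟨x, h⟩)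
  refine ⟨hfin.toFinset, hA, fun x => ?_⟩
  rw [← (chartPartition (q := q) S).sum_eq_one (mem_univ x), eq_comm]
  refine finsum_eq_sum_of_support_subset _ fun x₀ hx₀ => ?_
  by_contra h
  exact hx₀ (hA x₀ h x)

/-- A localized integrand is integrable: it is continuous and vanishes off a compact subset of the
coordinate domain. -/
theorem integrableOn_chartPartition_mul {x₀ : S} {w : (Fin q → ℝ) → ℝ}
    (hw : ContinuousOn w (coordTarget x₀)) :
    IntegrableOn (fun u => chartPartition (q := q) S x₀ (coordInv x₀ u) * w u)
      (coordTarget x₀) := by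
  have hsub := tsupport_chartPartition_subset (q := q) x₀
  set K : Set (Fin q → ℝ) := coordMap x₀ '' tsupport (chartPartition (q := q) S x₀) with hK
  have hKc : IsCompact K := (isClosed_tsupport _).isCompact.image_of_continuousOn fun x hx =>
    (contMDiffAt_coordMap (hsub hx)).continuousAt.continuousWithinAt
  have hKt : K ⊆ coordTarget x₀ := by
    rintro _ ⟨x, hx, rfl⟩
    exact coordMap_mem_target (hsub hx)
  refine IntegrableOn.of_forall_sdiff_eq_zero (s := K) ?_ (isOpen_coordTarget x₀).measurableSet ?_
  · refine ContinuousOn.integrableOn_compact hKc (ContinuousOn.mono ?_ hKt)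
    exact ((continuous_chartPartition x₀).comp_continuousOn (continuousOn_coordInv x₀)).mul hw
  · rintro u ⟨hu, huK⟩
    have : chartPartition (q := q) S x₀ (coordInv x₀ u) = 0 := by
      by_contra h
      exact huK ⟨_, subset_closure h, coordMap_coordInv hu⟩
    rw [this, zero_mul]

end PartitionOfUnity

section OnCube

variable {n : ℕ} {M : Type*} [TopologicalSpace M] [ChartedSpace (EuclideanSpace ℝ (Fin n)) M]
  {q : ℕ} {S : Type*} [TopologicalSpace S] [ChartedSpace (EuclideanSpace ℝ (Fin q)) S]

theorem SmoothSimplex.push_onCube (σ : SmoothSimplex q S q) {f : S → M}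
    (hf : ContMDiff (𝓡 q) (𝓡 n) ∞ f) : (σ.push f hf).onCube = f ∘ σ.onCube := by
  funext s
  simp only [SmoothSimplex.onCube, SmoothSimplex.push, Function.comp_apply]
  split_ifs <;> rfl

theorem SmoothSimplex.onCube_eq_of_extension (σ : SmoothSimplex n M q) {F : (Fin (q + 1) → ℝ) → M}
    (hF : ∀ t : stdSimplex ℝ (Fin (q + 1)), F t = σ.toFun t) {s : Fin q → ℝ}
    (hs : s ∈ Icc (0 : Fin q → ℝ) 1) : σ.onCube s = (F ∘ cubeToSimplex q) s := by
  rw [σ.onCube_of_mem hs, ← hF]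
  rfl

theorem SmoothSimplex.onCube_eventuallyEq (σ : SmoothSimplex n M q) {F : (Fin (q + 1) → ℝ) → M}
    (hF : ∀ t : stdSimplex ℝ (Fin (q + 1)), F t = σ.toFun t) {s : Fin q → ℝ}
    (hs : s ∈ openCube q) : σ.onCube =ᶠ[𝓝 s] F ∘ cubeToSimplex q := by
  filter_upwards [(isOpen_openCube q).mem_nhds hs] with t ht
  exact σ.onCube_eq_of_extension hF (openCube_subset_Icc q ht)

/-- A smooth extension of `σ.onCube` from the closed cube. -/
theorem SmoothSimplex.exists_onCube_extension (σ : SmoothSimplex n M q) :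
    ∃ G : (Fin q → ℝ) → M, EqOn σ.onCube G (Icc 0 1) ∧
      ∀ s ∈ Icc (0 : Fin q → ℝ) 1, ContMDiffAt 𝓘(ℝ, Fin q → ℝ) (𝓡 n) ∞ G s := by
  obtain ⟨U, F, hU, hsub, hF, hFσ⟩ := σ.exists_extension
  exact ⟨F ∘ cubeToSimplex q, fun s hs => σ.onCube_eq_of_extension hFσ hs,
    fun s hs => contMDiffAt_comp_cubeToSimplex hU hsub hF hs⟩

theorem SmoothSimplex.contMDiffAt_onCube (σ : SmoothSimplex n M q) {s : Fin q → ℝ}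
    (hs : s ∈ openCube q) : ContMDiffAt 𝓘(ℝ, Fin q → ℝ) (𝓡 n) ∞ σ.onCube s := by
  obtain ⟨G, hG, hGs⟩ := σ.exists_onCube_extension
  refine (hGs s (openCube_subset_Icc q hs)).congr_of_eventuallyEq ?_
  filter_upwards [(isOpen_openCube q).mem_nhds hs] with t ht
  exact hG (openCube_subset_Icc q ht)

theorem SmoothSimplex.continuousOn_onCube (σ : SmoothSimplex n M q) :
    ContinuousOn σ.onCube (Icc 0 1) := by
  obtain ⟨G, hG, hGs⟩ := σ.exists_onCube_extension
  exact ContinuousOn.congr (fun s hs => (hGs s hs).continuousAt.continuousWithinAt) hG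

namespace IsFundamentalCycle

variable {o : ManifoldOrientation q S} {c : SmoothChain q S q}

theorem frameSignAlong_onCube (hc : IsFundamentalCycle o c) {σ : SmoothSimplex q S q}
    (hσ : σ ∈ c.support) {s : Fin q → ℝ} (hs : s ∈ openCube q) :
    frameSignAlong o σ.onCube (stdFrame q) s = c σ := by
  obtain ⟨U, F, hU, hsub, hF, hFσ, hsign⟩ := hc.sign σ hσ
  have hmem := cubeToSimplex_mem_stdSimplex (openCube_subset_Icc q hs)
  rw [frameSignAlong_congr o _ (σ.onCube_eventuallyEq hFσ hs),
    frameSignAlong_comp o ((hF.contMDiffAt (hU.mem_nhds (hsub hmem))).mdifferentiableAt (by simp))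
      ((contDiff_cubeToSimplex q).differentiable (by simp) s)
      (v := stdFrame q) (w := fun i => Pi.single i.succ 1 - Pi.single 0 1) (D := cubeJacobian q s)
      (fun j => fderiv_cubeToSimplex_single q s j),
    sign_pos (det_cubeJacobian_pos hs), SignType.coe_one, one_mul]
  exact hsign _ hmem

theorem eq_of_onCube_eq (hc : IsFundamentalCycle o c) {σ τ : SmoothSimplex q S q}
    (hσ : σ ∈ c.support) (hτ : τ ∈ c.support) {s t : Fin q → ℝ} (hs : s ∈ openCube q)
    (ht : t ∈ openCube q) (h : σ.onCube s = τ.onCube t) : σ = τ := by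
  rw [σ.onCube_of_mem (openCube_subset_Icc q hs), τ.onCube_of_mem (openCube_subset_Icc q ht)] at h
  exact hc.disjoint_interiors σ hσ τ hτ _ _ (cubeToSimplex_pos hs) (cubeToSimplex_pos ht) h

theorem injOn_onCube (hc : IsFundamentalCycle o c) {σ : SmoothSimplex q S q}
    (hσ : σ ∈ c.support) : InjOn σ.onCube (openCube q) := by
  intro s hs t ht h
  rw [σ.onCube_of_mem (openCube_subset_Icc q hs), σ.onCube_of_mem (openCube_subset_Icc q ht)] at h
  exact injOn_cubeToSimplex q hs ht (congrArg Subtype.val (hc.injective σ hσ h))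

theorem exists_onCube_eq (hc : IsFundamentalCycle o c) (x : S) :
    ∃ σ ∈ c.support, ∃ s ∈ Icc (0 : Fin q → ℝ) 1, σ.onCube s = x := by
  obtain ⟨σ, hσ, t, rfl⟩ := hc.cover x
  obtain ⟨s, hs, hst⟩ := exists_cubeToSimplex_eq t.2
  refine ⟨σ, hσ, s, hs, ?_⟩
  rw [σ.onCube_of_mem hs]
  exact congrArg σ.toFun (Subtype.ext hst)

end IsFundamentalCycle

variable [IsManifold (𝓡 q) ∞ S]

/-- The boundary of a smooth simplex is a null set in each chart. -/
theorem SmoothSimplex.volume_image_boundary_eq_zero (σ : SmoothSimplex q S q) (x₀ : S) :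
    volume ((fun s => coordMap (q := q) x₀ (σ.onCube s)) ''
      ((Icc 0 1 \ openCube q) ∩ σ.onCube ⁻¹' (extChartAt (𝓡 q) x₀).source)) = 0 := by
  obtain ⟨G, hG, hGs⟩ := σ.exists_onCube_extension
  set N := (Icc 0 1 \ openCube q) ∩ σ.onCube ⁻¹' (extChartAt (𝓡 q) x₀).source with hN
  rw [image_congr (g := fun s => coordMap (q := q) x₀ (G s)) fun s hs => by rw [hG hs.1.1]]
  refine addHaar_image_eq_zero_of_differentiableOn_of_addHaar_eq_zero volume ?_ ?_
  · intro s hs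
    refine ((contDiffAt_coordMap_comp (hGs s hs.1.1) ?_).differentiableAt
      (by simp)).differentiableWithinAt
    rw [← hG hs.1.1]
    exact hs.2
  · refine measure_mono_null inter_subset_left ?_
    exact ae_le_set.1 (openCube_ae_eq_Icc q).symm.le

end OnCube

section FundamentalCycle

variable {n : ℕ} {M : Type*} [TopologicalSpace M] [ChartedSpace (EuclideanSpace ℝ (Fin n)) M]
  {q : ℕ} {S : Type*} [TopologicalSpace S] [ChartedSpace (EuclideanSpace ℝ (Fin q)) S]
  {o : ManifoldOrientation q S} {c : SmoothChain q S q}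
  {α : ∀ x : M, TangentSpace (𝓡 n) x [⋀^Fin q]→L[ℝ] ℝ} {ι : S → M}

theorem IsSmoothForm.continuousAt_pullbackForm_apply [IsManifold (𝓡 n) ∞ M]
    (hα : IsSmoothForm α) {E : Type*} [NormedAddCommGroup E] [NormedSpace ℝ E] {G : E → M} {y : E}
    (hG : ContMDiffAt 𝓘(ℝ, E) (𝓡 n) ∞ G y) (v : Fin q → E) :
    ContinuousAt (fun y => pullbackForm α G y v) y :=
  (ContinuousAlternatingMap.apply ℝ E ℝ v).continuous.continuousAt.comp
    (hα.differentiableAt_pullbackForm hG).continuousAt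

theorem SmoothSimplex.integrableOn_mul_pullbackForm [IsManifold (𝓡 n) ∞ M]
    (hα : IsSmoothForm α) (hι : ContMDiff (𝓡 q) (𝓡 n) ∞ ι) (σ : SmoothSimplex q S q) {r : S → ℝ}
    (hr : Continuous r) (a : ℝ) : IntegrableOn (fun s => r (σ.onCube s) *
      (a * pullbackForm α (ι ∘ σ.onCube) s (stdFrame q))) (openCube q) := by
  obtain ⟨G, hG, hGs⟩ := σ.exists_onCube_extension
  have h : IntegrableOn (fun s => r (G s) * (a * pullbackForm α (ι ∘ G) s (stdFrame q)))
      (Icc 0 1) := by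
    refine ContinuousOn.integrableOn_compact isCompact_Icc fun s hs => ?_
    have h1 := hGs s hs
    exact ((hr.continuousAt.comp h1.continuousAt).mul (continuousAt_const.mul
      (hα.continuousAt_pullbackForm_apply (hι.contMDiffAt.comp s h1) _))).continuousWithinAt
  refine (h.mono_set (openCube_subset_Icc q)).congr_fun (fun s hs => ?_)
    (isOpen_openCube q).measurableSet
  have hev : G =ᶠ[𝓝 s] σ.onCube := by
    filter_upwards [(isOpen_openCube q).mem_nhds hs] with t ht
    exact (hG (openCube_subset_Icc q ht)).symm
  simp only
  rw [pullbackForm_congr α (hev.fun_comp ι), hev.eq_of_nhds]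

variable [IsManifold (𝓡 q) ∞ S]

/-- The contribution of one simplex to the integral in one chart. -/
theorem IsFundamentalCycle.setIntegral_image_eq (hc : IsFundamentalCycle o c)
    (hι : ContMDiff (𝓡 q) (𝓡 n) ∞ ι) {σ : SmoothSimplex q S q} (hσ : σ ∈ c.support) (x₀ : S)
    (r : S → ℝ) (hr : ∀ x ∉ (extChartAt (𝓡 q) x₀).source, r x = 0) :
    ∫ u in (fun s => coordMap (q := q) x₀ (σ.onCube s)) ''
        (openCube q ∩ σ.onCube ⁻¹' (extChartAt (𝓡 q) x₀).source),
      r (coordInv x₀ u) * (frameSignAlong o (coordInv x₀) (stdFrame q) u *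
        pullbackForm α (ι ∘ coordInv x₀) u (stdFrame q)) =
      ∫ s in openCube q, r (σ.onCube s) *
        (c σ * pullbackForm α (ι ∘ σ.onCube) s (stdFrame q)) := by
  set C := openCube q ∩ σ.onCube ⁻¹' (extChartAt (𝓡 q) x₀).source with hC
  set Ψ : (Fin q → ℝ) → Fin q → ℝ := fun s => coordMap (q := q) x₀ (σ.onCube s) with hΨ
  have hCo : IsOpen C := (σ.continuousOn_onCube.mono (openCube_subset_Icc q)).isOpen_inter_preimage
    (isOpen_openCube q) (isOpen_extChartAt_source x₀)
  have hΨd : ∀ s ∈ C, DifferentiableAt ℝ Ψ s := fun s hs =>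
    (contDiffAt_coordMap_comp (σ.contMDiffAt_onCube hs.1) hs.2).differentiableAt (by simp)
  have hinj : InjOn Ψ C := by
    intro s hs t ht hst
    refine hc.injOn_onCube hσ hs.1 ht.1 ?_
    rw [← coordInv_coordMap hs.2, ← coordInv_coordMap ht.2]
    exact congrArg (coordInv x₀) hst
  rw [integral_image_eq_integral_abs_det_fderiv_smul volume hCo.measurableSet
    (fun s hs => (hΨd s hs).hasFDerivAt.hasFDerivWithinAt) hinj]
  refine Eq.trans ?_ (setIntegral_eq_of_subset_of_forall_sdiff_eq_zero
    (isOpen_openCube q).measurableSet (inter_subset_left : C ⊆ openCube q) (fun s hs => by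
      rw [hr (σ.onCube s) fun h => hs.2 ⟨hs.1, h⟩, zero_mul])).symm
  refine setIntegral_congr_fun hCo.measurableSet fun s hs => ?_
  have hev : σ.onCube =ᶠ[𝓝 s] coordInv x₀ ∘ Ψ := by
    filter_upwards [hCo.mem_nhds hs] with t ht
    exact (coordInv_coordMap ht.2).symm
  have hT : Ψ s ∈ coordTarget x₀ := coordMap_mem_target hs.2
  have hsgn := frameSignAlong_comp o ((contMDiffAt_coordInv hT).mdifferentiableAt (by simp))
    (hΨd s hs) (fderiv_stdFrame Ψ s)
  rw [← frameSignAlong_congr o _ hev, hc.frameSignAlong_onCube hσ hs.1, det_toMatrix'_fderiv] at hsgn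
  have hpb := pullbackForm_comp_apply α (G := ι ∘ coordInv x₀) (f := Ψ) (y := s)
    ((hι.contMDiffAt.comp _ (contMDiffAt_coordInv hT)).mdifferentiableAt (by simp))
    (hΨd s hs) (fderiv_stdFrame Ψ s)
  rw [det_toMatrix'_fderiv, pullbackForm_congr α (G := (ι ∘ coordInv x₀) ∘ Ψ)
    (G' := ι ∘ σ.onCube) (hev.symm.fun_comp ι)] at hpb
  have hinv : coordInv x₀ (Ψ s) = σ.onCube s := coordInv_coordMap hs.2
  simp only [smul_eq_mul]
  rw [hinv, hpb, hsgn, ← sign_mul_self]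
  ring

/-- An integral over a coordinate domain is the sum of the contributions of the simplices: their
interiors are disjoint, and what they leave out lies in the images of their boundaries, which are null sets. -/
theorem IsFundamentalCycle.setIntegral_coordTarget_eq (hc : IsFundamentalCycle o c)
    (hι : ContMDiff (𝓡 q) (𝓡 n) ∞ ι) (x₀ : S)
    (r : S → ℝ) (hr : ∀ x ∉ (extChartAt (𝓡 q) x₀).source, r x = 0)
    (hint : IntegrableOn (fun u => r (coordInv x₀ u) *
      (frameSignAlong o (coordInv x₀) (stdFrame q) u *
        pullbackForm α (ι ∘ coordInv x₀) u (stdFrame q))) (coordTarget x₀)) :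
    ∫ u in coordTarget x₀, r (coordInv x₀ u) *
      (frameSignAlong o (coordInv x₀) (stdFrame q) u *
        pullbackForm α (ι ∘ coordInv x₀) u (stdFrame q)) =
      ∑ σ ∈ c.support, ∫ s in openCube q, r (σ.onCube s) *
        (c σ * pullbackForm α (ι ∘ σ.onCube) s (stdFrame q)) := by
  set Ψ : SmoothSimplex q S q → (Fin q → ℝ) → Fin q → ℝ :=
    fun σ s => coordMap (q := q) x₀ (σ.onCube s) with hΨ
  set C : SmoothSimplex q S q → Set (Fin q → ℝ) :=
    fun σ => openCube q ∩ σ.onCube ⁻¹' (extChartAt (𝓡 q) x₀).source with hC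
  set N : SmoothSimplex q S q → Set (Fin q → ℝ) :=
    fun σ => (Icc 0 1 \ openCube q) ∩ σ.onCube ⁻¹' (extChartAt (𝓡 q) x₀).source with hN
  have hsubset : ∀ σ, Ψ σ '' C σ ⊆ coordTarget x₀ := by
    rintro σ _ ⟨s, hs, rfl⟩
    exact coordMap_mem_target hs.2
  have hdiff : coordTarget x₀ \ (⋃ σ ∈ c.support, Ψ σ '' C σ) ⊆
      ⋃ σ ∈ c.support, Ψ σ '' N σ := by
    rintro u ⟨hu, hun⟩
    obtain ⟨σ, hσ, s, hs, hsu⟩ := hc.exists_onCube_eq (coordInv x₀ u)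
    have hsrc : σ.onCube s ∈ (extChartAt (𝓡 q) x₀).source := hsu ▸ coordInv_mem_source hu
    have hΨs : Ψ σ s = u := (congrArg (coordMap x₀) hsu).trans (coordMap_coordInv hu)
    refine mem_biUnion hσ ⟨s, ⟨⟨hs, fun hso => hun ?_⟩, hsrc⟩, hΨs⟩
    exact mem_biUnion hσ ⟨s, ⟨hso, hsrc⟩, hΨs⟩
  have hnull : volume (coordTarget x₀ \ (⋃ σ ∈ c.support, Ψ σ '' C σ)) = 0 :=
    measure_mono_null hdiff ((measure_biUnion_null_iff c.support.countable_toSet).2 fun σ _ =>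
      σ.volume_image_boundary_eq_zero x₀)
  have hunion : (⋃ σ ∈ c.support, Ψ σ '' C σ : Set (Fin q → ℝ)) =ᵐ[volume] coordTarget x₀ :=
    Filter.EventuallyLE.antisymm (LE.le.eventuallyLE (iUnion₂_subset fun σ _ => hsubset σ))
      (ae_le_set.2 hnull)
  have hinj : ∀ σ ∈ c.support, InjOn (Ψ σ) (C σ) := by
    intro σ hσ s hs t ht hst
    refine hc.injOn_onCube hσ hs.1 ht.1 ?_
    rw [← coordInv_coordMap hs.2, ← coordInv_coordMap ht.2]
    exact congrArg (coordInv x₀) hst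
  have hmeas : ∀ σ ∈ c.support, MeasurableSet (Ψ σ '' C σ) := by
    intro σ hσ
    refine measurable_image_of_fderivWithin (f' := fderiv ℝ (Ψ σ)) ?_ (fun s hs => ?_) (hinj σ hσ)
    · exact ((σ.continuousOn_onCube.mono (openCube_subset_Icc q)).isOpen_inter_preimage
        (isOpen_openCube q) (isOpen_extChartAt_source x₀)).measurableSet
    · exact ((contDiffAt_coordMap_comp (σ.contMDiffAt_onCube hs.1) hs.2).differentiableAt
        (by simp)).hasFDerivAt.hasFDerivWithinAt
  rw [← setIntegral_congr_set hunion, integral_biUnion_finset _ hmeas ?_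
    (fun σ _ => hint.mono_set (hsubset σ))]
  · exact Finset.sum_congr rfl fun σ hσ => hc.setIntegral_image_eq hι hσ x₀ r hr
  · intro σ hσ τ hτ hne
    refine disjoint_left.2 ?_
    rintro _ ⟨s, hs, rfl⟩ ⟨t, ht, hts⟩
    refine hne (hc.eq_of_onCube_eq hσ hτ hs.1 ht.1 ?_)
    rw [← coordInv_coordMap hs.2, ← coordInv_coordMap ht.2]
    exact congrArg (coordInv x₀) hts.symm

variable [IsManifold (𝓡 n) ∞ M] [CompactSpace S] [T2Space S]

/-- The integral over `S` of the pull-back of a form is its integral over the image of a fundamental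
cycle: in each chart the simplices tile the coordinate domain up to a null set, so that the change of
variables formula applies, and the partition of unity sums to one on each simplex. -/
theorem IsFundamentalCycle.finsum_setIntegral_eq_chainIntegral (hc : IsFundamentalCycle o c)
    (hα : IsSmoothForm α) (hι : ContMDiff (𝓡 q) (𝓡 n) ∞ ι) :
    ∑ᶠ x₀ : S, ∫ u in coordTarget x₀, chartPartition (q := q) S x₀ (coordInv x₀ u) *
      (frameSignAlong o (coordInv x₀) (stdFrame q) u *
        pullbackForm α (ι ∘ coordInv x₀) u (stdFrame q)) = chainIntegral α (c.push ι hι) := by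
  obtain ⟨A, hA0, hA1⟩ := exists_finset_chartPartition q S
  rw [finsum_eq_sum_of_support_subset (s := A) _ fun x₀ hx₀ => by
    by_contra h
    refine hx₀ ?_
    simp only [hA0 x₀ h, zero_mul, integral_zero]]
  have h1 : ∀ x₀ : S, ∫ u in coordTarget x₀, chartPartition (q := q) S x₀ (coordInv x₀ u) *
      (frameSignAlong o (coordInv x₀) (stdFrame q) u *
        pullbackForm α (ι ∘ coordInv x₀) u (stdFrame q)) =
      ∑ σ ∈ c.support, ∫ s in openCube q, chartPartition (q := q) S x₀ (σ.onCube s) *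
        (c σ * pullbackForm α (ι ∘ σ.onCube) s (stdFrame q)) := by
    intro x₀
    refine hc.setIntegral_coordTarget_eq hι x₀ _ (fun x => chartPartition_eq_zero) ?_
    refine integrableOn_chartPartition_mul fun u hu => ContinuousAt.continuousWithinAt ?_
    refine ContinuousAt.mul ?_ (hα.continuousAt_pullbackForm_apply
      (hι.contMDiffAt.comp u (contMDiffAt_coordInv hu)) _)
    exact continuousAt_const.congr
      ((eventually_frameSignAlong_coordInv_eq o hu).mono fun _ h => h.symm)
  rw [Finset.sum_congr rfl fun x₀ _ => h1 x₀, Finset.sum_comm, SmoothChain.push, chainIntegral,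
    Finsupp.linearCombination_mapDomain, Finsupp.linearCombination_apply, Finsupp.sum]
  refine Finset.sum_congr rfl fun σ _ => ?_
  rw [← integral_finsetSum _ fun x₀ _ =>
    σ.integrableOn_mul_pullbackForm hα hι (continuous_chartPartition x₀) (c σ)]
  simp only [Function.comp_apply, simplexIntegral, σ.push_onCube hι]
  rw [smul_eq_mul, ← integral_const_mul]
  refine integral_congr_ae (Filter.Eventually.of_forall fun s => ?_)
  simp only [← Finset.sum_mul, hA1, one_mul]
  rfl

end FundamentalCycle

/-! ### Gram matrices of projections and their continuity -/

namespace OrientedPlane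

variable {W : Type*} [NormedAddCommGroup W] [InnerProductSpace ℝ W] {k : ℕ}

theorem det_gram_ne_zero {v : Fin k → W} (hv : LinearIndependent ℝ v) :
    (Matrix.of fun i j => (inner ℝ (v i) (v j) : ℝ)).det ≠ 0 :=
  (Matrix.posDef_gram_of_linearIndependent (𝕜 := ℝ) hv).det_pos.ne'

theorem linearIndependent_of_span_eq (H : OrientedPlane W k) {X : Fin k → W}
    (hX : Submodule.span ℝ (range X) = H.carrier) : LinearIndependent ℝ X := by
  rw [linearIndependent_iff_card_eq_finrank_span, Set.finrank, hX, H.finrank_eq, Fintype.card_fin]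

variable [FiniteDimensional ℝ W]

/-- The Gram matrix of orthogonal projections onto `H`, in terms of inner products with a basis `X` of
`H`. -/
theorem gram_projH (H : OrientedPlane W k) {X : Fin k → W}
    (hX : Submodule.span ℝ (range X) = H.carrier) (v : Fin k → W) :
    (Matrix.of fun i j => (inner ℝ (H.projH (v i)) (H.projH (v j)) : ℝ)) =
      (Matrix.of fun a i => (inner ℝ (X a) (v i) : ℝ)).transpose *
        (Matrix.of fun a b => (inner ℝ (X a) (X b) : ℝ))⁻¹ *
        (Matrix.of fun a i => (inner ℝ (X a) (v i) : ℝ)) := by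
  set A := Matrix.of fun a b => (inner ℝ (X a) (X b) : ℝ) with hA
  have hdet : IsUnit A.det := (det_gram_ne_zero (H.linearIndependent_of_span_eq hX)).isUnit
  have hC : ∀ i, ∃ c : Fin k → ℝ, ∑ a, c a • X a = H.projH (v i) := by
    intro i
    rw [← Submodule.mem_span_range_iff_exists_fun, hX]
    exact Submodule.starProjection_apply_mem _ _
  choose c hc using hC
  set C : Matrix (Fin k) (Fin k) ℝ := Matrix.of fun a i => c i a with hCdef
  have hB : (Matrix.of fun a i => (inner ℝ (X a) (v i) : ℝ)) = A * C := by
    ext a i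
    have hmem : X a ∈ H.carrier := hX ▸ Submodule.subset_span (mem_range_self a)
    have h1 : (inner ℝ (X a) (v i) : ℝ) = inner ℝ (X a) (H.projH (v i)) := by
      rw [← sub_eq_zero, ← inner_sub_right]
      exact (Submodule.sub_starProjection_mem_orthogonal (v i)) _ hmem
    rw [Matrix.of_apply, h1, ← hc i, inner_sum, Matrix.mul_apply]
    refine Finset.sum_congr rfl fun b _ => ?_
    simp [hA, hCdef, real_inner_smul_right, mul_comm]
  have hG : (Matrix.of fun i j => (inner ℝ (H.projH (v i)) (H.projH (v j)) : ℝ)) =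
      C.transpose * A * C := by
    ext i j
    simp only [Matrix.of_apply, Matrix.mul_apply, Matrix.transpose_apply, ← hc, sum_inner, inner_sum,
      real_inner_smul_left, real_inner_smul_right, Finset.sum_mul, hA, hCdef]
    refine Finset.sum_congr rfl fun a _ => Finset.sum_congr rfl fun b _ => ?_
    ring
  have hsymm : A.transpose = A := by
    ext a b
    simp [hA, real_inner_comm]
  rw [hB, hG, Matrix.transpose_mul, hsymm, Matrix.mul_nonsing_inv_cancel_right _ _ hdet,
    Matrix.mul_assoc]

theorem inner_projV (H : OrientedPlane W k) (v w : W) :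
    (inner ℝ (H.projV v) (H.projV w) : ℝ) =
      inner ℝ v w - inner ℝ (H.projH v) (H.projH w) := by
  have hv : H.projV v = v - H.projH v := Submodule.starProjection_orthogonal_val v
  have hw : H.projV w = w - H.projH w := Submodule.starProjection_orthogonal_val w
  have h1 : (inner ℝ (w - H.projH w) (H.projH v) : ℝ) = 0 :=
    Submodule.starProjection_inner_eq_zero _ _ (Submodule.starProjection_apply_mem _ _)
  have h2 : (inner ℝ (v - H.projH v) (H.projH w) : ℝ) = 0 :=
    Submodule.starProjection_inner_eq_zero _ _ (Submodule.starProjection_apply_mem _ _)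
  rw [hv, hw]
  rw [real_inner_comm] at h1
  simp only [inner_sub_left, inner_sub_right] at h1 h2 ⊢
  linarith

theorem PosProjectable.det_gram_projH_ne_zero {H P : OrientedPlane W k} (hP : H.PosProjectable P)
    (b : Basis (Fin k) ℝ P.carrier) :
    (Matrix.of fun i j => (inner ℝ (H.projH (b i)) (H.projH (b j)) : ℝ)).det ≠ 0 := by
  obtain ⟨e, he, -⟩ := hP
  simp only [← he]
  exact det_gram_ne_zero ((b.map e).linearIndependent.map' H.carrier.subtype
    (Submodule.ker_subtype _))

end OrientedPlane

section Continuity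

variable {n : ℕ} {M : Type*} [TopologicalSpace M] [ChartedSpace (EuclideanSpace ℝ (Fin n)) M]
  [IsManifold (𝓡 n) ∞ M] {E : Type*} [NormedAddCommGroup E] [NormedSpace ℝ E] {q : ℕ}

/-- The image of a constant vector under the differential of a smooth map is a smooth section. -/
theorem contMDiffAt_mfderiv_const {G : E → M} {T : Set E} (hT : IsOpen T)
    (hG : ContMDiffOn 𝓘(ℝ, E) (𝓡 n) ∞ G T) {u₀ : E} (hu : u₀ ∈ T) (v : E) :
    ContMDiffAt 𝓘(ℝ, E) (𝓡 n).tangent ∞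
      (fun u => (⟨G u, mfderiv 𝓘(ℝ, E) (𝓡 n) G u v⟩ : TangentBundle (𝓡 n) M)) u₀ := by
  have h1 := hG.contMDiffOn_tangentMapWithin (m := ∞) (by simp) hT.uniqueMDiffOn
  have h2 : ContMDiffAt 𝓘(ℝ, E) 𝓘(ℝ, E).tangent ∞
      (fun u => (⟨u, v⟩ : TangentBundle 𝓘(ℝ, E) E)) u₀ :=
    contMDiffAt_vectorSpace_iff_contDiffAt.2 contDiffAt_const
  have h3 := (h1.contMDiffAt (x := (⟨u₀, v⟩ : TangentBundle 𝓘(ℝ, E) E))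
    ((hT.preimage (FiberBundle.continuous_proj E _)).mem_nhds hu)).comp u₀ h2
  refine h3.congr_of_eventuallyEq ?_
  filter_upwards [hT.mem_nhds hu] with u hu
  simp only [Function.comp_apply, tangentMapWithin, mfderivWithin_of_isOpen hT hu]

variable [Bundle.RiemannianBundle (fun x : M => TangentSpace (𝓡 n) x)]
  [IsContMDiffRiemannianBundle (𝓡 n) ∞ (EuclideanSpace ℝ (Fin n))
    (fun x : M => TangentSpace (𝓡 n) x)]

theorem continuousAt_inner_of_contMDiffAt {G : E → M} {V W : ∀ u, TangentSpace (𝓡 n) (G u)} {u₀ : E}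
    (hV : ContMDiffAt 𝓘(ℝ, E) (𝓡 n).tangent ∞ (fun u => (⟨G u, V u⟩ : TangentBundle (𝓡 n) M)) u₀)
    (hW : ContMDiffAt 𝓘(ℝ, E) (𝓡 n).tangent ∞ (fun u => (⟨G u, W u⟩ : TangentBundle (𝓡 n) M)) u₀) :
    ContinuousAt (fun u => (inner ℝ (V u) (W u) : ℝ)) u₀ :=
  (ContMDiffAt.inner_bundle (F := EuclideanSpace ℝ (Fin n)) hV hW).continuousAt

theorem IsSmoothDistribution.continuousAt_gram_projH
    {H : ∀ x : M, OrientedPlane (TangentSpace (𝓡 n) x) q} (hH : IsSmoothDistribution H) {G : E → M}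
    {V : Fin q → ∀ u, TangentSpace (𝓡 n) (G u)} {u₀ : E} (hG : ContMDiffAt 𝓘(ℝ, E) (𝓡 n) ∞ G u₀)
    (hV : ∀ i, ContMDiffAt 𝓘(ℝ, E) (𝓡 n).tangent ∞
      (fun u => (⟨G u, V i u⟩ : TangentBundle (𝓡 n) M)) u₀) :
    ContinuousAt (fun u => Matrix.of fun i j =>
      (inner ℝ ((H (G u)).projH (V i u)) ((H (G u)).projH (V j u)) : ℝ)) u₀ := by
  obtain ⟨U, hU, X, hX, hspan⟩ := hH (G u₀)
  have hXs : ∀ a, ContMDiffAt 𝓘(ℝ, E) (𝓡 n).tangent ∞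
      (fun u => (⟨G u, X a (G u)⟩ : TangentBundle (𝓡 n) M)) u₀ := fun a =>
    ((hX a).contMDiffAt hU).comp u₀ hG
  have hev : (fun u => Matrix.of fun i j =>
      (inner ℝ ((H (G u)).projH (V i u)) ((H (G u)).projH (V j u)) : ℝ)) =ᶠ[𝓝 u₀] fun u =>
      (Matrix.of fun a i => (inner ℝ (X a (G u)) (V i u) : ℝ)).transpose *
        (Matrix.of fun a b => (inner ℝ (X a (G u)) (X b (G u)) : ℝ))⁻¹ *
        (Matrix.of fun a i => (inner ℝ (X a (G u)) (V i u) : ℝ)) := by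
    filter_upwards [hG.continuousAt hU] with u hu
    exact (H (G u)).gram_projH (hspan _ hu) fun i => V i u
  refine ContinuousAt.congr ?_ hev.symm
  have hB : ContinuousAt (fun u => Matrix.of fun a i => (inner ℝ (X a (G u)) (V i u) : ℝ)) u₀ :=
    continuousAt_pi.2 fun a => continuousAt_pi.2 fun i =>
      continuousAt_inner_of_contMDiffAt (hXs a) (hV i)
  have hA : ContinuousAt (fun u => Matrix.of fun a b => (inner ℝ (X a (G u)) (X b (G u)) : ℝ)) u₀ :=
    continuousAt_pi.2 fun a => continuousAt_pi.2 fun b =>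
      continuousAt_inner_of_contMDiffAt (hXs a) (hXs b)
  have hdet : (Matrix.of fun a b => (inner ℝ (X a (G u₀)) (X b (G u₀)) : ℝ)).det ≠ 0 :=
    OrientedPlane.det_gram_ne_zero
      ((H (G u₀)).linearIndependent_of_span_eq (hspan _ (mem_of_mem_nhds hU)))
  have hinv := ContinuousAt.comp (f := fun u => Matrix.of fun a b =>
    (inner ℝ (X a (G u)) (X b (G u)) : ℝ)) (continuousAt_matrix_inv _
      (by simpa using NormedRing.inverse_continuousAt (Units.mk0 _ hdet))) hA
  have hBt := (continuous_id.matrix_transpose).continuousAt.comp hB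
  exact (hBt.mul hinv).mul hB

end Continuity

/-! ### The functionals in coordinates and the calibration inequality -/

namespace SmoothImmersion

section Frame

variable {q n : ℕ} {S M : Type*} [TopologicalSpace S] [ChartedSpace (EuclideanSpace ℝ (Fin q)) S]
  [TopologicalSpace M] [ChartedSpace (EuclideanSpace ℝ (Fin n)) M]

/-- The image under `dι` of the coordinate frame of the chart centred at `x₀`, as a frame of the tangent
plane of the immersion. -/
def coordFrame (ι : SmoothImmersion q n S M) (o : ManifoldOrientation q S) (x₀ : S) (u : Fin q → ℝ)
    (i : Fin q) : (ι.plane o (coordInv x₀ u)).carrier :=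
  ι.tangentEquiv (coordInv x₀ u)
    (mfderiv 𝓘(ℝ, Fin q → ℝ) (𝓡 q) (coordInv x₀) u (stdFrame q i))

theorem frameSign_coordFrame (ι : SmoothImmersion q n S M) (o : ManifoldOrientation q S) (x₀ : S)
    (u : Fin q → ℝ) : (ι.plane o (coordInv x₀ u)).orientation.frameSign (ι.coordFrame o x₀ u) =
      frameSignAlong o (coordInv x₀) (stdFrame q) u :=
  Orientation.frameSign_map _ _ _

variable [IsManifold (𝓡 q) ∞ S]

theorem coe_coordFrame (ι : SmoothImmersion q n S M) (o : ManifoldOrientation q S) {x₀ : S}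
    {u : Fin q → ℝ} (hu : u ∈ coordTarget x₀) (i : Fin q) :
    (ι.coordFrame o x₀ u i : TangentSpace (𝓡 n) (ι.toFun (coordInv x₀ u))) =
      mfderiv 𝓘(ℝ, Fin q → ℝ) (𝓡 n) (ι.toFun ∘ coordInv x₀) u (stdFrame q i) := by
  rw [mfderiv_comp u (ι.contMDiff.mdifferentiableAt (by simp))
    ((contMDiffAt_coordInv hu).mdifferentiableAt (by simp))]
  rfl

theorem pullbackForm_coordInv
    {α : ∀ x : M, TangentSpace (𝓡 n) x [⋀^Fin q]→L[ℝ] ℝ} (ι : SmoothImmersion q n S M)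
    (o : ManifoldOrientation q S) {x₀ : S} {u : Fin q → ℝ} (hu : u ∈ coordTarget x₀) :
    pullbackForm α (ι.toFun ∘ coordInv x₀) u (stdFrame q) =
      α (ι.toFun (coordInv x₀ u)) (fun i => (ι.coordFrame o x₀ u i :
        TangentSpace (𝓡 n) (ι.toFun (coordInv x₀ u)))) := by
  rw [pullbackForm_apply]
  exact congrArg (α (ι.toFun (coordInv x₀ u))) (funext fun i => (ι.coe_coordFrame o hu i).symm)

theorem exists_basis_eq_coordFrame (ι : SmoothImmersion q n S M) (o : ManifoldOrientation q S)
    {x₀ : S} {u : Fin q → ℝ} (hu : u ∈ coordTarget x₀) :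
    ∃ b : Basis (Fin q) ℝ (ι.plane o (coordInv x₀ u)).carrier, ⇑b = ι.coordFrame o x₀ u := by
  let L : (Fin q → ℝ) →ₗ[ℝ] (ι.plane o (coordInv x₀ u)).carrier :=
    (ι.tangentEquiv (coordInv x₀ u)).toLinearMap ∘ₗ
      (mfderiv 𝓘(ℝ, Fin q → ℝ) (𝓡 q) (coordInv x₀) u).toLinearMap
  have hL : Function.Injective L :=
    (ι.tangentEquiv (coordInv x₀ u)).injective.comp (injective_mfderiv_coordInv hu)
  refine ⟨(Pi.basisFun ℝ (Fin q)).map (LinearEquiv.ofInjectiveOfFinrankEq L hL ?_), ?_⟩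
  · rw [(ι.plane o (coordInv x₀ u)).finrank_eq, Module.finrank_fin_fun]
  · funext i
    simp only [Basis.map_apply, Pi.basisFun_apply]
    rfl

end Frame

section Densities

variable {q n : ℕ} {S M : Type*} [TopologicalSpace S] [ChartedSpace (EuclideanSpace ℝ (Fin q)) S]
  [IsManifold (𝓡 q) ∞ S] [TopologicalSpace M] [ChartedSpace (EuclideanSpace ℝ (Fin n)) M]
  [Bundle.RiemannianBundle (fun x : M => TangentSpace (𝓡 n) x)]
  {H : ∀ x : M, OrientedPlane (TangentSpace (𝓡 n) x) q} {o : ManifoldOrientation q S}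

/-- The Gram matrix of the coordinate frame for `g^H`. -/
def gramH (ι : SmoothImmersion q n S M) (o : ManifoldOrientation q S)
    (H : ∀ x : M, OrientedPlane (TangentSpace (𝓡 n) x) q) (x₀ : S) (u : Fin q → ℝ) :
    Matrix (Fin q) (Fin q) ℝ :=
  Matrix.of fun i j => (H (ι.toFun (coordInv x₀ u))).innerH (ι.plane o (coordInv x₀ u))
    (ι.coordFrame o x₀ u i) (ι.coordFrame o x₀ u j)

/-- The Gram matrix of the vertical parts of the coordinate frame. -/
def gramV (ι : SmoothImmersion q n S M) (o : ManifoldOrientation q S)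
    (H : ∀ x : M, OrientedPlane (TangentSpace (𝓡 n) x) q) (x₀ : S) (u : Fin q → ℝ) :
    Matrix (Fin q) (Fin q) ℝ :=
  Matrix.of fun i j => inner ℝ
    ((H (ι.toFun (coordInv x₀ u))).projV (ι.coordFrame o x₀ u i))
    ((H (ι.toFun (coordInv x₀ u))).projV (ι.coordFrame o x₀ u j))

/-- The sign of the chart cancels the sign of the frame in the horizontal volume form. -/
theorem frameSignAlong_mul_volH (ι : SmoothImmersion q n S M) {x₀ : S} {u : Fin q → ℝ}
    (hu : u ∈ coordTarget x₀) : frameSignAlong o (coordInv x₀) (stdFrame q) u *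
      (H (ι.toFun (coordInv x₀ u))).volH (ι.plane o (coordInv x₀ u)) (ι.coordFrame o x₀ u) =
      √ (ι.gramH o H x₀ u).det := by
  rw [OrientedPlane.volH, Orientation.volOf, frameSign_coordFrame, ← mul_assoc,
    frameSignAlong_coordInv_mul_self o hu, one_mul]
  rfl

theorem ve_eq_trace (ι : SmoothImmersion q n S M) {x₀ : S} {u : Fin q → ℝ}
    (hu : u ∈ coordTarget x₀) :
    (H (ι.toFun (coordInv x₀ u))).ve (ι.plane o (coordInv x₀ u)) =
      (1 / 2) * ((ι.gramH o H x₀ u)⁻¹ * ι.gramV o H x₀ u).trace := by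
  obtain ⟨b, hb⟩ := ι.exists_basis_eq_coordFrame o hu
  rw [OrientedPlane.ve, OrientedPlane.veIn_basis_eq _ _ _ b, hb]
  rfl

variable [IsManifold (𝓡 n) ∞ M] [IsContMDiffRiemannianBundle (𝓡 n) ∞ (EuclideanSpace ℝ (Fin n))
    (fun x : M => TangentSpace (𝓡 n) x)]

theorem continuousOn_gramH (ι : SmoothImmersion q n S M) (o : ManifoldOrientation q S)
    (hH : IsSmoothDistribution H) (x₀ : S) :
    ContinuousOn (ι.gramH o H x₀) (coordTarget x₀) := by
  have hG : ContMDiffOn 𝓘(ℝ, Fin q → ℝ) (𝓡 n) ∞ (ι.toFun ∘ coordInv x₀) (coordTarget x₀) :=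
    fun u hu => (ι.contMDiff.contMDiffAt.comp u (contMDiffAt_coordInv hu)).contMDiffWithinAt
  refine ContinuousOn.congr (f := fun u => Matrix.of fun i j => (inner ℝ
    ((H ((ι.toFun ∘ coordInv x₀) u)).projH
      (mfderiv 𝓘(ℝ, Fin q → ℝ) (𝓡 n) (ι.toFun ∘ coordInv x₀) u (stdFrame q i)))
    ((H ((ι.toFun ∘ coordInv x₀) u)).projH
      (mfderiv 𝓘(ℝ, Fin q → ℝ) (𝓡 n) (ι.toFun ∘ coordInv x₀) u (stdFrame q j))) : ℝ))
    (fun u hu => ContinuousAt.continuousWithinAt ?_) fun u hu => ?_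
  · exact hH.continuousAt_gram_projH
      (hG.contMDiffAt ((isOpen_coordTarget x₀).mem_nhds hu))
      (fun i => contMDiffAt_mfderiv_const (isOpen_coordTarget x₀) hG hu (stdFrame q i))
  · ext i j
    simp only [gramH, OrientedPlane.innerH, Matrix.of_apply, ι.coe_coordFrame o hu]
    rfl

theorem continuousOn_gramV (ι : SmoothImmersion q n S M) (o : ManifoldOrientation q S)
    (hH : IsSmoothDistribution H) (x₀ : S) :
    ContinuousOn (ι.gramV o H x₀) (coordTarget x₀) := by
  have hG : ContMDiffOn 𝓘(ℝ, Fin q → ℝ) (𝓡 n) ∞ (ι.toFun ∘ coordInv x₀) (coordTarget x₀) :=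
    fun u hu => (ι.contMDiff.contMDiffAt.comp u (contMDiffAt_coordInv hu)).contMDiffWithinAt
  refine ContinuousOn.congr (f := fun u => (Matrix.of fun i j => (inner ℝ
    (mfderiv 𝓘(ℝ, Fin q → ℝ) (𝓡 n) (ι.toFun ∘ coordInv x₀) u (stdFrame q i))
    (mfderiv 𝓘(ℝ, Fin q → ℝ) (𝓡 n) (ι.toFun ∘ coordInv x₀) u (stdFrame q j)) : ℝ)) -
      ι.gramH o H x₀ u) (ContinuousOn.sub (fun u hu => ContinuousAt.continuousWithinAt ?_)
      (ι.continuousOn_gramH o hH x₀)) fun u hu => ?_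
  · refine continuousAt_pi.2 fun i => continuousAt_pi.2 fun j => ?_
    exact continuousAt_inner_of_contMDiffAt
      (contMDiffAt_mfderiv_const (isOpen_coordTarget x₀) hG hu (stdFrame q i))
      (contMDiffAt_mfderiv_const (isOpen_coordTarget x₀) hG hu (stdFrame q j))
  · ext i j
    simp only [gramV, gramH, OrientedPlane.innerH, OrientedPlane.inner_projV, Matrix.of_apply,
      Matrix.sub_apply, ι.coe_coordFrame o hu]

theorem continuousOn_sqrt_det_gramH (ι : SmoothImmersion q n S M) (o : ManifoldOrientation q S)
    (hH : IsSmoothDistribution H) (x₀ : S) :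
    ContinuousOn (fun u => √ (ι.gramH o H x₀ u).det) (coordTarget x₀) :=
  Real.continuous_sqrt.comp_continuousOn
    ((continuous_id.matrix_det).comp_continuousOn (ι.continuousOn_gramH o hH x₀))

theorem continuousOn_half_trace_mul (ι : SmoothImmersion q n S M) (hH : IsSmoothDistribution H)
    (hι : ι.PosProjectable o H) (x₀ : S) :
    ContinuousOn (fun u => (1 / 2) * ((ι.gramH o H x₀ u)⁻¹ * ι.gramV o H x₀ u).trace *
      √ (ι.gramH o H x₀ u).det) (coordTarget x₀) := by
  have hinv : ContinuousOn (fun u => (ι.gramH o H x₀ u)⁻¹) (coordTarget x₀) := ?_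
  · exact (continuousOn_const.mul ((continuous_id.matrix_trace).comp_continuousOn
      (hinv.mul (ι.continuousOn_gramV o hH x₀)))).mul (ι.continuousOn_sqrt_det_gramH o hH x₀)
  intro u hu
  have hdet : (ι.gramH o H x₀ u).det ≠ 0 := by
    obtain ⟨b, hb⟩ := ι.exists_basis_eq_coordFrame o hu
    have h := (hι (coordInv x₀ u)).det_gram_projH_ne_zero b
    rw [hb] at h
    exact h
  have hinv : ContinuousAt Ring.inverse (ι.gramH o H x₀ u).det := by
    simpa using NormedRing.inverse_continuousAt (Units.mk0 _ hdet)
  exact ContinuousAt.comp_continuousWithinAt (continuousAt_matrix_inv _ hinv)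
    (ι.continuousOn_gramH o hH x₀ u hu)

variable [CompactSpace S] [T2Space S]

/-- The value of `VE + Vol^H` as a sum of integrals over finitely many charts. -/
theorem VE_add_VolH_eq_sum (ι : SmoothImmersion q n S M) (hH : IsSmoothDistribution H)
    (hι : ι.PosProjectable o H) {A : Finset S}
    (hA : ∀ x₀ ∉ A, ∀ x, chartPartition (q := q) S x₀ x = 0) :
    ι.VE o H + ι.VolH o H = ∑ x₀ ∈ A, ∫ u in coordTarget x₀,
      chartPartition (q := q) S x₀ (coordInv x₀ u) *
        ((1 / 2) * ((ι.gramH o H x₀ u)⁻¹ * ι.gramV o H x₀ u).trace * √ (ι.gramH o H x₀ u).det +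
          √ (ι.gramH o H x₀ u).det) := by
  have hsum : ∀ η : ∀ x : S, (Fin q → TangentSpace (𝓡 q) x) → ℝ, integrateTop o η =
      ∑ x₀ ∈ A, ∫ u in coordTarget x₀, chartPartition (q := q) S x₀ (coordInv x₀ u) *
        (frameSignAlong o (coordInv x₀) (stdFrame q) u * η (coordInv x₀ u) (fun i =>
          mfderiv 𝓘(ℝ, Fin q → ℝ) (𝓡 q) (coordInv x₀) u (stdFrame q i))) := by
    intro η
    rw [integrateTop_eq]
    refine finsum_eq_sum_of_support_subset _ fun x₀ hx₀ => ?_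
    by_contra h
    refine hx₀ ?_
    simp only [hA x₀ h, zero_mul, integral_zero]
  rw [VE, VolH, hsum, hsum, ← Finset.sum_add_distrib]
  refine Finset.sum_congr rfl fun x₀ _ => ?_
  have hvol := ι.continuousOn_sqrt_det_gramH o hH x₀
  have hve := ι.continuousOn_half_trace_mul hH hι x₀
  have hadd := integral_add (integrableOn_chartPartition_mul hve)
    (integrableOn_chartPartition_mul hvol)
  simp only [← mul_add] at hadd
  refine Eq.trans ?_ hadd.symm
  congr 1
  · refine setIntegral_congr_fun (isOpen_coordTarget x₀).measurableSet fun u hu => ?_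
    change _ * (_ * (_ * OrientedPlane.volH _ _ (ι.coordFrame o x₀ u))) = _
    rw [← ι.frameSignAlong_mul_volH hu, ← ι.ve_eq_trace hu]
    ring
  · refine setIntegral_congr_fun (isOpen_coordTarget x₀).measurableSet fun u hu => ?_
    change _ * (_ * OrientedPlane.volH _ _ (ι.coordFrame o x₀ u)) = _
    rw [← ι.frameSignAlong_mul_volH hu]

variable {α : ∀ x : M, TangentSpace (𝓡 n) x [⋀^Fin q]→L[ℝ] ℝ}

/-- The integral of `α` over an immersion is at most `VE + Vol^H`. -/
theorem chainIntegral_push_le (ι : SmoothImmersion q n S M) (hα : IsSmoothForm α)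
    (hsc : IsSemiCalibration α) (hH : IsCalibratedDistribution α H) (hd : IsZeroPlusTwo α H)
    (hι : ι.PosProjectable o H) {c : SmoothChain q S q} (hc : IsFundamentalCycle o c) :
    chainIntegral α (c.push ι.toFun ι.contMDiff) ≤ ι.VE o H + ι.VolH o H := by
  obtain ⟨A, hA0, -⟩ := exists_finset_chartPartition q S
  rw [ι.VE_add_VolH_eq_sum hH.1 hι hA0, ← hc.finsum_setIntegral_eq_chainIntegral hα ι.contMDiff,
    finsum_eq_sum_of_support_subset (s := A) _ fun x₀ hx₀ => by
      by_contra h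
      refine hx₀ ?_
      simp only [hA0 x₀ h, zero_mul, integral_zero]]
  refine Finset.sum_le_sum fun x₀ _ => ?_
  have hvol := ι.continuousOn_sqrt_det_gramH o hH.1 x₀
  refine setIntegral_mono_on (integrableOn_chartPartition_mul fun u hu => ?_)
    (integrableOn_chartPartition_mul ((ι.continuousOn_half_trace_mul hH.1 hι x₀).add hvol))
    (isOpen_coordTarget x₀).measurableSet fun u hu => ?_
  · exact ((continuousAt_const.congr ((eventually_frameSignAlong_coordInv_eq o hu).mono
      fun _ h => h.symm)).mul (hα.continuousAt_pullbackForm_apply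
      (ι.contMDiff.contMDiffAt.comp u (contMDiffAt_coordInv hu)) _)).continuousWithinAt
  · refine mul_le_mul_of_nonneg_left ?_ ((chartPartition (q := q) S).nonneg _ _)
    have h := OrientedPlane.frameSign_mul_le (hsc _) (hH.2 _) (hd _) (hι (coordInv x₀ u))
      (ι.coordFrame o x₀ u)
    rw [frameSign_coordFrame, ← ι.pullbackForm_coordInv o hu] at h
    refine h.trans (le_of_eq ?_)
    rw [← ι.frameSignAlong_mul_volH hu, ← ι.ve_eq_trace hu]
    ring

/-- Equality holds for `f`-calibrated immersions. -/
theorem VE_add_VolH_eq_chainIntegral_push (ι : SmoothImmersion q n S M) (hα : IsSmoothForm α)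
    (hH : IsCalibratedDistribution α H) (hd : IsZeroPlusTwo α H)
    (hι : ι.IsFCalibrated o H α) {c : SmoothChain q S q} (hc : IsFundamentalCycle o c) :
    ι.VE o H + ι.VolH o H = chainIntegral α (c.push ι.toFun ι.contMDiff) := by
  obtain ⟨A, hA0, -⟩ := exists_finset_chartPartition q S
  rw [ι.VE_add_VolH_eq_sum hH.1 (fun x => (hι x).1) hA0,
    ← hc.finsum_setIntegral_eq_chainIntegral hα ι.contMDiff,
    finsum_eq_sum_of_support_subset (s := A) _ fun x₀ hx₀ => by
      by_contra h
      refine hx₀ ?_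
      simp only [hA0 x₀ h, zero_mul, integral_zero]]
  refine Finset.sum_congr rfl fun x₀ _ =>
    setIntegral_congr_fun (isOpen_coordTarget x₀).measurableSet fun u hu => ?_
  have h := OrientedPlane.apply_eq_of_restrictEq_weight (hH.2 _) (hd _) (hι (coordInv x₀ u)).1
    (hι (coordInv x₀ u)).2 (ι.coordFrame o x₀ u)
  rw [← ι.pullbackForm_coordInv o hu] at h
  rw [h, ← ι.frameSignAlong_mul_volH hu, ← ι.ve_eq_trace hu]
  ring

/-- The calibration argument: `∫ α` depends only on the homology class, bounds `VE + Vol^H` from below,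
and equals it for `f`-calibrated immersions. -/
theorem IsFCalibrated.minimizesVEAddVolH {ι : SmoothImmersion q n S M} (hα : IsSmoothForm α)
    (hsc : IsSemiCalibration α) (hH : IsCalibratedDistribution α H) (hd : IsZeroPlusTwo α H)
    (hcl : IsClosedForm α) (hι : ι.IsFCalibrated o H α) : ι.MinimizesVEAddVolH o H := by
  refine ⟨fun x => (hι x).1, fun ι' hι' => ?_⟩
  rintro ⟨c, hc, b, hb⟩
  have h := congrArg (chainIntegral α) hb
  rw [chainIntegral_boundary hα hcl, map_sub, sub_eq_zero] at h
  rw [ι.VE_add_VolH_eq_chainIntegral_push hα hH hd hι hc, h]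
  exact ι'.chainIntegral_push_le hα hsc hH hd hι' hc

end Densities

end SmoothImmersion

section GTwoStructures

variable {M : Type*} [TopologicalSpace M] [ChartedSpace (EuclideanSpace ℝ (Fin 7)) M]
  [Bundle.RiemannianBundle (fun x : M => TangentSpace (𝓡 7) x)]
  {φ : ∀ x : M, TangentSpace (𝓡 7) x [⋀^Fin 3]→L[ℝ] ℝ}
  {H : ∀ x : M, OrientedPlane (TangentSpace (𝓡 7) x) 3}

theorem IsGTwoStructure.isSemiCalibration (hφ : IsGTwoStructure φ) : IsSemiCalibration φ := by
  intro x P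
  obtain ⟨T, hT, hg⟩ := hφ x
  obtain ⟨X, hX⟩ := exists_vectorCrossProduct (φ x) T hT hg
  exact X.restrictLE hX P

/-- The decomposition `φ = φ₀ + φ₂` along an associative distribution. -/
theorem IsGTwoStructure.isZeroPlusTwo [IsManifold (𝓡 7) ∞ M] (hφ : IsGTwoStructure φ)
    (hH : IsCalibratedDistribution φ H) :
    IsZeroPlusTwo φ H := by
  intro x
  obtain ⟨T, hT, hg⟩ := hφ x
  obtain ⟨X, hX⟩ := exists_vectorCrossProduct (φ x) T hT hg
  exact VectorCrossProduct.eq_component_zero_add_component_two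
    (T.finrank_eq.trans (Module.finrank_fin_fun ℝ)) hX (hH.2 x)

end GTwoStructures

end

theorem mainTheorem4 :
    (∀ (q n : ℕ) (M : Type*) [TopologicalSpace M] [T2Space M] [SecondCountableTopology M]
      [ChartedSpace (EuclideanSpace ℝ (Fin n)) M] [IsManifold (𝓡 n) ∞ M]
      [Bundle.RiemannianBundle (fun x : M => TangentSpace (𝓡 n) x)]
      [IsContMDiffRiemannianBundle (𝓡 n) ∞ (EuclideanSpace ℝ (Fin n))
        (fun x : M => TangentSpace (𝓡 n) x)]
      (α : ∀ x : M, TangentSpace (𝓡 n) x [⋀^Fin q]→L[ℝ] ℝ)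
      (H : ∀ x : M, OrientedPlane (TangentSpace (𝓡 n) x) q),
      IsSmoothForm α → IsSemiCalibration α → IsCalibratedDistribution α H →
      IsZeroPlusTwo α H → IsClosedForm α →
      ∀ (S : Type*) [TopologicalSpace S] [T2Space S] [CompactSpace S]
        [ChartedSpace (EuclideanSpace ℝ (Fin q)) S] [IsManifold (𝓡 q) ∞ S]
        (o : ManifoldOrientation q S) (ι : SmoothImmersion q n S M),
        ι.IsFCalibrated o H α → ι.MinimizesVEAddVolH o H) ∧
    (∀ (M : Type*) [TopologicalSpace M] [T2Space M] [SecondCountableTopology M]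
      [ChartedSpace (EuclideanSpace ℝ (Fin 7)) M] [IsManifold (𝓡 7) ∞ M]
      [Bundle.RiemannianBundle (fun x : M => TangentSpace (𝓡 7) x)]
      [IsContMDiffRiemannianBundle (𝓡 7) ∞ (EuclideanSpace ℝ (Fin 7))
        (fun x : M => TangentSpace (𝓡 7) x)]
      (φ : ∀ x : M, TangentSpace (𝓡 7) x [⋀^Fin 3]→L[ℝ] ℝ)
      (H : ∀ x : M, OrientedPlane (TangentSpace (𝓡 7) x) 3),
      IsSmoothForm φ → IsGTwoStructure φ → IsCalibratedDistribution φ H →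
      IsZeroPlusTwo φ H ∧
      (IsClosedForm φ →
        ∀ (S : Type*) [TopologicalSpace S] [T2Space S] [CompactSpace S]
          [ChartedSpace (EuclideanSpace ℝ (Fin 3)) S] [IsManifold (𝓡 3) ∞ S]
          (o : ManifoldOrientation 3 S) (ι : SmoothImmersion 3 7 S M),
          ι.IsFCalibrated o H φ → ι.MinimizesVEAddVolH o H)) := by
  refine ⟨?_, ?_⟩
  · intro q n M _ _ _ _ _ _ _ α H hα hsc hH hd hcl S _ _ _ _ _ o ι hι
    exact hι.minimizesVEAddVolH hα hsc hH hd hcl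
  · intro M _ _ _ _ _ _ _ φ H hφ hG hH
    refine ⟨hG.isZeroPlusTwo hH, fun hcl S _ _ _ _ _ o ι hι => ?_⟩
    exact hι.minimizesVEAddVolH hφ hG.isSemiCalibration hH (hG.isZeroPlusTwo hH) hcl
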